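/- Let $k$ be a field and let $G=\operatorname{Gr}(2,5)$ be the Grassmannian of $2$-dimensional linear subspaces of $k^5$, a scheme over $k$, with tangent bundle $TG$ (relative to $k$), tautological subbundle $\mathcal S\subset\mathcal O_G^{5}$ of rank $2$ and quotient bundle $\mathcal Q=\mathcal O_G^{5}/\mathcal S$ of rank $3$. Let $\mathcal E=\operatorname{Sym}^5\mathcal S^*$, where $\operatorname{Sym}^5$ is the degree $5$ part of the symmetric algebra. A vector bundle $E$ on $G$ is called relatively orientable if there are a line bundle $L$ on $G$ and an isomorphism $\operatorname{Hom}(\det TG,\det E)\cong L^{\otimes 2}$. Then $TG$ and $\mathcal E$ are vector bundles of rank $6$, and $\mathcal E$ is relatively orientable. More precisely, $L=\det\mathcal Q^*\otimes(\det\mathcal S^*)^{\otimes 6}$ is a line bundle, and there is a canonical isomorphism $$\phi:\operatorname{Hom}(\det TG,\det\mathcal E)\xrightarrow{\ \cong\ }L^{\otimes 2}.$$ Here canonical means that $\phi$ is the unique isomorphism with the following property. Let $U\subseteq G$ be open, let $\xi_0,\xi_1$ be a basis of $\mathcal S^*|_U$, let $q_0,q_1,q_2$ be a basis of $\mathcal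 Q|_U$ with dual basis $\psi_0,\psi_1,\psi_2$ of $\mathcal Q^*|_U$, and let $D_{ji}$ be the vector field on $U$ that corresponds to $\xi_i\otimes q_j$ under the natural isomorphism $TG\cong\mathcal S^*\otimes\mathcal Q\cong\operatorname{Hom}(\mathcal S,\mathcal Q)$, $D\mapsto(s\mapsto Ds \bmod \mathcal S)$, with $D$ acting on the components of $s\in\mathcal S\subset\mathcal O_G^5$. Then $\phi$ sends the homomorphism $$D_{00}\wedge D_{01}\wedge D_{10}\wedge D_{11}\wedge D_{20}\wedge D_{21}\longmapsto \xi_0^5\wedge\xi_0^4\xi_1\wedge\xi_0^3\xi_1^2\wedge\xi_0^2\xi_1^3\wedge\xi_0\xi_1^4\wedge\xi_1^5$$ to $\ell\otimes\ell$, where $\ell=(\psi_0\wedge\psi_1\wedge\psi_2)\otimes(\xi_0\wedge\xi_1)^{\otimes 6}$. -/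

import Mathlib

universe u
open CategoryTheory CategoryTheory.Limits AlgebraicGeometry TopologicalSpace Opposite
open scoped TensorProduct

noncomputable section
namespace Grass

/-! ### The Grassmannian `Gr(d, n)` of `d`-dimensional subspaces of `k^n`

For every `d`-element subset `I` of the `n` coordinates there is a chart, the affine space of
`d × n` matrices whose columns in `I` form the identity matrix. Such a matrix stands for its row
space. The charts `I` and `J` are glued along the loci where the minors `J` and `I` do not vanish,
by `M ↦ (M_J)⁻¹ M`. -/

section Charts
variable (k : Type u) [CommRing k] {d n : ℕ}

/-- Coordinate ring of the chart `I`: one variable for every matrix entry outside the columns `I`. -/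
abbrev ChartRing (I : Fin d ↪o Fin n) : Type u :=
  MvPolynomial (Fin d × {j : Fin n // j ∉ Set.range I}) k

open scoped Classical in
/-- The universal matrix of the chart `I`; its columns in `I` form the identity matrix. -/
def chartMatrix (I : Fin d ↪o Fin n) : Matrix (Fin d) (Fin n) (ChartRing k I) :=
  Matrix.of fun a j =>
    if h : j ∈ Set.range I then (if I a = j then 1 else 0) else MvPolynomial.X (a, ⟨j, h⟩)

/-- The `d × d` minor on the columns `J` of the universal matrix of the chart `I`. -/
def chartMinor (I J : Fin d ↪o Fin n) : ChartRing k I :=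
  ((chartMatrix k I).submatrix id J).det

variable {k}

lemma chartMatrix_self (I : Fin d ↪o Fin n) : (chartMatrix k I).submatrix id I = 1 := by
  ext a b
  simp [chartMatrix, Matrix.one_apply]

lemma chartMinor_self (I : Fin d ↪o Fin n) : chartMinor k I I = 1 := by
  simp [chartMinor, chartMatrix_self]

section Hom
variable {B C : Type u} [CommRing B] [CommRing C]

/-- The matrix of a `B`-valued point of the chart `I`. -/
def pointMatrix {I : Fin d ↪o Fin n} (ρ : ChartRing k I →+* B) : Matrix (Fin d) (Fin n) B :=
  (chartMatrix k I).map ρ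

lemma pointMatrix_self {I : Fin d ↪o Fin n} (ρ : ChartRing k I →+* B) :
    (pointMatrix ρ).submatrix id I = 1 := by
  have := congrArg (fun M => M.map ρ) (chartMatrix_self (k := k) I)
  simpa [pointMatrix, Matrix.submatrix_map] using this

lemma det_pointMatrix {I : Fin d ↪o Fin n} (ρ : ChartRing k I →+* B) (J : Fin d ↪o Fin n) :
    ((pointMatrix ρ).submatrix id J).det = ρ (chartMinor k I J) := by
  rw [chartMinor, RingHom.map_det]; rfl

lemma pointMatrix_of_notMem {I : Fin d ↪o Fin n} (ρ : ChartRing k I →+* B) (a : Fin d)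
    {j : Fin n} (hj : j ∉ Set.range I) :
    pointMatrix ρ a j = ρ (MvPolynomial.X (a, ⟨j, hj⟩)) := by
  have hj' : ¬ ∃ y, I y = j := by simpa using hj
  simp [pointMatrix, chartMatrix, hj']

lemma pointMatrix_comp {I : Fin d ↪o Fin n} (ρ : ChartRing k I →+* B) (g : B →+* C) :
    pointMatrix (g.comp ρ) = (pointMatrix ρ).map g := by
  ext; simp [pointMatrix]

lemma chartHom_ext {I : Fin d ↪o Fin n} {ρ σ : ChartRing k I →+* B}
    (hC : ρ.comp MvPolynomial.C = σ.comp MvPolynomial.C)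
    (hM : pointMatrix ρ = pointMatrix σ) : ρ = σ := by
  apply MvPolynomial.ringHom_ext
  · intro r; exact congrArg (fun f => f r) hC
  · rintro ⟨a, j, hj⟩
    have := congrFun (congrFun hM a) j
    rwa [pointMatrix_of_notMem _ _ hj, pointMatrix_of_notMem _ _ hj] at this

/-- The point of the chart `J` with matrix `(N_J)⁻¹ N`, for a point of the chart `I` with matrix `N`;
it is meaningful when the minor `J` of `N` is invertible. -/
def changeChart {I : Fin d ↪o Fin n} (J : Fin d ↪o Fin n) (ρ : ChartRing k I →+* B) :
    ChartRing k J →+* B :=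
  MvPolynomial.eval₂Hom (ρ.comp MvPolynomial.C)
    fun p => (((pointMatrix ρ).submatrix id J)⁻¹ * pointMatrix ρ) p.1 p.2

lemma changeChart_comp_C {I : Fin d ↪o Fin n} (J : Fin d ↪o Fin n) (ρ : ChartRing k I →+* B) :
    (changeChart J ρ).comp MvPolynomial.C = ρ.comp MvPolynomial.C := by
  ext; simp [changeChart]

lemma pointMatrix_changeChart {I : Fin d ↪o Fin n} (J : Fin d ↪o Fin n) (ρ : ChartRing k I →+* B)
    (h : IsUnit (ρ (chartMinor k I J))) :
    pointMatrix (changeChart J ρ) = ((pointMatrix ρ).submatrix id J)⁻¹ * pointMatrix ρ := by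
  rw [← det_pointMatrix] at h
  set N := pointMatrix ρ with hN
  have key : (((N.submatrix id J)⁻¹ * N).submatrix id J) = 1 := by
    rw [← Matrix.nonsing_inv_mul _ h]; rfl
  ext a j
  by_cases hj : j ∈ Set.range J
  · obtain ⟨b, rfl⟩ := hj
    have := congrFun (congrFun key a) b
    rw [Matrix.submatrix_apply, id] at this
    rw [this]
    exact congrFun (congrFun (pointMatrix_self (changeChart J ρ)) a) b
  · rw [pointMatrix_of_notMem _ _ hj]
    simp [changeChart, ← hN]

lemma comp_changeChart {I : Fin d ↪o Fin n} (J : Fin d ↪o Fin n) (ρ : ChartRing k I →+* B)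
    (h : IsUnit (ρ (chartMinor k I J))) (g : B →+* C) :
    g.comp (changeChart J ρ) = changeChart J (g.comp ρ) := by
  have h' : IsUnit (g.comp ρ (chartMinor k I J)) := h.map g
  refine chartHom_ext ?_ ?_
  · rw [RingHom.comp_assoc, changeChart_comp_C, changeChart_comp_C, RingHom.comp_assoc]
  · rw [pointMatrix_comp, pointMatrix_changeChart _ _ h, pointMatrix_changeChart _ _ h',
      pointMatrix_comp, Matrix.map_mul]
    congr 1
    rw [← det_pointMatrix] at h
    have h2 := h.map g
    rw [RingHom.map_det] at h2
    symm
    apply Matrix.inv_eq_left_inv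
    have := congrArg (fun M => M.map g) (Matrix.nonsing_inv_mul _ h)
    simpa [Matrix.map_mul, Matrix.submatrix_map] using this

lemma changeChart_minor {I : Fin d ↪o Fin n} (J K : Fin d ↪o Fin n) (ρ : ChartRing k I →+* B)
    (h : IsUnit (ρ (chartMinor k I J))) (hK : IsUnit (ρ (chartMinor k I K))) :
    IsUnit (changeChart J ρ (chartMinor k J K)) := by
  rw [← det_pointMatrix, pointMatrix_changeChart _ _ h]
  rw [← det_pointMatrix] at h hK
  have : (((pointMatrix ρ).submatrix id J)⁻¹ * pointMatrix ρ).submatrix id K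
    = ((pointMatrix ρ).submatrix id J)⁻¹ * (pointMatrix ρ).submatrix id K := rfl
  rw [this, Matrix.det_mul]
  exact (Matrix.isUnit_nonsing_inv_det _ h).mul hK

lemma changeChart_changeChart {I : Fin d ↪o Fin n} (J K : Fin d ↪o Fin n)
    (ρ : ChartRing k I →+* B)
    (h : IsUnit (ρ (chartMinor k I J))) (hK : IsUnit (ρ (chartMinor k I K))) :
    changeChart K (changeChart J ρ) = changeChart K ρ := by
  refine chartHom_ext ?_ ?_
  · simp only [changeChart_comp_C]
  · rw [pointMatrix_changeChart _ _ (changeChart_minor J K ρ h hK),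
      pointMatrix_changeChart _ _ hK, pointMatrix_changeChart _ _ h]
    rw [← det_pointMatrix] at h hK
    set N := pointMatrix ρ
    have : ((N.submatrix id J)⁻¹ * N).submatrix id K
      = (N.submatrix id J)⁻¹ * N.submatrix id K := rfl
    rw [this, Matrix.mul_inv_rev, Matrix.nonsing_inv_nonsing_inv _ h, Matrix.mul_assoc,
      ← Matrix.mul_assoc (N.submatrix id J), Matrix.mul_nonsing_inv _ h, Matrix.one_mul]

lemma changeChart_self {I : Fin d ↪o Fin n} (ρ : ChartRing k I →+* B) :
    changeChart I ρ = ρ := by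
  refine chartHom_ext (changeChart_comp_C _ _) ?_
  rw [pointMatrix_changeChart _ _ (by rw [chartMinor_self, map_one]; exact isUnit_one),
    pointMatrix_self, inv_one, Matrix.one_mul]

end Hom
end Charts

section Glue
variable (k : Type u) [CommRing k] {d n : ℕ}

/-- The part of the chart `I` that is shared with the chart `J`: the minor `J` is invertible. -/
abbrev OverlapRing (I J : Fin d ↪o Fin n) : Type u := Localization.Away (chartMinor k I J)

abbrev chart (I : Fin d ↪o Fin n) : Scheme.{u} := Spec (.of (ChartRing k I))

abbrev overlap (I J : Fin d ↪o Fin n) : Scheme.{u} := Spec (.of (OverlapRing k I J))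

abbrev overlapToChart (I J : Fin d ↪o Fin n) : overlap k I J ⟶ chart k I :=
  Spec.map (CommRingCat.ofHom (algebraMap (ChartRing k I) (OverlapRing k I J)))

variable {k}

/-- The ring map of a morphism to a chart. -/
def coords {T : Scheme.{u}} {R : CommRingCat.{u}} (x : T ⟶ Spec R) : R →+* Γ(T, ⊤) :=
  ((Scheme.ΓSpecIso R).inv ≫ x.appTop).hom

lemma coords_injective {T : Scheme.{u}} {R : CommRingCat.{u}} {x y : T ⟶ Spec R}
    (h : coords x = coords y) : x = y := by
  have h' : (Scheme.ΓSpecIso R).inv ≫ x.appTop = (Scheme.ΓSpecIso R).inv ≫ y.appTop :=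
    CommRingCat.hom_ext h
  refine ext_to_Spec ?_
  simpa using h'

/-- The morphism to an affine scheme with a given ring map. -/
def ofCoords {T : Scheme.{u}} {R : CommRingCat.{u}} (φ : R →+* Γ(T, ⊤)) : T ⟶ Spec R :=
  T.toSpecΓ ≫ Spec.map (CommRingCat.ofHom φ)

lemma coords_comp_map {T : Scheme.{u}} {R S : CommRingCat.{u}} (x : T ⟶ Spec S) (g : R ⟶ S) :
    coords (x ≫ Spec.map g) = (coords x).comp g.hom := by
  simp only [coords, Scheme.Hom.comp_appTop, ← CommRingCat.hom_comp]
  rw [← Scheme.ΓSpecIso_inv_naturality_assoc]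

lemma coords_comp {T T' : Scheme.{u}} {R : CommRingCat.{u}} (y : T' ⟶ T) (x : T ⟶ Spec R) :
    coords (y ≫ x) = y.appTop.hom.comp (coords x) := by
  rfl

lemma coords_ofCoords {T : Scheme.{u}} {R : CommRingCat.{u}} (φ : R →+* Γ(T, ⊤)) :
    coords (ofCoords φ) = φ := by
  rw [ofCoords, coords_comp_map]
  simp [coords]

lemma isUnit_minor {T : Scheme.{u}} {I J : Fin d ↪o Fin n} (y : T ⟶ overlap k I J) :
    IsUnit (coords (y ≫ overlapToChart k I J) (chartMinor k I J)) := by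
  rw [coords_comp_map]
  exact (IsLocalization.Away.algebraMap_isUnit (S := OverlapRing k I J)
    (chartMinor k I J)).map (coords y)

/-- A point of a chart at which the minor is invertible is a point of the overlap. -/
def toOverlap {T : Scheme.{u}} {I J : Fin d ↪o Fin n} (ρ : ChartRing k I →+* Γ(T, ⊤))
    (h : IsUnit (ρ (chartMinor k I J))) : T ⟶ overlap k I J :=
  ofCoords (R := .of (OverlapRing k I J))
    (IsLocalization.Away.lift (S := OverlapRing k I J) (chartMinor k I J) h)

lemma coords_toOverlap {T : Scheme.{u}} {I J : Fin d ↪o Fin n} (ρ : ChartRing k I →+* Γ(T, ⊤))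
    (h : IsUnit (ρ (chartMinor k I J))) :
    coords (toOverlap ρ h ≫ overlapToChart k I J) = ρ := by
  rw [coords_comp_map, toOverlap, coords_ofCoords]
  exact IsLocalization.Away.lift_comp _ h

lemma isUnit_algebraMap_minor (I J : Fin d ↪o Fin n) :
    IsUnit (algebraMap (ChartRing k I) (OverlapRing k I J) (chartMinor k I J)) :=
  IsLocalization.Away.algebraMap_isUnit _

lemma isUnit_changeChart_minor {B : Type u} [CommRing B] {I J : Fin d ↪o Fin n}
    (ρ : ChartRing k I →+* B)
    (h : IsUnit (ρ (chartMinor k I J))) : IsUnit (changeChart J ρ (chartMinor k J I)) :=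
  changeChart_minor J I ρ h (by rw [chartMinor_self, map_one]; exact isUnit_one)

variable (k) in
/-- The transition map between the charts `I` and `J`. -/
def transition (I J : Fin d ↪o Fin n) : overlap k I J ⟶ overlap k J I :=
  Spec.map (CommRingCat.ofHom
    (IsLocalization.Away.lift (S := OverlapRing k J I) (chartMinor k J I)
      (isUnit_changeChart_minor _ (isUnit_algebraMap_minor I J))))

lemma coords_transition {T : Scheme.{u}} {I J : Fin d ↪o Fin n} (y : T ⟶ overlap k I J) :
    coords (y ≫ transition k I J ≫ overlapToChart k J I) =
      changeChart J (coords (y ≫ overlapToChart k I J)) := by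
  rw [transition, ← Spec.map_comp, coords_comp_map, coords_comp_map, ← CommRingCat.ofHom_comp,
    IsLocalization.Away.lift_comp]
  exact comp_changeChart _ _ (isUnit_algebraMap_minor I J) _

instance (I : Fin d ↪o Fin n) : IsIso (overlapToChart k I I) := by
  have h : Function.Bijective (algebraMap (ChartRing k I) (OverlapRing k I I)) :=
    (IsLocalization.atUnit (ChartRing k I) (OverlapRing k I I) (chartMinor k I I)
      (by rw [chartMinor_self]; exact isUnit_one)).bijective
  have : IsIso (CommRingCat.ofHom (algebraMap (ChartRing k I) (OverlapRing k I I))) :=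
    (ConcreteCategory.isIso_iff_bijective _).2 h
  infer_instance

instance (I J : Fin d ↪o Fin n) : IsOpenImmersion (overlapToChart k I J) :=
  inferInstanceAs (IsOpenImmersion (Spec.map (CommRingCat.ofHom
    (algebraMap (ChartRing k I) (Localization.Away (chartMinor k I J))))))

section Triple
variable (I J K : Fin d ↪o Fin n)

abbrev triple : Scheme.{u} := pullback (overlapToChart k I J) (overlapToChart k I K)

/-- The coordinates in the chart `I` on a triple overlap. -/
def tripleCoords : ChartRing k I →+* Γ(triple (k := k) I J K, ⊤) :=
  coords (pullback.fst (overlapToChart k I J) (overlapToChart k I K) ≫ overlapToChart k I J)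

lemma isUnit_tripleCoords_left : IsUnit (tripleCoords I J K (chartMinor k I J)) :=
  isUnit_minor _

lemma isUnit_tripleCoords_right : IsUnit (tripleCoords I J K (chartMinor k I K)) := by
  rw [tripleCoords, pullback.condition]
  exact isUnit_minor _

def tripleTransition : triple (k := k) I J K ⟶ triple (k := k) J K I :=
  pullback.lift
    (toOverlap (changeChart J (tripleCoords I J K))
      (changeChart_minor J K _ (isUnit_tripleCoords_left I J K) (isUnit_tripleCoords_right I J K)))
    (pullback.fst _ _ ≫ transition k I J)
    (coords_injective (by
      rw [Category.assoc]
      refine Eq.trans (coords_toOverlap _ _) ?_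
      exact (coords_transition _).symm))

lemma coords_tripleTransition {T : Scheme.{u}} (y : T ⟶ triple (k := k) I J K) :
    coords (y ≫ tripleTransition I J K ≫ pullback.fst _ _ ≫ overlapToChart k J K) =
      changeChart J (coords (y ≫ pullback.fst _ _ ≫ overlapToChart k I J)) := by
  rw [tripleTransition, pullback.lift_fst_assoc]
  refine Eq.trans (coords_comp y _) ?_
  refine Eq.trans (congrArg _ (coords_toOverlap _ _)) ?_
  refine Eq.trans (comp_changeChart _ _ (isUnit_tripleCoords_left I J K) _) ?_
  exact congrArg _ (coords_comp y _).symm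

end Triple

variable (k d n) in
/-- The Grassmannian glue data. -/
def glueData : Scheme.GlueData.{u} where
  J := ULift.{u} (Fin d ↪o Fin n)
  U I := chart k I.down
  V p := overlap k p.1.down p.2.down
  f I J := overlapToChart k I.down J.down
  t I J := transition k I.down J.down
  t' I J K := tripleTransition I.down J.down K.down
  f_open _ _ := inferInstance
  t_id I := by
    rw [← cancel_mono (overlapToChart k I.down I.down)]
    apply coords_injective
    have := coords_transition (𝟙 (overlap k I.down I.down))
    rw [Category.id_comp] at this
    refine this.trans ?_
    rw [changeChart_self]
  t_fac I J K := by
    apply pullback.lift_snd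
  cocycle I J K := by
    rw [← cancel_mono (pullback.fst (overlapToChart k I.down J.down) (overlapToChart k I.down K.down)),
      ← cancel_mono (overlapToChart k I.down J.down)]
    apply coords_injective
    simp only [Category.assoc, Category.id_comp]
    have h1 := isUnit_tripleCoords_left (k := k) I.down J.down K.down
    have h2 := isUnit_tripleCoords_right (k := k) I.down J.down K.down
    have h3 : IsUnit (tripleCoords (k := k) I.down J.down K.down (chartMinor k I.down I.down)) := by
      rw [chartMinor_self, map_one]; exact isUnit_one
    have e1 : coords (tripleTransition I.down J.down K.down ≫ pullback.fst _ _ ≫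
        overlapToChart k J.down K.down) = changeChart J.down (tripleCoords I.down J.down K.down) := by
      simpa [tripleCoords] using coords_tripleTransition I.down J.down K.down (𝟙 (triple (k := k) _ _ _))
    have e2 := coords_tripleTransition J.down K.down I.down
      (tripleTransition (k := k) I.down J.down K.down)
    rw [e1, changeChart_changeChart _ _ _ h1 h2] at e2
    have e3 := coords_tripleTransition K.down I.down J.down
      (tripleTransition (k := k) I.down J.down K.down ≫ tripleTransition J.down K.down I.down)
    simp only [Category.assoc] at e3
    rw [e2, changeChart_changeChart _ _ _ h2 h3, changeChart_self] at e3
    exact e3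

variable (k d n) in
/-- The Grassmannian scheme `Gr(d, n)` over `k`. -/
def Gr : Scheme.{u} := (glueData k d n).glued

variable (k) in
/-- The inclusion of a standard chart. -/
def chartι (I : Fin d ↪o Fin n) : chart k I ⟶ Gr k d n := (glueData k d n).ι ⟨I⟩

instance (I : Fin d ↪o Fin n) : IsOpenImmersion (chartι k I) :=
  (glueData k d n).ι_isOpenImmersion ⟨I⟩

lemma overlap_toBase (I J : Fin d ↪o Fin n) :
    overlapToChart k I J ≫ Spec.map (CommRingCat.ofHom (MvPolynomial.C : k →+* ChartRing k I)) =
      (transition k I J ≫ overlapToChart k J I) ≫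
        Spec.map (CommRingCat.ofHom (MvPolynomial.C : k →+* ChartRing k J)) := by
  have h := coords_transition (𝟙 (overlap k I J))
  rw [Category.id_comp, Category.id_comp] at h
  apply coords_injective
  rw [coords_comp_map, coords_comp_map, h]
  exact (changeChart_comp_C _ _).symm

variable (k d n) in
/-- The structure morphism `Gr(d, n) ⟶ Spec k`. -/
def Gr.toBase : Gr k d n ⟶ Spec (.of k) :=
  Multicoequalizer.desc _ _
    (fun I => Spec.map (CommRingCat.ofHom (MvPolynomial.C : k →+* ChartRing k I.down)))
    (fun p => overlap_toBase p.1.down p.2.down)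

end Glue

/-! ### Exterior and symmetric powers of modules under semilinear maps -/

section Semilinear
variable {R R' : Type u} [CommRing R] [CommRing R'] (σ : R →+* R')
  {M N : Type u} [AddCommGroup M] [Module R M] [AddCommGroup N] [Module R' N]

/-- The map of exterior powers induced by a semilinear map. -/
def extMap (n : ℕ) (f : M →ₛₗ[σ] N) : ⋀[R]^n M →ₛₗ[σ] ⋀[R']^n N :=
  letI : Module R (⋀[R']^n N) := Module.compHom _ σ
  letI φ : M [⋀^Fin n]→ₗ[R] ⋀[R']^n N :=
    { toFun := fun m => exteriorPower.ιMulti R' n (f ∘ m)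
      map_update_add' := by
        intro _ m i x y
        have h : ∀ z, f ∘ Function.update m i z = Function.update (f ∘ m) i (f z) :=
          fun z => Function.comp_update f m i z
        simp only [h, map_add, AlternatingMap.map_update_add]
      map_update_smul' := by
        intro _ m i r x
        have h : ∀ z, f ∘ Function.update m i z = Function.update (f ∘ m) i (f z) :=
          fun z => Function.comp_update f m i z
        simp only [h, LinearMap.map_smulₛₗ, AlternatingMap.map_update_smul]
        rfl
      map_eq_zero_of_eq' := by
        intro m i j hm hij
        exact AlternatingMap.map_eq_zero_of_eq _ _ (by simp [hm]) hij }
  { toFun := exteriorPower.alternatingMapLinearEquiv φ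
    map_add' := map_add _
    map_smul' := fun r x => map_smul (exteriorPower.alternatingMapLinearEquiv φ) r x }

lemma extMap_ιMulti (n : ℕ) (f : M →ₛₗ[σ] N) (m : Fin n → M) :
    extMap σ n f (exteriorPower.ιMulti R n m) = exteriorPower.ιMulti R' n (f ∘ m) := by
  let _ : Module R (⋀[R']^n N) := Module.compHom _ σ
  exact exteriorPower.alternatingMapLinearEquiv_apply_ιMulti _ _

/-- The `n`-th symmetric power: the degree `n` part of the symmetric algebra. -/
abbrev symPart (R : Type u) [CommRing R] (n : ℕ) (M : Type u) [AddCommGroup M] [Module R M] :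
    Submodule R (SymmetricAlgebra R M) :=
  LinearMap.range (SymmetricAlgebra.ι R M) ^ n

lemma symPart_zero : symPart R 0 M = 1 := pow_zero _

lemma symPart_succ (n : ℕ) :
    symPart R (n + 1) M = symPart R n M * LinearMap.range (SymmetricAlgebra.ι R M) := pow_succ _ n

/-- The map of symmetric algebras induced by a semilinear map. -/
def symAlgMap (f : M →ₛₗ[σ] N) : SymmetricAlgebra R M →+* SymmetricAlgebra R' N :=
  letI : Algebra R (SymmetricAlgebra R' N) := ((algebraMap R' _).comp σ).toAlgebra
  (SymmetricAlgebra.lift (R := R)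
    { toFun := fun m => SymmetricAlgebra.ι R' N (f m)
      map_add' := by simp
      map_smul' := fun r m => by
        rw [LinearMap.map_smulₛₗ, map_smul, Algebra.smul_def, Algebra.smul_def]; rfl }).toRingHom

lemma symAlgMap_ι (f : M →ₛₗ[σ] N) (m : M) :
    symAlgMap σ f (SymmetricAlgebra.ι R M m) = SymmetricAlgebra.ι R' N (f m) := by
  let _ : Algebra R (SymmetricAlgebra R' N) := ((algebraMap R' _).comp σ).toAlgebra
  exact SymmetricAlgebra.lift_ι_apply (R := R) (A := SymmetricAlgebra R' N) _ m

lemma symAlgMap_algebraMap (f : M →ₛₗ[σ] N) (r : R) :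
    symAlgMap σ f (algebraMap R _ r) = algebraMap R' _ (σ r) := by
  let _ : Algebra R (SymmetricAlgebra R' N) := ((algebraMap R' _).comp σ).toAlgebra
  exact AlgHom.commutes (SymmetricAlgebra.lift (R := R) _) r

lemma symAlgMap_smul (f : M →ₛₗ[σ] N) (r : R) (x : SymmetricAlgebra R M) :
    symAlgMap σ f (r • x) = σ r • symAlgMap σ f x := by
  rw [Algebra.smul_def, map_mul, symAlgMap_algebraMap, ← Algebra.smul_def]

lemma symAlgMap_mem (n : ℕ) (f : M →ₛₗ[σ] N) {x : SymmetricAlgebra R M}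
    (hx : x ∈ symPart R n M) : symAlgMap σ f x ∈ symPart R' n N := by
  induction n generalizing x with
  | zero =>
    rw [symPart_zero] at hx ⊢
    obtain ⟨r, rfl⟩ := Submodule.mem_one.1 hx
    rw [symAlgMap_algebraMap]
    exact Submodule.mem_one.2 ⟨σ r, rfl⟩
  | succ n ih =>
    rw [symPart_succ] at hx ⊢
    refine Submodule.mul_induction_on hx ?_ ?_
    · rintro a ha _ ⟨m, rfl⟩
      rw [map_mul, symAlgMap_ι]
      exact Submodule.mul_mem_mul (ih ha) ⟨_, rfl⟩
    · intro a b ha hb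
      rw [map_add]
      exact add_mem ha hb

/-- The map of symmetric powers induced by a semilinear map. -/
def symMap (n : ℕ) (f : M →ₛₗ[σ] N) : symPart R n M →ₛₗ[σ] symPart R' n N where
  toFun x := ⟨symAlgMap σ f x, symAlgMap_mem σ n f x.2⟩
  map_add' x y := by ext; simp
  map_smul' r x := by ext; simp [symAlgMap_smul]

lemma symAlgMap_ext {g h : SymmetricAlgebra R M →+* SymmetricAlgebra R' N}
    (h1 : ∀ r, g (algebraMap R _ r) = h (algebraMap R _ r))
    (h2 : ∀ m, g (SymmetricAlgebra.ι R M m) = h (SymmetricAlgebra.ι R M m)) : g = h := by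
  refine RingHom.ext fun x => ?_
  induction x using SymmetricAlgebra.induction with
  | algebraMap r => exact h1 r
  | ι m => exact h2 m
  | mul a b ha hb => rw [map_mul, map_mul, ha, hb]
  | add a b ha hb => rw [map_add, map_add, ha, hb]

/-- A product of `n` elements of `M`, in the `n`-th symmetric power. -/
def symProd {n : ℕ} (v : Fin n → M) : symPart R n M :=
  ⟨∏ i, SymmetricAlgebra.ι R M (v i), by
    induction n with
    | zero => simp
    | succ n ih =>
      rw [Fin.prod_univ_castSucc, symPart_succ]
      exact Submodule.mul_mem_mul (ih _) ⟨_, rfl⟩⟩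

end Semilinear

/-! ### Operations on sheaves of modules

All sheaves are objects of Mathlib's category `X.Modules` of sheaves of `𝒪_X`-modules. -/

section Sheaves
variable {X : Scheme.{u}}

/-- Restriction of functions. -/
abbrev resRing {U V : X.Opens} (h : V ≤ U) : Γ(X, U) →+* Γ(X, V) :=
  (X.presheaf.map (homOfLE h).op).hom

lemma resRing_id (U : X.Opens) (h : U ≤ U) (r : Γ(X, U)) : resRing h r = r := by
  have : X.presheaf.map (homOfLE h).op = 𝟙 _ := X.presheaf.map_id _
  simp only [resRing, this]; rfl

lemma resRing_comp {U V W : X.Opens} (h : V ≤ U) (h' : W ≤ V) (r : Γ(X, U)) :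
    resRing h' (resRing h r) = resRing (h'.trans h) r := by
  have : X.presheaf.map (homOfLE (h'.trans h)).op =
      X.presheaf.map (homOfLE h).op ≫ X.presheaf.map (homOfLE h').op := by
    rw [← Functor.map_comp]; rfl
  simp only [resRing, this]; rfl

/-- Restriction of sections of a sheaf of modules. -/
def res (M : X.Modules) {U V : X.Opens} (h : V ≤ U) : Γ(M, U) →ₛₗ[resRing h] Γ(M, V) where
  toFun := M.presheaf.map (homOfLE h).op
  map_add' := map_add _
  map_smul' r x := M.map_smul (homOfLE h) r x

lemma res_id (M : X.Modules) (U : X.Opens) (h : U ≤ U) (x : Γ(M, U)) : res M h x = x := by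
  have : M.presheaf.map (homOfLE h).op = 𝟙 _ := M.presheaf.map_id _
  change M.presheaf.map (homOfLE h).op x = x
  rw [this]; rfl

lemma res_res (M : X.Modules) {U V W : X.Opens} (h : V ≤ U) (h' : W ≤ V) (x : Γ(M, U)) :
    res M h' (res M h x) = res M (h'.trans h) x := by
  have : M.presheaf.map (homOfLE (h'.trans h)).op =
      M.presheaf.map (homOfLE h).op ≫ M.presheaf.map (homOfLE h').op := by
    rw [← Functor.map_comp]; rfl
  change _ = M.presheaf.map (homOfLE (h'.trans h)).op x
  rw [this]; rfl

variable (X) in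
/-- A presheaf of `𝒪_X`-modules, given by its modules of sections and restriction maps. -/
structure PreMod where
  obj : X.Opens → Type u
  [grp : ∀ U, AddCommGroup (obj U)]
  [mod : ∀ U, Module Γ(X, U) (obj U)]
  res : ∀ {U V : X.Opens} (h : V ≤ U), obj U →ₛₗ[resRing h] obj V
  res_id : ∀ (U : X.Opens) (x : obj U), res le_rfl x = x
  res_res : ∀ {U V W : X.Opens} (h : V ≤ U) (h' : W ≤ V) (x : obj U),
    res h' (res h x) = res (h'.trans h) x

namespace PreMod

attribute [instance] PreMod.grp PreMod.mod

variable (P : PreMod X)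

/-- The underlying presheaf of abelian groups. -/
def toAb : X.Opensᵒᵖ ⥤ Ab.{u} where
  obj U := AddCommGrpCat.of (P.obj U.unop)
  map i := AddCommGrpCat.ofHom (P.res i.unop.le).toAddMonoidHom
  map_id U := by ext x; exact P.res_id _ x
  map_comp i j := by ext x; exact (P.res_res _ _ x).symm

instance (U : X.Opensᵒᵖ) : Module (X.ringCatSheaf.obj.obj U) (P.toAb.obj U) :=
  inferInstanceAs (Module Γ(X, U.unop) (P.obj U.unop))

/-- The associated object of Mathlib's category of presheaves of modules. -/
def toPresheaf : X.PresheafOfModules :=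
  PresheafOfModules.ofPresheaf P.toAb fun _ _ i r m => (P.res i.unop.le).map_smulₛₗ r m

/-- The associated sheaf of modules. -/
def sheafify : X.Modules :=
  (PresheafOfModules.sheafification (𝟙 X.ringCatSheaf.obj)).obj P.toPresheaf

/-- The canonical map to the sheafification. -/
def toSheafify : P.toPresheaf ⟶ P.sheafify.val :=
  (PresheafOfModules.sheafificationAdjunction (𝟙 X.ringCatSheaf.obj)).unit.app P.toPresheaf

/-- The section of the sheafification defined by a section of the presheaf. -/
def toSection {U : X.Opens} (x : P.obj U) : Γ(P.sheafify, U) := P.toSheafify.app (op U) x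

/-- The sheaf condition: compatible families glue uniquely. -/
def UniqueGluing : Prop :=
  ∀ ⦃ι : Type u⦄ (U : ι → X.Opens) (s : ∀ i, P.obj (U i)),
    (∀ i j, P.res (inf_le_left : U i ⊓ U j ≤ U i) (s i) =
      P.res (inf_le_right : U i ⊓ U j ≤ U j) (s j)) →
    ∃! t : P.obj (iSup U), ∀ i, P.res (le_iSup U i) t = s i

variable {P}

/-- A presheaf with unique gluing, as a sheaf of modules. -/
def toSheaf (h : P.UniqueGluing) : X.Modules where
  val := P.toPresheaf
  isSheaf := (TopCat.Presheaf.isSheaf_iff_isSheafUniqueGluing P.toAb).2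
    fun _ U s hs => h U s hs

end PreMod

lemma Modules.existsUnique_gluing (M : X.Modules) {ι : Type u} (U : ι → X.Opens)
    (V : X.Opens) (hUV : ∀ i, U i ≤ V) (hV : V ≤ iSup U) (s : ∀ i, Γ(M, U i))
    (hs : ∀ i j, res M (inf_le_left : U i ⊓ U j ≤ U i) (s i) =
      res M (inf_le_right : U i ⊓ U j ≤ U j) (s j)) :
    ∃! t : Γ(M, V), ∀ i, res M (hUV i) t = s i :=
  TopCat.Sheaf.existsUnique_gluing' ⟨M.presheaf, M.isSheaf⟩ U V (fun i => homOfLE (hUV i)) hV s hs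

lemma Modules.eq_of_locally_eq (M : X.Modules) {ι : Type u} (U : ι → X.Opens)
    (V : X.Opens) (hUV : ∀ i, U i ≤ V) (hV : V ≤ iSup U) {s t : Γ(M, V)}
    (h : ∀ i, res M (hUV i) s = res M (hUV i) t) : s = t := by
  obtain ⟨_, _, hu⟩ := Modules.existsUnique_gluing M U V hUV hV (fun i => res M (hUV i) t)
    (fun i j => by rw [res_res, res_res])
  rw [hu s h, hu t fun _ => rfl]

variable (X) in
/-- The structure sheaf as a module over itself. -/
def structureModule : X.Modules := SheafOfModules.unit X.ringCatSheaf


/-- The tensor product `M ⊗ N`: the sheaf associated with `U ↦ M(U) ⊗ N(U)`. -/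
def tensor (M N : X.Modules) : X.Modules :=
  PreMod.sheafify
    { obj := fun U => Γ(M, U) ⊗[Γ(X, U)] Γ(N, U)
      res := fun h => TensorProduct.map (res M h) (res N h)
      res_id := fun U x => by
        induction x with
        | zero => simp
        | tmul m n => rw [TensorProduct.map_tmul, Grass.res_id, Grass.res_id]
        | add x y hx hy => rw [map_add, hx, hy]
      res_res := fun h h' x => by
        induction x with
        | zero => simp
        | tmul m n => simp only [TensorProduct.map_tmul, Grass.res_res]
        | add x y hx hy => simp only [map_add, hx, hy] }


/-- The section `m ⊗ n`. -/
def tensorSection {M N : X.Modules} {U : X.Opens} (m : Γ(M, U)) (n : Γ(N, U)) :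
    Γ(tensor M N, U) :=
  PreMod.toSection _ (m ⊗ₜ[Γ(X, U)] n : Γ(M, U) ⊗[Γ(X, U)] Γ(N, U))

/-- The tensor power `M^{⊗ n}`. -/
def tensorPow (M : X.Modules) : ℕ → X.Modules
  | 0 => structureModule X
  | n + 1 => tensor (tensorPow M n) M

/-- The section `m ⊗ ⋯ ⊗ m`. -/
def tensorPowSection {M : X.Modules} {U : X.Opens} (m : Γ(M, U)) : ∀ n, Γ(tensorPow M n, U)
  | 0 => (1 : Γ(X, U))
  | n + 1 => tensorSection (tensorPowSection m n) m

/-- The exterior power `⋀ⁿ M`: the sheaf associated with `U ↦ ⋀ⁿ M(U)`. For a vector bundle of rank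
`n` this is its determinant. -/
def extPow (n : ℕ) (M : X.Modules) : X.Modules :=
  PreMod.sheafify
    { obj := fun U => ⋀[Γ(X, U)]^n Γ(M, U)
      res := fun h => extMap (resRing h) n (res M h)
      res_id := fun U x => by
        have hx : x ∈ Submodule.span Γ(X, U) (Set.range (exteriorPower.ιMulti Γ(X, U) n)) := by
          rw [exteriorPower.ιMulti_span]; trivial
        induction hx using Submodule.span_induction with
        | mem x hx =>
          obtain ⟨m, rfl⟩ := hx
          rw [extMap_ιMulti]
          congr 1
          exact funext fun i => Grass.res_id M U _ _
        | zero => simp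
        | add x y _ _ hx hy => rw [map_add, hx, hy]
        | smul r x _ hx => rw [LinearMap.map_smulₛₗ, hx, resRing_id]
      res_res := fun {U V W} h h' x => by
        have hx : x ∈ Submodule.span Γ(X, U) (Set.range (exteriorPower.ιMulti Γ(X, U) n)) := by
          rw [exteriorPower.ιMulti_span]; trivial
        induction hx using Submodule.span_induction with
        | mem x hx =>
          obtain ⟨m, rfl⟩ := hx
          rw [extMap_ιMulti, extMap_ιMulti, extMap_ιMulti]
          congr 1
          exact funext fun i => Grass.res_res M h h' _
        | zero => simp
        | add x y _ _ hx hy => simp only [map_add, hx, hy]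
        | smul r x _ hx => simp only [LinearMap.map_smulₛₗ, hx, resRing_comp] }

/-- The section `m₀ ∧ ⋯ ∧ mₙ₋₁`. -/
def wedge {M : X.Modules} {U : X.Opens} {n : ℕ} (m : Fin n → Γ(M, U)) : Γ(extPow n M, U) :=
  PreMod.toSection _ (exteriorPower.ιMulti Γ(X, U) n m : ⋀[Γ(X, U)]^n Γ(M, U))

/-- The symmetric power `Symⁿ M`: the sheaf associated with `U ↦ Symⁿ M(U)`. -/
def symPow (n : ℕ) (M : X.Modules) : X.Modules :=
  PreMod.sheafify
    { obj := fun U => symPart Γ(X, U) n Γ(M, U)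
      res := fun h => symMap (resRing h) n (res M h)
      res_id := fun U x => by
        have h : symAlgMap (resRing le_rfl) (res M (le_refl U)) = RingHom.id _ :=
          symAlgMap_ext
            (fun r => by rw [symAlgMap_algebraMap, resRing_id]; rfl)
            (fun m => by rw [symAlgMap_ι, Grass.res_id]; rfl)
        exact Subtype.ext (congrArg (fun f => f x.1) h)
      res_res := fun {U V W} h h' x => by
        have h : (symAlgMap (resRing h') (res M h')).comp (symAlgMap (resRing h) (res M h)) =
            symAlgMap (resRing (h'.trans h)) (res M (h'.trans h)) :=
          symAlgMap_ext
            (fun r => by simp only [RingHom.comp_apply, symAlgMap_algebraMap, resRing_comp])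
            (fun m => by simp only [RingHom.comp_apply, symAlgMap_ι, Grass.res_res])
        exact Subtype.ext (congrArg (fun f => f x.1) h) }

/-- The section `m₀ ⋯ mₙ₋₁`. -/
def symSection {M : X.Modules} {U : X.Opens} {n : ℕ} (m : Fin n → Γ(M, U)) :
    Γ(symPow n M, U) :=
  PreMod.toSection _ (symProd m : symPart Γ(X, U) n Γ(M, U))

lemma le_iSup_inf {ι : Type u} {U : ι → X.Opens} {V : X.Opens} (hV : V ≤ iSup U) :
    V ≤ ⨆ i, V ⊓ U i := by
  rw [← inf_iSup_eq]; exact le_inf le_rfl hV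

lemma glueFamily (M N : X.Modules) {ι : Type u} (U : ι → X.Opens)
    (g : ∀ i V, V ≤ U i → Γ(M, V) → Γ(N, V))
    (nat : ∀ i V W (hV : V ≤ U i) (h : W ≤ V) (x : Γ(M, V)),
      g i W (h.trans hV) (res M h x) = res N h (g i V hV x))
    (compat : ∀ i j V (hi : V ≤ U i) (hj : V ≤ U j) x, g i V hi x = g j V hj x) :
    ∃ G : ∀ V, V ≤ iSup U → Γ(M, V) → Γ(N, V),
      (∀ i V (hi : V ≤ U i) (hV : V ≤ iSup U) x, G V hV x = g i V hi x) ∧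
      ∀ V W (hV : V ≤ iSup U) (h : W ≤ V) (x : Γ(M, V)),
        G W (h.trans hV) (res M h x) = res N h (G V hV x) := by
  have key : ∀ V (_ : V ≤ iSup U) (x : Γ(M, V)), ∃ t : Γ(N, V),
      ∀ i, res N (inf_le_left : V ⊓ U i ≤ V) t = g i (V ⊓ U i) inf_le_right (res M inf_le_left x) := by
    intro V hV x
    refine (Modules.existsUnique_gluing N (fun i => V ⊓ U i) V (fun _ => inf_le_left)
      (le_iSup_inf hV) _ ?_).exists
    intro i j
    rw [← nat, ← nat, res_res, res_res]
    exact compat _ _ _ _ _ _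
  choose G hG using key
  have hG' : ∀ V (hV : V ≤ iSup U) x i W (hWV : W ≤ V) (hWi : W ≤ U i),
      res N hWV (G V hV x) = g i W hWi (res M hWV x) := by
    intro V hV x i W hWV hWi
    have := congrArg (res N (le_inf hWV hWi)) (hG V hV x i)
    rw [res_res, ← nat, res_res] at this
    exact this
  refine ⟨G, ?_, ?_⟩
  · intro i V hi hV x
    have := hG' V hV x i V le_rfl hi
    rwa [res_id, res_id] at this
  · intro V W hV h x
    refine Modules.eq_of_locally_eq N (fun i => W ⊓ U i) W (fun _ => inf_le_left)
      (le_iSup_inf (h.trans hV)) fun i => ?_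
    rw [hG, res_res, res_res, hG' V hV x i _ (inf_le_left.trans h) inf_le_right]

/-- A homomorphism `M|_U ⟶ N|_U` of sheaves of modules on `U`. -/
@[ext]
structure LocalHom (M N : X.Modules) (U : X.Opens) where
  app : ∀ V : X.Opens, V ≤ U → Γ(M, V) →ₗ[Γ(X, V)] Γ(N, V)
  naturality : ∀ (V W : X.Opens) (hV : V ≤ U) (h : W ≤ V) (x : Γ(M, V)),
    app W (h.trans hV) (res M h x) = res N h (app V hV x)

namespace LocalHom
variable {M N : X.Modules} {U : X.Opens}

lemma app_injective : Function.Injective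
    (fun (f : LocalHom M N U) (V : {V : X.Opens // V ≤ U}) => f.app V.1 V.2) :=
  fun _ _ h => LocalHom.ext (funext fun V => funext fun hV => congrFun h ⟨V, hV⟩)

instance : Zero (LocalHom M N U) := ⟨⟨fun _ _ => 0, by simp⟩⟩
instance : Add (LocalHom M N U) :=
  ⟨fun f g => ⟨fun V hV => f.app V hV + g.app V hV, by
    intro V W hV h x; simp [f.naturality V W hV h x, g.naturality V W hV h x]⟩⟩
instance : Neg (LocalHom M N U) :=
  ⟨fun f => ⟨fun V hV => -f.app V hV, by
    intro V W hV h x; simp [f.naturality V W hV h x]⟩⟩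
instance : Sub (LocalHom M N U) :=
  ⟨fun f g => ⟨fun V hV => f.app V hV - g.app V hV, by
    intro V W hV h x; simp [f.naturality V W hV h x, g.naturality V W hV h x]⟩⟩
instance : SMul Γ(X, U) (LocalHom M N U) :=
  ⟨fun r f => ⟨fun V hV => resRing hV r • f.app V hV, by
    intro V W hV h x
    rw [LinearMap.smul_apply, LinearMap.smul_apply, LinearMap.map_smulₛₗ, resRing_comp,
      f.naturality]⟩⟩
instance : SMul ℕ (LocalHom M N U) :=
  ⟨fun r f => ⟨fun V hV => r • f.app V hV, by
    intro V W hV h x; simp [f.naturality V W hV h x]⟩⟩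
instance : SMul ℤ (LocalHom M N U) :=
  ⟨fun r f => ⟨fun V hV => r • f.app V hV, by
    intro V W hV h x; simp [f.naturality V W hV h x]⟩⟩

instance : AddCommGroup (LocalHom M N U) :=
  app_injective.addCommGroup _ rfl (fun _ _ => rfl) (fun _ => rfl) (fun _ _ => rfl)
    (fun _ _ => rfl) (fun _ _ => rfl)

lemma add_app (f g : LocalHom M N U) (V hV) : (f + g).app V hV = f.app V hV + g.app V hV := rfl
lemma smul_app (r : Γ(X, U)) (f : LocalHom M N U) (V hV) :
    (r • f).app V hV = resRing hV r • f.app V hV := rfl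

instance : Module Γ(X, U) (LocalHom M N U) where
  one_smul f := by
    apply LocalHom.ext; funext V hV; rw [smul_app, map_one, one_smul]
  mul_smul r s f := by
    apply LocalHom.ext; funext V hV; rw [smul_app, map_mul, mul_smul]; rfl
  smul_zero r := by
    apply LocalHom.ext; funext V hV; exact smul_zero (resRing hV r)
  smul_add r f g := by
    apply LocalHom.ext; funext V hV; exact smul_add (resRing hV r) _ _
  add_smul r s f := by
    apply LocalHom.ext; funext V hV; rw [smul_app, map_add, add_smul]; rfl
  zero_smul f := by
    apply LocalHom.ext; funext V hV; rw [smul_app, map_zero, zero_smul]; rfl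

variable (M N) in
/-- The presheaf of local homomorphisms. -/
def preMod : PreMod X where
  obj U := LocalHom M N U
  res h :=
    { toFun := fun f => ⟨fun V hV => f.app V (hV.trans h), fun V W hV => f.naturality V W _⟩
      map_add' := fun _ _ => rfl
      map_smul' := fun r f => by
        apply LocalHom.ext; funext V hV
        rw [smul_app, smul_app, resRing_comp] }
  res_id _ _ := rfl
  res_res _ _ _ := rfl

lemma uniqueGluing : (preMod M N).UniqueGluing := by
  intro ι U s hs
  have compat : ∀ i j V (hi : V ≤ U i) (hj : V ≤ U j) x,
      (s i).app V hi x = (s j).app V hj x := fun i j V hi hj x =>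
    congrArg (fun f : LocalHom M N (U i ⊓ U j) => f.app V (le_inf hi hj) x) (hs i j)
  obtain ⟨G, hG, hnat⟩ := glueFamily M N U (fun i V hV x => (s i).app V hV x)
    (fun i => (s i).naturality) compat
  refine ⟨⟨fun V hV => { toFun := G V hV, map_add' := ?_, map_smul' := ?_ }, hnat⟩, ?_, ?_⟩
  · intro x y
    refine Modules.eq_of_locally_eq N (fun i => V ⊓ U i) V (fun _ => inf_le_left)
      (le_iSup_inf hV) fun i => ?_
    have h : V ⊓ U i ≤ iSup U := inf_le_left.trans hV
    simp only [← hnat, map_add, hG i _ inf_le_right]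
  · intro r x
    refine Modules.eq_of_locally_eq N (fun i => V ⊓ U i) V (fun _ => inf_le_left)
      (le_iSup_inf hV) fun i => ?_
    simp only [← hnat, LinearMap.map_smulₛₗ, hG i _ inf_le_right, RingHom.id_apply]
  · intro i
    apply LocalHom.ext; funext V hV; ext x
    exact hG i V hV _ x
  · intro t ht
    apply LocalHom.ext; funext V hV; ext x
    refine Modules.eq_of_locally_eq N (fun i => V ⊓ U i) V (fun _ => inf_le_left)
      (le_iSup_inf hV) fun i => ?_
    rw [← t.naturality V _ hV]
    refine Eq.trans ?_ (hnat V _ hV inf_le_left x)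
    rw [hG i _ inf_le_right]
    exact congrArg (fun f : LocalHom M N (U i) => f.app (V ⊓ U i) inf_le_right _) (ht i)

end LocalHom

/-- The sheaf `Hom(M, N)`, with sections `Hom(M|_U, N|_U)` over `U`. -/
def sheafHom (M N : X.Modules) : X.Modules :=
  PreMod.toSheaf (LocalHom.uniqueGluing (M := M) (N := N))

/-- The dual `M^* = Hom(M, 𝒪_X)`. -/
def dual (M : X.Modules) : X.Modules := sheafHom M (structureModule X)

/-- Evaluation of a section of `Hom(M, N)`. -/
def evalHom {M N : X.Modules} {U V : X.Opens} (f : Γ(sheafHom M N, U)) (h : V ≤ U)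
    (x : Γ(M, V)) : Γ(N, V) := LocalHom.app (M := M) (N := N) (U := U) f V h x

/-- Evaluation of a section of the dual. -/
def evalDual {M : X.Modules} {U V : X.Opens} (f : Γ(dual M, U)) (h : V ≤ U) (x : Γ(M, V)) :
    Γ(X, V) := evalHom (N := structureModule X) f h x

/-- A derivation of the sheaf of rings `𝒪_X|_U` that vanishes on functions pulled back from `S`
along `f : X ⟶ S`. -/
@[ext]
structure LocalDer {S : Scheme.{u}} (f : X ⟶ S) (U : X.Opens) where
  app : ∀ V : X.Opens, V ≤ U → Derivation ℤ Γ(X, V) Γ(X, V)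
  naturality : ∀ (V W : X.Opens) (hV : V ≤ U) (h : W ≤ V) (x : Γ(X, V)),
    app W (h.trans hV) (resRing h x) = resRing h (app V hV x)
  map_base : ∀ (V : X.Opens) (hV : V ≤ U) (W : S.Opens) (e : V ≤ f ⁻¹ᵁ W) (a : Γ(S, W)),
    app V hV (f.appLE W V e a) = 0

namespace LocalDer
variable {S : Scheme.{u}} {f : X ⟶ S} {U : X.Opens}

lemma app_injective : Function.Injective
    (fun (D : LocalDer f U) (V : {V : X.Opens // V ≤ U}) => D.app V.1 V.2) :=
  fun _ _ h => LocalDer.ext (funext fun V => funext fun hV => congrFun h ⟨V, hV⟩)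

instance : Zero (LocalDer f U) := ⟨⟨fun _ _ => 0, by simp, by simp⟩⟩
instance : Add (LocalDer f U) :=
  ⟨fun D E => ⟨fun V hV => D.app V hV + E.app V hV, by
    intro V W hV h x
    simp only [Derivation.add_apply, D.naturality V W hV h x, E.naturality V W hV h x, map_add], by
    intro V hV W e a
    rw [Derivation.add_apply, D.map_base, E.map_base, add_zero]⟩⟩
instance : Neg (LocalDer f U) :=
  ⟨fun D => ⟨fun V hV => -D.app V hV, by
    intro V W hV h x
    simp only [Derivation.neg_apply, D.naturality V W hV h x, map_neg], by
    intro V hV W e a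
    rw [Derivation.neg_apply, D.map_base, neg_zero]⟩⟩
instance : Sub (LocalDer f U) :=
  ⟨fun D E => ⟨fun V hV => D.app V hV - E.app V hV, by
    intro V W hV h x
    simp only [Derivation.sub_apply, D.naturality V W hV h x, E.naturality V W hV h x, map_sub], by
    intro V hV W e a
    rw [Derivation.sub_apply, D.map_base, E.map_base, sub_zero]⟩⟩
instance : SMul Γ(X, U) (LocalDer f U) :=
  ⟨fun r D => ⟨fun V hV => resRing hV r • D.app V hV, by
    intro V W hV h x
    simp only [Derivation.smul_apply, smul_eq_mul, map_mul, resRing_comp,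
      D.naturality V W hV h x], by
    intro V hV W e a
    rw [Derivation.smul_apply, D.map_base, smul_zero]⟩⟩
instance : SMul ℕ (LocalDer f U) :=
  ⟨fun r D => ⟨fun V hV => r • D.app V hV, by
    intro V W hV h x
    simp only [Derivation.smul_apply, D.naturality V W hV h x, map_nsmul], by
    intro V hV W e a
    rw [Derivation.smul_apply, D.map_base, smul_zero]⟩⟩
instance : SMul ℤ (LocalDer f U) :=
  ⟨fun r D => ⟨fun V hV => r • D.app V hV, by
    intro V W hV h x
    simp only [Derivation.smul_apply, D.naturality V W hV h x, map_zsmul], by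
    intro V hV W e a
    rw [Derivation.smul_apply, D.map_base, smul_zero]⟩⟩

instance : AddCommGroup (LocalDer f U) :=
  app_injective.addCommGroup _ rfl (fun _ _ => rfl) (fun _ => rfl) (fun _ _ => rfl)
    (fun _ _ => rfl) (fun _ _ => rfl)

lemma smul_app (r : Γ(X, U)) (D : LocalDer f U) (V hV) :
    (r • D).app V hV = resRing hV r • D.app V hV := rfl

instance : Module Γ(X, U) (LocalDer f U) where
  one_smul D := by
    apply LocalDer.ext; funext V hV; rw [smul_app, map_one, one_smul]
  mul_smul r s D := by
    apply LocalDer.ext; funext V hV; rw [smul_app, map_mul, mul_smul]; rfl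
  smul_zero r := by
    apply LocalDer.ext; funext V hV; exact smul_zero (resRing hV r)
  smul_add r D E := by
    apply LocalDer.ext; funext V hV; exact smul_add (resRing hV r) _ _
  add_smul r s D := by
    apply LocalDer.ext; funext V hV; rw [smul_app, map_add, add_smul]; rfl
  zero_smul D := by
    apply LocalDer.ext; funext V hV; rw [smul_app, map_zero, zero_smul]; rfl

variable (f) in
/-- The presheaf of derivations. -/
def preMod : PreMod X where
  obj U := LocalDer f U
  res h :=
    { toFun := fun D => ⟨fun V hV => D.app V (hV.trans h), fun V W hV => D.naturality V W _,
        fun V hV => D.map_base V _⟩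
      map_add' := fun _ _ => rfl
      map_smul' := fun r D => by
        apply LocalDer.ext; funext V hV
        rw [smul_app, smul_app, resRing_comp] }
  res_id _ _ := rfl
  res_res _ _ _ := rfl

lemma eq_of_locally_eq {ι : Type u} {U : ι → X.Opens} {V : X.Opens} (hV : V ≤ iSup U)
    {s t : Γ(X, V)}
    (h : ∀ i, resRing (inf_le_left : V ⊓ U i ≤ V) s = resRing (inf_le_left : V ⊓ U i ≤ V) t) :
    s = t :=
  Modules.eq_of_locally_eq (structureModule X) (fun i => V ⊓ U i) V (fun _ => inf_le_left)
      (le_iSup_inf hV) h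

lemma uniqueGluing : (preMod f).UniqueGluing := by
  intro ι U s hs
  have compat : ∀ i j V (hi : V ≤ U i) (hj : V ≤ U j) x,
      (s i).app V hi x = (s j).app V hj x := fun i j V hi hj x =>
    congrArg (fun D : LocalDer f (U i ⊓ U j) => D.app V (le_inf hi hj) x) (hs i j)
  obtain ⟨G, hG, hnat⟩ : ∃ G : ∀ V : X.Opens, V ≤ iSup U → Γ(X, V) → Γ(X, V),
      (∀ i V (hi : V ≤ U i) (hV : V ≤ iSup U) x, G V hV x = (s i).app V hi x) ∧
      ∀ V W (hV : V ≤ iSup U) (h : W ≤ V) (x : Γ(X, V)),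
        G W (h.trans hV) (resRing h x) = resRing h (G V hV x) :=
    glueFamily (structureModule X) (structureModule X) U (fun i V hV x => (s i).app V hV x)
      (fun i => (s i).naturality) compat
  have hadd : ∀ V (hV : V ≤ iSup U) x y, G V hV (x + y) = G V hV x + G V hV y := by
    intro V hV x y
    refine eq_of_locally_eq hV fun i => ?_
    simp only [← hnat, map_add, hG i _ inf_le_right]
  have hmul : ∀ V (hV : V ≤ iSup U) x y,
      G V hV (x * y) = x * G V hV y + y * G V hV x := by
    intro V hV x y
    refine eq_of_locally_eq hV fun i => ?_
    simp only [map_add, map_mul, ← hnat, hG i _ inf_le_right, Derivation.leibniz, smul_eq_mul]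
  refine ⟨⟨fun V hV => Derivation.mk' (AddMonoidHom.mk' (G V hV) (hadd V hV)).toIntLinearMap
    (hmul V hV), hnat, ?_⟩, ?_, ?_⟩
  · intro V hV W e a
    refine eq_of_locally_eq hV fun i => ?_
    rw [map_zero]
    refine (hnat V _ hV inf_le_left _).symm.trans ?_
    rw [hG i _ inf_le_right]
    refine Eq.trans ?_ ((s i).map_base (V ⊓ U i) inf_le_right W (inf_le_left.trans e) a)
    congr 1
    have := Scheme.Hom.appLE_map f e (homOfLE (inf_le_left : V ⊓ U i ≤ V)).op
    exact congrArg (fun g => g.hom a) this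
  · intro i
    apply LocalDer.ext; funext V hV; ext x
    exact hG i V hV _ x
  · intro t ht
    apply LocalDer.ext; funext V hV; ext x
    refine eq_of_locally_eq hV fun i => ?_
    rw [← t.naturality V _ hV]
    refine Eq.trans ?_ (hnat V _ hV inf_le_left x)
    rw [hG i _ inf_le_right]
    exact congrArg (fun D : LocalDer f (U i) => D.app (V ⊓ U i) inf_le_right _) (ht i)

end LocalDer

/-- The tangent sheaf of `X` over `S`: the sheaf of `𝒪_S`-linear derivations of `𝒪_X`. -/
def tangentSheaf {S : Scheme.{u}} (f : X ⟶ S) : X.Modules :=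
  PreMod.toSheaf (LocalDer.uniqueGluing (f := f))

/-- The action of a vector field on functions. -/
def applyDer {S : Scheme.{u}} {f : X ⟶ S} {U V : X.Opens} (D : Γ(tangentSheaf f, U)) (h : V ≤ U)
    (x : Γ(X, V)) : Γ(X, V) := LocalDer.app (f := f) (U := U) D V h x

/-- Sections `e₀, …, e_{r-1}` of `M` over `U` that form a basis of `M|_U`. -/
def IsFrame {r : ℕ} {M : X.Modules} {U : X.Opens} (e : Fin r → Γ(M, U)) : Prop :=
  ∀ (V : X.Opens) (h : V ≤ U),
    Function.Bijective fun c : Fin r → Γ(X, V) => ∑ i, c i • res M h (e i)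

/-- `M` is locally free of rank `r`. -/
def IsVectorBundle (M : X.Modules) (r : ℕ) : Prop :=
  ∀ x : X, ∃ (U : X.Opens) (e : Fin r → Γ(M, U)), x ∈ U ∧ IsFrame e

/-- Relative orientability of a vector bundle `E` of rank `r` on `X`, where the tangent bundle of `X`
over `S` has rank `d`: there are a line bundle `L` and an isomorphism
`Hom(det TX, det E) ≅ L ⊗ L`. -/
def IsRelativelyOrientable {S : Scheme.{u}} (f : X ⟶ S) (d : ℕ) (E : X.Modules) (r : ℕ) : Prop :=
  IsVectorBundle (tangentSheaf f) d ∧ IsVectorBundle E r ∧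
    ∃ L : X.Modules, IsVectorBundle L 1 ∧
      Nonempty (sheafHom (extPow d (tangentSheaf f)) (extPow r E) ≅ tensor L L)

end Sheaves

/-! ### The tautological bundle and the quotient bundle -/

section Tautological
variable {k : Type u} [CommRing k] {d n : ℕ}

/-- A coordinate function on an open subset of a chart. -/
def chartFn (I : Fin d ↪o Fin n) (W : (chart k I).Opens) : ChartRing k I →+* Γ(chart k I, W) :=
  ((Scheme.ΓSpecIso (.of (ChartRing k I))).inv ≫
    (chart k I).presheaf.map (homOfLE (le_top : W ≤ ⊤)).op).hom

/-- Pull-back of functions from `Gr(d, n)` to a chart. -/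
def chartPull (I : Fin d ↪o Fin n) (U : (Gr k d n).Opens) :
    Γ(Gr k d n, U) →+* Γ(chart k I, chartι k I ⁻¹ᵁ U) :=
  ((chartι k I).app U).hom

lemma resRing_chartFn (I : Fin d ↪o Fin n) {W W' : (chart k I).Opens} (h : W' ≤ W)
    (r : ChartRing k I) : resRing h (chartFn I W r) = chartFn I W' r := by
  have := resRing_comp (X := chart k I) (le_top : W ≤ ⊤) h
    ((Scheme.ΓSpecIso (.of (ChartRing k I))).inv r)
  exact this

lemma chartPull_resRing (I : Fin d ↪o Fin n) {U V : (Gr k d n).Opens} (h : V ≤ U)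
    (x : Γ(Gr k d n, U)) :
    chartPull I V (resRing h x) =
      resRing ((chartι k I).preimage_mono h) (chartPull I U x) :=
  congrArg (fun g => g.hom x) ((chartι k I).naturality (homOfLE h).op)

variable (k d n) in
/-- Sections of the tautological subbundle: vectors that lie on each chart in the row space of the
matrix `M` of the chart. As the columns `I` of `M` form the identity matrix, a vector `s` is in the
row space if and only if `s j = ∑ a, s (I a) * M a j` for all `j`. -/
def tautSections (U : (Gr k d n).Opens) : Submodule Γ(Gr k d n, U) (Fin n → Γ(Gr k d n, U)) where
  carrier := {s | ∀ (I : Fin d ↪o Fin n) (j : Fin n),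
    chartPull I U (s j) = ∑ a, chartPull I U (s (I a)) * chartFn I _ (chartMatrix k I a j)}
  zero_mem' := by intro I j; simp
  add_mem' := by
    intro s t hs ht I j
    simp only [Pi.add_apply, map_add, add_mul, Finset.sum_add_distrib]
    rw [hs, ht]
  smul_mem' := by
    intro r s hs I j
    simp only [Pi.smul_apply, smul_eq_mul, map_mul, mul_assoc, ← Finset.mul_sum]
    rw [hs]

/-- Componentwise restriction. -/
def vecRes {X : Scheme.{u}} (n : ℕ) {U V : X.Opens} (h : V ≤ U) :
    (Fin n → Γ(X, U)) →ₛₗ[resRing h] (Fin n → Γ(X, V)) where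
  toFun s := fun j => resRing h (s j)
  map_add' s t := by ext; simp
  map_smul' r s := by ext; simp

lemma vecRes_mem {U V : (Gr k d n).Opens} (h : V ≤ U) {s : Fin n → Γ(Gr k d n, U)}
    (hs : s ∈ tautSections k d n U) : vecRes n h s ∈ tautSections k d n V := by
  intro I j
  have := congrArg (resRing ((chartι k I).preimage_mono h)) (hs I j)
  simp only [map_sum, map_mul, resRing_chartFn] at this
  change chartPull I V (resRing h (s j)) = ∑ a, chartPull I V (resRing h (s (I a))) * _
  simp only [chartPull_resRing]
  exact this

variable (k d n) in
/-- The presheaf of sections of the tautological subbundle. -/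
def tautPre : PreMod (Gr k d n) where
  obj U := tautSections k d n U
  res h :=
    { toFun := fun s => ⟨vecRes n h s.1, vecRes_mem h s.2⟩
      map_add' := fun s t => Subtype.ext (map_add (vecRes n h) s.1 t.1)
      map_smul' := fun r s => Subtype.ext ((vecRes n h).map_smulₛₗ r s.1) }
  res_id U s := Subtype.ext (funext fun j => resRing_id U _ _)
  res_res h h' s := Subtype.ext (funext fun j => resRing_comp h h' _)

variable (k d n) in
lemma tautPre_uniqueGluing : (tautPre k d n).UniqueGluing := by
  intro ι U s hs
  have hloc : ∀ (I : Fin d ↪o Fin n)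
      {x y : Γ(chart k I, chartι k I ⁻¹ᵁ iSup U)},
      (∀ i, resRing ((chartι k I).preimage_mono (le_iSup U i)) x =
        resRing ((chartι k I).preimage_mono (le_iSup U i)) y) → x = y := by
    intro I x y h
    refine Modules.eq_of_locally_eq (structureModule (chart k I))
      (fun i => chartι k I ⁻¹ᵁ U i) _ (fun i => (chartι k I).preimage_mono (le_iSup U i)) ?_ h
    rw [Scheme.Hom.preimage_iSup]
  have hc : ∀ j : Fin n, ∃! t : Γ(Gr k d n, iSup U), ∀ i, resRing (le_iSup U i) t = (s i).1 j :=
    fun j => Modules.existsUnique_gluing (structureModule (Gr k d n)) U (iSup U)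
      (le_iSup U) le_rfl (fun i => (s i).1 j)
      (fun i i' => congrArg (fun v : tautSections k d n (U i ⊓ U i') => v.1 j) (hs i i'))
  choose t ht hu using hc
  refine ⟨⟨t, ?_⟩, ?_, ?_⟩
  · intro I j
    refine hloc I fun i => ?_
    have e : ∀ j, resRing ((chartι k I).preimage_mono (le_iSup U i)) (chartPull I (iSup U) (t j)) =
        chartPull I (U i) ((s i).1 j) := fun j =>
      (chartPull_resRing I (le_iSup U i) (t j)).symm.trans (congrArg _ (ht j i))
    simp only [map_sum, map_mul, resRing_chartFn]
    rw [e]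
    refine ((s i).2 I j).trans ?_
    refine Finset.sum_congr rfl fun a _ => ?_
    rw [e]
  · intro i
    exact Subtype.ext (funext fun j => ht j i)
  · intro t' ht'
    refine Subtype.ext (funext fun j => hu j _ fun i => ?_)
    exact congrArg (fun v : tautSections k d n (U i) => v.1 j) (ht' i)

variable (k d n) in
/-- The tautological subbundle `S` of the trivial bundle of rank `n` on `Gr(d, n)`. -/
def tautSub : (Gr k d n).Modules := PreMod.toSheaf (tautPre_uniqueGluing k d n)

/-- The components of a section of `S`. -/
def tautSub.vec {U : (Gr k d n).Opens} (s : Γ(tautSub k d n, U)) : Fin n → Γ(Gr k d n, U) :=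
  Subtype.val (p := (· ∈ tautSections k d n U)) s

variable (k d n) in
/-- The presheaf `U ↦ 𝒪(U)^n / S(U)`. -/
def quotPre : PreMod (Gr k d n) where
  obj U := (Fin n → Γ(Gr k d n, U)) ⧸ tautSections k d n U
  res h := Submodule.mapQ _ _ (vecRes n h) fun _ hs => vecRes_mem h hs
  res_id U x := by
    obtain ⟨s, rfl⟩ := Submodule.Quotient.mk_surjective _ x
    rw [Submodule.mapQ_apply]
    congr 1
    exact funext fun j => resRing_id U _ _
  res_res h h' x := by
    obtain ⟨s, rfl⟩ := Submodule.Quotient.mk_surjective _ x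
    rw [Submodule.mapQ_apply, Submodule.mapQ_apply, Submodule.mapQ_apply]
    congr 1
    exact funext fun j => resRing_comp h h' _

variable (k d n) in
/-- The quotient bundle `Q = 𝒪^n / S` on `Gr(d, n)`. -/
def tautQuot : (Gr k d n).Modules := (quotPre k d n).sheafify

/-- The class in `Q` of a vector of functions. -/
def tautQuot.mk {U : (Gr k d n).Opens} (s : Fin n → Γ(Gr k d n, U)) : Γ(tautQuot k d n, U) :=
  (quotPre k d n).toSection (Submodule.Quotient.mk s)

/-- The natural map `T Gr(d, n) ⟶ Hom(S, Q)`, which underlies `T Gr(d, n) ≅ S^* ⊗ Q`: the vector field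
`D` sends a section `s` of `S` to the class of the componentwise derivative `D s`. -/
def derivTaut {U V : (Gr k d n).Opens} (D : Γ(tangentSheaf (Gr.toBase k d n), U)) (h : V ≤ U)
    (s : Γ(tautSub k d n, V)) : Γ(tautQuot k d n, V) :=
  tautQuot.mk fun j => applyDer D h (tautSub.vec s j)

end Tautological

/-! ### The bundles on `G = Gr(2, 5)` -/

section Quintic
variable (k : Type u) [Field k]

/-- `G = Gr(2, 5)`. -/
abbrev G25 : Scheme.{u} := Gr k 2 5
/-- The tangent bundle `TG` over `k`. -/
abbrev TG : (G25 k).Modules := tangentSheaf (Gr.toBase k 2 5)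
/-- The tautological bundle `S`. -/
abbrev bundleS : (G25 k).Modules := tautSub k 2 5
/-- The quotient bundle `Q`. -/
abbrev bundleQ : (G25 k).Modules := tautQuot k 2 5
/-- `E = Sym⁵ S^*`. -/
def bundleE : (G25 k).Modules := symPow 5 (dual (bundleS k))
/-- `L = det Q^* ⊗ (det S^*)^{⊗ 6}`. -/
def bundleL : (G25 k).Modules :=
  tensor (extPow 3 (dual (bundleQ k))) (tensorPow (extPow 2 (dual (bundleS k))) 6)

/-- The section `ξ₀^(5 - i) ξ₁^i` of `E`. -/
def monomialSection {U : (G25 k).Opens} (ξ : Fin 2 → Γ(dual (bundleS k), U)) (i : Fin 6) :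
    Γ(bundleE k, U) :=
  symSection fun b : Fin 5 => if (b : ℕ) + i < 5 then ξ 0 else ξ 1

/-- The section `(ψ₀ ∧ ψ₁ ∧ ψ₂) ⊗ (ξ₀ ∧ ξ₁)^{⊗ 6}` of `L`. -/
def frameSection {U : (G25 k).Opens} (ξ : Fin 2 → Γ(dual (bundleS k), U))
    (ψ : Fin 3 → Γ(dual (bundleQ k), U)) : Γ(bundleL k, U) :=
  tensorSection (wedge ψ) (tensorPowSection (wedge ξ) 6)

/-- The property that pins down the canonical isomorphism `Hom(det TG, det E) ≅ L ⊗ L`. Take local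
bases `ξ₀, ξ₁` of `S^*` and `q₀, q₁, q₂` of `Q`, the dual basis `ψ` of `Q^*`, and the vector fields
`D j i` that correspond to `ξ_i ⊗ q_j` under `TG ≅ S^* ⊗ Q`. Then the homomorphism `ω` with
`D 0 0 ∧ D 0 1 ∧ D 1 0 ∧ D 1 1 ∧ D 2 0 ∧ D 2 1 ↦ ξ₀⁵ ∧ ξ₀⁴ ξ₁ ∧ ξ₀³ ξ₁² ∧ ξ₀² ξ₁³ ∧ ξ₀ ξ₁⁴ ∧ ξ₁⁵`
is sent to `ℓ ⊗ ℓ`, where `ℓ = (ψ₀ ∧ ψ₁ ∧ ψ₂) ⊗ (ξ₀ ∧ ξ₁)^{⊗ 6}`. -/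
def IsCanonical
    (φ : sheafHom (extPow 6 (TG k)) (extPow 6 (bundleE k)) ≅ tensor (bundleL k) (bundleL k)) :
    Prop :=
  ∀ (U : (G25 k).Opens) (ξ : Fin 2 → Γ(dual (bundleS k), U)) (q : Fin 3 → Γ(bundleQ k, U))
    (ψ : Fin 3 → Γ(dual (bundleQ k), U)) (D : Fin 3 → Fin 2 → Γ(TG k, U))
    (ω : Γ(sheafHom (extPow 6 (TG k)) (extPow 6 (bundleE k)), U)),
    IsFrame ξ → IsFrame q →
    (∀ i j, evalDual (ψ i) le_rfl (q j) = if i = j then 1 else 0) →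
    (∀ i j (V : (G25 k).Opens) (h : V ≤ U) (s : Γ(bundleS k, V)),
      derivTaut (D j i) h s = evalDual (ξ i) h s • res (bundleQ k) h (q j)) →
    evalHom ω le_rfl (wedge ![D 0 0, D 0 1, D 1 0, D 1 1, D 2 0, D 2 1]) =
      wedge (monomialSection k ξ) →
    φ.hom.app U ω = tensorSection (frameSection k ξ ψ) (frameSection k ξ ψ)

end Quintic
end Grass

end

/-!
The canonical isomorphism is glued from local generators. Over an open subset `U` with frames `ξ` of
`S^*` and `q` of `Q`, let `ω` be the homomorphism that carries the exterior product of the vector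
fields `D j i` to the exterior product of the quintic monomials in `ξ`, and let `ℓ` be the section of
`L` that `ξ` and the dual basis `ψ` of `q` define. Then `ω` generates `Hom(det TG, det E)` and
`ℓ ⊗ ℓ` generates `L ⊗ L`, and both change by the same factor when the frames change. Indeed, let
`A` and `B` be the matrices that carry `ξ` and `q` to new frames. The vector fields change by the
Kronecker product of `B` and `A`, whose determinant is `det B ^ 2 * det A ^ 3`; the quintic monomials
change by `Sym⁵ A`, whose determinant is `det A ^ 15`; and `ψ` changes by the inverse transpose of
`B`. Hence `ω` changes by `det A ^ 12 * det B ^ (-2)` and `ℓ` by `det A ^ 6 * det B ^ (-1)`. This is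
`IsCanonicalPair.proportional`, and `existsUnique_iso_of_generators` glues the local isomorphisms
`ω ↦ ℓ ⊗ ℓ` to a unique global one.

The determinant of `Sym⁵ A` is computed by the action of `A` on projective Vandermonde matrices
(`det_symMatrix_mul`).

It remains to see that all sheaves involved are locally free, with the expected frames. Frames pass
to tensor products, exterior and symmetric powers and duals, and survive sheafification
(`PreMod.isFrameOn_toSection`). On a chart of the Grassmannian, `S` has the rows of the universal
matrix as a frame (`isFrameOn_tautRow`), where `mem_tautSections_iff` reduces the condition for a
section of `S` to this one chart, and `Q` has the classes of the standard basis vectors outside the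
columns of the chart (`isFrameOn_quotClass`). The tangent sheaf has the partial derivatives with
respect to the coordinates as a frame (`isFrameOn_coordField`): a derivation of the coordinate ring
of an affine open subset extends uniquely to a vector field by the quotient rule
(`LocalDer.ofDerivation`, `LocalDer.ext_affine`). These vector fields correspond to the tensors
`ξ i ⊗ q j` of the frames on the chart (`isAdapted_chart`), and a vector field is determined by the
homomorphism from `S` to `Q` that it defines (`derivTaut_injective`).
-/

noncomputable section
namespace Grass

/-! ### Sections of sheaves and of sheafifications -/

section Locality
variable {X : Scheme.{u}}

lemma Modules.eq_of_forall_mem (M : X.Modules) {V : X.Opens} {s t : Γ(M, V)}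
    (h : ∀ x ∈ V, ∃ (W : X.Opens) (hW : W ≤ V), x ∈ W ∧ res M hW s = res M hW t) : s = t := by
  choose W hW hx he using h
  refine Modules.eq_of_locally_eq M (fun x : V => W x x.2) V (fun x => hW x x.2) ?_ fun x => he x x.2
  intro x hxV
  exact Opens.mem_iSup.2 ⟨⟨x, hxV⟩, hx x hxV⟩

lemma eq_of_forall_mem {V : X.Opens} {s t : Γ(X, V)}
    (h : ∀ x ∈ V, ∃ (W : X.Opens) (hW : W ≤ V), x ∈ W ∧ resRing hW s = resRing hW t) : s = t :=
  Modules.eq_of_forall_mem (structureModule X) h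

/-- Sections that satisfy a property `P` glue if any two of them agree where both are defined and if
they exist near every point. -/
lemma Modules.exists_glue (M : X.Modules) {V : X.Opens} (P : ∀ W : X.Opens, Γ(M, W) → Prop)
    (huniq : ∀ W W' (_ : W ≤ V) (_ : W' ≤ V) (s : Γ(M, W)) (s' : Γ(M, W')), P W s → P W' s' →
      res M (inf_le_left : W ⊓ W' ≤ W) s = res M (inf_le_right : W ⊓ W' ≤ W') s')
    (hex : ∀ x ∈ V, ∃ W ≤ V, x ∈ W ∧ ∃ s, P W s) :
    ∃ t : Γ(M, V), ∀ W (hW : W ≤ V) s, P W s → res M hW t = s := by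
  let ι : Type u := {p : Σ W : X.Opens, Γ(M, W) // p.1 ≤ V ∧ P p.1 p.2}
  obtain ⟨t, ht, -⟩ := Modules.existsUnique_gluing M (ι := ι) (fun p => p.1.1) V (fun p => p.2.1)
    (by
      intro x hx
      obtain ⟨W, hW, hxW, s, hs⟩ := hex x hx
      exact Opens.mem_iSup.2 ⟨⟨⟨W, s⟩, hW, hs⟩, hxW⟩)
    (fun p => p.1.2) (fun p q => huniq _ _ p.2.1 q.2.1 _ _ p.2.2 q.2.2)
  exact ⟨t, fun W hW s hs => ht ⟨⟨W, s⟩, hW, hs⟩⟩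

end Locality

namespace PreMod
variable {X : Scheme.{u}} {P : PreMod X}

lemma toSection_add {U : X.Opens} (x y : P.obj U) :
    P.toSection (x + y) = P.toSection x + P.toSection y :=
  map_add (P.toSheafify.app (op U)).hom x y

lemma toSection_smul {U : X.Opens} (r : Γ(X, U)) (x : P.obj U) :
    P.toSection (r • x) = r • P.toSection x :=
  (P.toSheafify.app (op U)).hom.map_smul r x

variable (P) in
/-- The canonical map to the sections of the sheafification, as a linear map. -/
def toSectionₗ (U : X.Opens) : P.obj U →ₗ[Γ(X, U)] Γ(P.sheafify, U) where
  toFun := P.toSection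
  map_add' := toSection_add
  map_smul' := toSection_smul

lemma res_toSection {U V : X.Opens} (h : V ≤ U) (x : P.obj U) :
    Grass.res P.sheafify h (P.toSection x) = P.toSection (P.res h x) :=
  (PresheafOfModules.naturality_apply P.toSheafify (homOfLE h).op x).symm

/-- Every section of the sheafification comes locally from the presheaf. -/
lemma exists_toSection {U : X.Opens} (s : Γ(P.sheafify, U)) {x : X} (hx : x ∈ U) :
    ∃ (V : X.Opens) (hV : V ≤ U) (y : P.obj V), x ∈ V ∧ P.toSection y = Grass.res _ hV s := by
  have h : Presheaf.IsLocallySurjective (Opens.grothendieckTopology X)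
    (CategoryTheory.toSheafify (Opens.grothendieckTopology X) P.toAb) := inferInstance
  obtain ⟨V, f, ⟨y, hy⟩, hxV⟩ := h.imageSieve_mem (U := U) s x hx
  exact ⟨V, f.le, y, hxV, hy⟩

/-- Sections of the presheaf that agree in the sheafification agree locally. -/
lemma exists_res_eq {U : X.Opens} {y z : P.obj U} (h : P.toSection y = P.toSection z) {x : X}
    (hx : x ∈ U) : ∃ (V : X.Opens) (hV : V ≤ U), x ∈ V ∧ P.res hV y = P.res hV z := by
  have hinj : Presheaf.IsLocallyInjective (Opens.grothendieckTopology X)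
    (CategoryTheory.toSheafify (Opens.grothendieckTopology X) P.toAb) := inferInstance
  obtain ⟨V, f, hV, hxV⟩ := hinj.equalizerSieve_mem (X := op U) y z h x hx
  exact ⟨V, f.le, hxV, hV⟩

end PreMod

/-! ### Frames of sheaves of modules -/

section Frames
variable {X : Scheme.{u}} {ι κ : Type*} [Fintype ι] [Fintype κ]

/-- Sections `e i` of `M` over `U`, with an arbitrary finite index type, that form a basis of
`M|_U`. -/
def IsFrameOn {M : X.Modules} {U : X.Opens} (e : ι → Γ(M, U)) : Prop :=
  ∀ (V : X.Opens) (h : V ≤ U),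
    Function.Bijective fun c : ι → Γ(X, V) => ∑ i, c i • res M h (e i)

/-- Sections of a presheaf of modules that form a basis on every smaller open subset. -/
def PreMod.IsFrameOn {P : PreMod X} {U : X.Opens} (e : ι → P.obj U) : Prop :=
  ∀ (V : X.Opens) (h : V ≤ U),
    Function.Bijective fun c : ι → Γ(X, V) => ∑ i, c i • P.res h (e i)

lemma bijective_of_basis {R N : Type*} [CommRing R] [AddCommGroup N] [Module R N]
    (b : Module.Basis ι R N) {e : ι → N} (h : ∀ i, b i = e i) :
    Function.Bijective fun c : ι → R => ∑ i, c i • e i := by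
  obtain rfl : ⇑b = e := funext h
  convert b.equivFun.symm.bijective using 1
  funext c
  rw [b.equivFun_symm_apply]

/-- The basis of a module with a family of elements in which every element has unique
coordinates. -/
def basisOfBijective {R N : Type*} [CommRing R] [AddCommGroup N] [Module R N] {e : ι → N}
    (h : Function.Bijective fun c : ι → R => ∑ i, c i • e i) : Module.Basis ι R N :=
  .ofEquivFun (LinearEquiv.ofBijective (Fintype.linearCombination R e) h).symm

lemma basisOfBijective_apply {R N : Type*} [CommRing R] [AddCommGroup N] [Module R N] {e : ι → N}
    (h : Function.Bijective fun c : ι → R => ∑ i, c i • e i) (i : ι) :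
    basisOfBijective h i = e i := by
  classical
  rw [basisOfBijective, Module.Basis.coe_ofEquivFun, LinearEquiv.symm_symm]
  change Fintype.linearCombination R e _ = _
  rw [Fintype.linearCombination_apply_single, one_smul]

lemma res_linearCombination {M : X.Modules} {U V W : X.Opens} (e : ι → Γ(M, U)) (h : V ≤ U)
    (h' : W ≤ V) (c : ι → Γ(X, V)) :
    res M h' (∑ i, c i • res M h (e i)) = ∑ i, resRing h' (c i) • res M (h'.trans h) (e i) := by
  rw [map_sum]
  exact Finset.sum_congr rfl fun i _ => by rw [LinearMap.map_smulₛₗ, res_res]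

/-- To be a frame is a local property: coordinates that exist locally glue, because they are
unique. -/
lemma IsFrameOn.of_locally {M : X.Modules} {U : X.Opens} {e : ι → Γ(M, U)}
    (hinj : ∀ (V : X.Opens) (h : V ≤ U),
      Function.Injective fun c : ι → Γ(X, V) => ∑ i, c i • res M h (e i))
    (hsurj : ∀ (V : X.Opens) (h : V ≤ U) (s : Γ(M, V)), ∀ x ∈ V,
      ∃ (W : X.Opens) (hW : W ≤ V) (c : ι → Γ(X, W)), x ∈ W ∧
        ∑ i, c i • res M (hW.trans h) (e i) = res M hW s) : IsFrameOn e := by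
  refine fun V h => ⟨hinj V h, fun s => ?_⟩
  have hglue : ∀ i, ∃ t : Γ(X, V), ∀ (W) (hW : W ≤ V) (r : Γ(X, W)),
      (∃ hW : W ≤ V, ∃ c : ι → Γ(X, W), c i = r ∧
        ∑ i, c i • res M (hW.trans h) (e i) = res M hW s) → resRing hW t = r := by
    intro i
    refine Modules.exists_glue (structureModule X) (V := V) (fun W r =>
      ∃ hW : W ≤ V, ∃ c : ι → Γ(X, W), c i = r ∧
        ∑ i, c i • res M (hW.trans h) (e i) = res M hW s) ?_ ?_
    · rintro W W' hW hW' _ _ ⟨_, c, rfl, hc⟩ ⟨_, c', rfl, hc'⟩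
      have := congrArg (res M (inf_le_left : W ⊓ W' ≤ W)) hc
      have h' := congrArg (res M (inf_le_right : W ⊓ W' ≤ W')) hc'
      rw [res_res, res_linearCombination] at this h'
      exact congrFun (hinj _ _ (this.trans h'.symm)) i
    · intro x hx
      obtain ⟨W, hW, c, hxW, hc⟩ := hsurj V h s x hx
      exact ⟨W, hW, hxW, c i, hW, c, rfl, hc⟩
  choose t ht using hglue
  refine ⟨t, Modules.eq_of_forall_mem _ fun x hx => ?_⟩
  obtain ⟨W, hW, c, hxW, hc⟩ := hsurj V h s x hx
  refine ⟨W, hW, hxW, (res_linearCombination e h hW t).trans ?_⟩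
  refine Eq.trans (Finset.sum_congr rfl fun i _ => ?_) hc
  rw [ht i W hW (c i) ⟨hW, c, rfl, hc⟩]

/-- A basis of a presheaf of modules on all smaller open subsets stays a frame after
sheafification. -/
lemma PreMod.isFrameOn_toSection {P : PreMod X} {U : X.Opens} {e : ι → P.obj U}
    (he : PreMod.IsFrameOn e) :
    Grass.IsFrameOn (M := P.sheafify) (fun i => P.toSection (e i)) := by
  have hsum : ∀ (V : X.Opens) (h : V ≤ U) (c : ι → Γ(X, V)),
      ∑ i, c i • Grass.res P.sheafify h (P.toSection (e i)) =
        P.toSection (∑ i, c i • P.res h (e i)) := by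
    intro V h c
    change _ = P.toSectionₗ V _
    rw [map_sum]
    exact Finset.sum_congr rfl fun i _ => by rw [res_toSection, map_smul]; rfl
  have hres : ∀ (V W : X.Opens) (h : V ≤ U) (h' : W ≤ V) (c : ι → Γ(X, V)),
      P.res h' (∑ i, c i • P.res h (e i)) =
        ∑ i, resRing h' (c i) • P.res (h'.trans h) (e i) := by
    intro V W h h' c
    rw [map_sum]
    exact Finset.sum_congr rfl fun i _ => by rw [LinearMap.map_smulₛₗ, P.res_res]
  refine Grass.IsFrameOn.of_locally (fun V h c c' hcc => ?_) fun V h s x hx => ?_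
  · simp only [hsum] at hcc
    funext i
    refine eq_of_forall_mem fun x hx => ?_
    obtain ⟨W, hW, hxW, h2⟩ := exists_res_eq hcc hx
    rw [hres, hres] at h2
    exact ⟨W, hW, hxW, congrFun ((he W (hW.trans h)).1 h2) i⟩
  · obtain ⟨W, hW, y, hxW, hy⟩ := exists_toSection s hx
    obtain ⟨c, hc⟩ := (he W (hW.trans h)).2 y
    exact ⟨W, hW, c, hxW, by rw [hsum, ← hy]; exact congrArg _ hc⟩

namespace IsFrameOn
variable {M N : X.Modules} {U V W : X.Opens} {e : ι → Γ(M, U)}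

lemma restrict (he : IsFrameOn e) (h : V ≤ U) : IsFrameOn fun i => res M h (e i) := by
  intro W h'
  simpa only [res_res] using he W (h'.trans h)

lemma of_forall_mem
    (h : ∀ x ∈ U, ∃ (V : X.Opens) (hV : V ≤ U), x ∈ V ∧ IsFrameOn fun i => res M hV (e i)) :
    IsFrameOn e := by
  have hloc : ∀ (W : X.Opens) (_ : W ≤ U), ∀ x ∈ W, ∃ (V : X.Opens) (_ : V ≤ W) (h' : V ≤ U),
      x ∈ V ∧ Function.Bijective fun c : ι → Γ(X, V) => ∑ i, c i • res M h' (e i) := by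
    intro W hW x hx
    obtain ⟨V, hV, hxV, hf⟩ := h x (hW hx)
    refine ⟨W ⊓ V, inf_le_left, inf_le_right.trans hV, ⟨hx, hxV⟩, ?_⟩
    simpa only [res_res] using hf (W ⊓ V) inf_le_right
  refine of_locally (fun W hW c c' hcc => ?_) fun W hW s x hx => ?_
  · funext i
    refine eq_of_forall_mem fun x hx => ?_
    obtain ⟨V, hVW, hVU, hxV, hb⟩ := hloc W hW x hx
    have := congrArg (res M hVW) hcc
    simp only [res_linearCombination] at this
    exact ⟨V, hVW, hxV, congrFun (hb.1 (a₁ := fun i => resRing hVW (c i))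
      (a₂ := fun i => resRing hVW (c' i)) this) i⟩
  · obtain ⟨V, hVW, hVU, hxV, hb⟩ := hloc W hW x hx
    obtain ⟨c, hc⟩ := hb.2 (res M hVW s)
    exact ⟨V, hVW, c, hxV, hc⟩

/-- The basis of the module of sections over a smaller open subset that a frame defines. -/
def basis (he : IsFrameOn e) (h : V ≤ U) : Module.Basis ι Γ(X, V) Γ(M, V) :=
  basisOfBijective (he V h)

lemma basis_apply (he : IsFrameOn e) (h : V ≤ U) (i : ι) : he.basis h i = res M h (e i) :=
  basisOfBijective_apply (he V h) i

lemma of_basis (h : ∀ (V : X.Opens) (hV : V ≤ U),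
    ∃ b : Module.Basis ι Γ(X, V) Γ(M, V), ∀ i, b i = res M hV (e i)) : IsFrameOn e := by
  intro V hV
  obtain ⟨b, hb⟩ := h V hV
  exact bijective_of_basis b hb

lemma repr_res (he : IsFrameOn e) (h : V ≤ U) (h' : W ≤ V) (x : Γ(M, V)) (i : ι) :
    (he.basis (h'.trans h)).repr (res M h' x) i = resRing h' ((he.basis h).repr x i) := by
  have hx : res M h' x =
      ∑ i, resRing h' ((he.basis h).repr x i) • he.basis (h'.trans h) i := by
    conv_lhs => rw [← (he.basis h).sum_repr x]
    rw [map_sum]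
    refine Finset.sum_congr rfl fun i _ => ?_
    rw [LinearMap.map_smulₛₗ, basis_apply, basis_apply, res_res]
  rw [hx, Module.Basis.repr_sum_self]

lemma sum_repr (he : IsFrameOn e) (x : Γ(M, U)) :
    ∑ i, (he.basis le_rfl).repr x i • e i = x := by
  conv_rhs => rw [← (he.basis le_rfl).sum_repr x]
  refine Finset.sum_congr rfl fun i _ => ?_
  rw [basis_apply, res_id]

lemma reindex (he : IsFrameOn e) (σ : κ ≃ ι) : IsFrameOn (e ∘ σ) :=
  of_basis fun V hV => ⟨(he.basis hV).reindex σ.symm, fun i => by simp [basis_apply]⟩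

end IsFrameOn
end Frames

/-! ### Top exterior powers of free modules -/

section ExteriorAlgebra
variable {R M : Type*} [CommRing R] [AddCommGroup M] [Module R M] {n : ℕ}

/-- Both sides are alternating in the rows of `A`, and they agree on the identity matrix. -/
lemma ιMulti_linearCombination (A : Matrix (Fin n) (Fin n) R) (m : Fin n → M) :
    exteriorPower.ιMulti R n (fun i => ∑ j, A i j • m j) =
      A.det • exteriorPower.ιMulti R n m := by
  let L : (Fin n → R) →ₗ[R] M := Fintype.linearCombination R m
  let g : (Fin n → R) [⋀^Fin n]→ₗ[R] ⋀[R]^n M :=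
    (LinearMap.toSpanSingleton R _ (exteriorPower.ιMulti R n m)).compAlternatingMap
      Matrix.detRowAlternating
  have key : (exteriorPower.ιMulti R n).compLinearMap L = g := by
    refine Module.Basis.ext_alternating (Pi.basisFun R (Fin n)) fun v hv => ?_
    obtain ⟨σ, rfl⟩ : ∃ σ : Equiv.Perm (Fin n), ⇑σ = v :=
      ⟨Equiv.ofBijective v (Finite.injective_iff_bijective.1 hv), rfl⟩
    have h1 := AlternatingMap.map_perm ((exteriorPower.ιMulti R n).compLinearMap L)
      (Pi.basisFun R (Fin n)) σ
    have h2 := AlternatingMap.map_perm g (Pi.basisFun R (Fin n)) σ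
    refine h1.trans (Eq.trans ?_ h2.symm)
    congr 1
    have e1 : (L ∘ Pi.basisFun R (Fin n)) = m := by
      funext i
      simp [L, Fintype.linearCombination_apply_single]
    have e2 : Matrix.detRowAlternating (⇑(Pi.basisFun R (Fin n))) = (1 : R) := by
      rw [← Matrix.det_one (n := Fin n)]
      change Matrix.det _ = _
      congr 1
      ext i j
      simp [Matrix.one_apply, Pi.single_apply, eq_comm]
    change exteriorPower.ιMulti R n (L ∘ Pi.basisFun R (Fin n)) =
      (Matrix.detRowAlternating (⇑(Pi.basisFun R (Fin n))) : R) • exteriorPower.ιMulti R n m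
    rw [e1, e2, one_smul]
  have e : (fun i => ∑ j, A i j • m j) = ⇑L ∘ fun i => A i := by
    funext i; exact (Fintype.linearCombination_apply R m (A i)).symm
  rw [e]
  exact congrArg (fun f => f fun i => A i) key

/-- The top exterior power of a free module is free of rank one: the determinant with respect to the
basis gives the coordinate. -/
lemma bijective_smul_ιMulti (b : Module.Basis (Fin n) R M) :
    Function.Bijective fun c : R => c • exteriorPower.ιMulti R n b := by
  constructor
  · intro c c' h
    have := congrArg (exteriorPower.alternatingMapLinearEquiv b.det) h
    simpa [exteriorPower.alternatingMapLinearEquiv_apply_ιMulti, b.det_self] using this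
  · intro x
    have hx : x ∈ Submodule.span R (Set.range (exteriorPower.ιMulti R n (M := M))) := by
      rw [exteriorPower.ιMulti_span]; trivial
    induction hx using Submodule.span_induction with
    | mem x hx =>
      obtain ⟨m, rfl⟩ := hx
      refine ⟨(b.toMatrix m).transpose.det, ?_⟩
      change _ • _ = _
      rw [← ιMulti_linearCombination]
      congr 1
      funext i
      exact b.sum_toMatrix_smul_self m i
    | zero => exact ⟨0, zero_smul _ _⟩
    | add x y _ _ hx hy =>
      obtain ⟨c, rfl⟩ := hx
      obtain ⟨d, rfl⟩ := hy
      exact ⟨c + d, add_smul _ _ _⟩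
    | smul r x _ hx =>
      obtain ⟨c, rfl⟩ := hx
      exact ⟨r * c, mul_smul _ _ _⟩

end ExteriorAlgebra

/-! ### Determinants of symmetric powers of matrices of size two -/

section BinaryForms
open Polynomial
open scoped Pointwise
variable {R B : Type*} [CommRing R] [CommRing B] [Algebra R B]

/-- The matrix of the action of a `2 × 2` matrix on binary forms of degree `n`: the row `i` has the
coefficients of `(a u + b v)^(n - i) (c u + d v)^i` with respect to the monomials `u^(n - j) v^j`.
The form is dehomogenized by `u = 1`. -/
def symMatrix (n : ℕ) (A : Matrix (Fin 2) (Fin 2) R) : Matrix (Fin (n + 1)) (Fin (n + 1)) R :=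
  Matrix.of fun i j =>
    ((C (A 0 0) + C (A 0 1) * X) ^ (n - i : ℕ) * (C (A 1 0) + C (A 1 1) * X) ^ (i : ℕ)).coeff j

lemma aeval_homogenize_eq_sum (p : R[X]) (n : ℕ) (u v : B) :
    MvPolynomial.aeval ![v, u] (p.homogenize n) =
      ∑ j : Fin (n + 1), p.coeff j • (u ^ (n - j : ℕ) * v ^ (j : ℕ)) := by
  rw [homogenize, map_sum, Finset.Nat.sum_antidiagonal_eq_sum_range_succ_mk, Finset.sum_range]
  refine Finset.sum_congr rfl fun j _ => ?_
  simp [MvPolynomial.aeval_monomial, Algebra.smul_def, mul_comm (u ^ _), Finsupp.prod_fintype]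

lemma natDegree_C_add_C_mul_X_le (a b : R) : (C a + C b * X).natDegree ≤ 1 := by
  compute_degree

lemma homogenize_linear_pow (a b : R) (n : ℕ) :
    ((C a + C b * X) ^ n).homogenize n = ((C a + C b * X).homogenize 1) ^ n := by
  induction n with
  | zero => simp
  | succ n ih =>
    rw [pow_succ, homogenize_mul _ _ ?_ (natDegree_C_add_C_mul_X_le a b), ih, pow_succ]
    simpa using natDegree_pow_le_of_le n (natDegree_C_add_C_mul_X_le a b)

/-- The defining property of `symMatrix`, in any commutative algebra. -/
lemma linear_pow_mul_linear_pow (n : ℕ) (A : Matrix (Fin 2) (Fin 2) R) (u v : B)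
    (i : Fin (n + 1)) :
    (A 0 0 • u + A 0 1 • v) ^ (n - i : ℕ) * (A 1 0 • u + A 1 1 • v) ^ (i : ℕ) =
      ∑ j : Fin (n + 1), symMatrix n A i j • (u ^ (n - j : ℕ) * v ^ (j : ℕ)) := by
  have h := aeval_homogenize_eq_sum
    ((C (A 0 0) + C (A 0 1) * X) ^ (n - i : ℕ) * (C (A 1 0) + C (A 1 1) * X) ^ (i : ℕ)) n u v
  refine Eq.trans ?_ h
  have key : ∀ p q : ℕ, p + q = n →
      ((C (A 0 0) + C (A 0 1) * X) ^ p * (C (A 1 0) + C (A 1 1) * X) ^ q).homogenize n =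
        ((C (A 0 0) + C (A 0 1) * X).homogenize 1) ^ p *
          ((C (A 1 0) + C (A 1 1) * X).homogenize 1) ^ q := by
    rintro p q rfl
    rw [homogenize_mul _ _ (by simpa using natDegree_pow_le_of_le p (natDegree_C_add_C_mul_X_le _ _))
      (by simpa using natDegree_pow_le_of_le q (natDegree_C_add_C_mul_X_le _ _)),
      homogenize_linear_pow, homogenize_linear_pow]
  rw [key _ _ (by omega)]
  simp [Algebra.smul_def]

lemma symMatrix_map {S : Type*} [CommRing S] (f : R →+* S) (n : ℕ)
    (A : Matrix (Fin 2) (Fin 2) R) : symMatrix n (A.map f) = (symMatrix n A).map f := by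
  ext i j
  simp only [symMatrix, Matrix.of_apply, Matrix.map_apply]
  rw [← Polynomial.coeff_map]
  simp

/-- The action of `A` on binary forms carries the projective Vandermonde matrix of the points
`(u i, v i)` to the one of their images under `A`; this compares the determinants. -/
lemma det_symMatrix_mul (n : ℕ) (A : Matrix (Fin 2) (Fin 2) R) (u v : Fin (n + 1) → R) :
    (symMatrix n A).det * (Matrix.projVandermonde v u).det =
      A.det ^ (∑ i : Fin (n + 1), (Finset.Ioi i).card) * (Matrix.projVandermonde v u).det := by
  have h : Matrix.projVandermonde (fun k => A 1 0 * u k + A 1 1 * v k)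
      (fun k => A 0 0 * u k + A 0 1 * v k) =
      Matrix.projVandermonde v u * (symMatrix n A).transpose := by
    ext k i
    have := linear_pow_mul_linear_pow n A (u k) (v k) i
    simp only [smul_eq_mul] at this
    rw [Matrix.projVandermonde_apply, Matrix.mul_apply, mul_comm]
    have hrev : ∀ i : Fin (n + 1), (i.rev : ℕ) = n - i := fun i => by
      rw [Fin.val_rev]; omega
    rw [hrev, this]
    refine Finset.sum_congr rfl fun j _ => ?_
    rw [Matrix.projVandermonde_apply, Matrix.transpose_apply, hrev]
    ring
  have h2 := congrArg Matrix.det h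
  rw [Matrix.det_mul, Matrix.det_transpose, mul_comm] at h2
  rw [← h2, Matrix.det_projVandermonde, Matrix.det_projVandermonde, ← Finset.prod_pow_eq_pow_sum,
    ← Finset.prod_mul_distrib]
  refine Finset.prod_congr rfl fun i _ => ?_
  rw [← Finset.prod_const, ← Finset.prod_mul_distrib]
  refine Finset.prod_congr rfl fun j _ => ?_
  rw [Matrix.det_fin_two]
  ring

/-- The exponent is `n (n + 1) / 2`. In the universal case the Vandermonde determinant of
`det_symMatrix_mul` can be cancelled, and every matrix is a specialization of the universal one. -/
lemma det_symMatrix (n : ℕ) (A : Matrix (Fin 2) (Fin 2) R) :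
    (symMatrix n A).det = A.det ^ (∑ i : Fin (n + 1), (Finset.Ioi i).card) := by
  let A' : Matrix (Fin 2) (Fin 2) (MvPolynomial (Fin 2 × Fin 2) ℤ) :=
    Matrix.of fun i j => MvPolynomial.X (i, j)
  let f : MvPolynomial (Fin 2 × Fin 2) ℤ →+* R :=
    MvPolynomial.eval₂Hom (Int.castRingHom R) fun p => A p.1 p.2
  have hA : A'.map f = A := by
    ext i j
    simp [A', f]
  have h : (symMatrix n A').det = A'.det ^ (∑ i : Fin (n + 1), (Finset.Ioi i).card) := by
    -- the points `(1, i)` of the projective line have a non-zero Vandermonde determinant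
    refine mul_right_cancel₀ ?_ (det_symMatrix_mul n A' 1 fun i => (i : ℕ))
    rw [← Matrix.vandermonde_eq_projVandermonde, Matrix.det_vandermonde_ne_zero_iff]
    intro i j hij
    have : (i : ℕ) = j := by simpa using hij
    exact Fin.ext this
  have := congrArg f h
  rw [RingHom.map_det, map_pow, RingHom.map_det] at this
  change ((symMatrix n A').map f).det = (A'.map f).det ^ _ at this
  rwa [← symMatrix_map, hA] at this

/-- The products `x ^ (n - i) * y ^ i` form a basis of the `n`-th symmetric power of a free module
with basis `x, y`. -/
lemma bijective_symPart {R M : Type u} [CommRing R] [AddCommGroup M] [Module R M] (n : ℕ)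
    (b : Module.Basis (Fin 2) R M) (m : Fin (n + 1) → symPart R n M)
    (hm : ∀ i, (m i : SymmetricAlgebra R M) = SymmetricAlgebra.ι R M (b 0) ^ (n - i : ℕ) *
      SymmetricAlgebra.ι R M (b 1) ^ (i : ℕ)) :
    Function.Bijective fun c : Fin (n + 1) → R => ∑ i, c i • m i := by
  set x := SymmetricAlgebra.ι R M (b 0)
  set y := SymmetricAlgebra.ι R M (b 1)
  have hli : LinearIndependent R fun i : Fin (n + 1) => x ^ (n - i : ℕ) * y ^ (i : ℕ) := by
    let d : Fin (n + 1) → (Fin 2 →₀ ℕ) := fun i =>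
      Finsupp.single 0 (n - i : ℕ) + Finsupp.single 1 (i : ℕ)
    have hd : Function.Injective d := fun i j h => by
      have := DFunLike.congr_fun h 1
      simpa [d, Fin.ext_iff] using this
    have := b.symmetricAlgebra.linearIndependent.comp d hd
    convert this using 1
    funext i
    have e : (SymmetricAlgebra.equivMvPolynomial b) (x ^ (n - i : ℕ) * y ^ (i : ℕ)) =
        MvPolynomial.monomial (d i) 1 := by
      simp only [map_mul, map_pow, x, y, SymmetricAlgebra.equivMvPolynomial_ι_apply, d,
        MvPolynomial.X_pow_eq_monomial, MvPolynomial.monomial_mul, mul_one]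
    rw [← (SymmetricAlgebra.equivMvPolynomial b).symm_apply_apply (_ * _), e]
    simp [Module.Basis.symmetricAlgebra]
  have hval : ∀ c : Fin (n + 1) → R, ((∑ i, c i • m i : symPart R n M) : SymmetricAlgebra R M) =
      ∑ i, c i • (x ^ (n - i : ℕ) * y ^ (i : ℕ)) := by
    intro c
    simp [hm]
  constructor
  · intro c c' h
    have h' := congrArg (Subtype.val) h
    simp only [hval] at h'
    have := hli.fintypeLinearCombination_injective
    exact this (by simpa [Fintype.linearCombination_apply] using h')
  · intro z
    have hrange : LinearMap.range (SymmetricAlgebra.ι R M) = Submodule.span R {x, y} := by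
      rw [LinearMap.range_eq_map, ← b.span_eq, Submodule.map_span, ← Set.range_comp]
      congr 1
      ext z
      simp [x, y, eq_comm]
    -- a product of `k` elements of `{x, y}` is one of the monomials of degree `k`
    have hpow : ∀ k : ℕ, ∀ z ∈ ({x, y} : Set (SymmetricAlgebra R M)) ^ k,
        ∃ i ≤ k, z = x ^ (k - i) * y ^ i := by
      intro k
      induction k with
      | zero => intro z hz; exact ⟨0, le_rfl, by simpa using hz⟩
      | succ k ih =>
        intro z hz
        rw [pow_succ, Set.mem_mul] at hz
        obtain ⟨w, hw, t, ht, rfl⟩ := hz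
        obtain ⟨i, hi, rfl⟩ := ih w hw
        rcases ht with rfl | rfl
        · refine ⟨i, by omega, ?_⟩
          rw [Nat.succ_sub hi, pow_succ]; ring
        · refine ⟨i + 1, by omega, ?_⟩
          rw [Nat.add_sub_add_right, pow_succ]; ring
    have hz : (z : SymmetricAlgebra R M) ∈
        Submodule.span R (Set.range fun i : Fin (n + 1) => x ^ (n - i : ℕ) * y ^ (i : ℕ)) := by
      have hz := z.2
      change _ ∈ LinearMap.range (SymmetricAlgebra.ι R M) ^ n at hz
      rw [hrange, Submodule.span_pow] at hz
      refine Submodule.span_mono ?_ hz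
      intro w hw
      obtain ⟨i, hi, rfl⟩ := hpow n w hw
      exact ⟨⟨i, by omega⟩, rfl⟩
    obtain ⟨c, hc⟩ := (Submodule.mem_span_range_iff_exists_fun R).1 hz
    exact ⟨c, Subtype.ext ((hval c).trans hc)⟩

end BinaryForms

/-! ### Frames of tensor, exterior and symmetric powers and of sheaves of homomorphisms -/

section Bundles
variable {X : Scheme.{u}} {ι κ : Type*} [Fintype ι] [Fintype κ] {M N : X.Modules} {U : X.Opens}

lemma isFrameOn_one : IsFrameOn (ι := Fin 1) (M := structureModule X) (U := U) (fun _ : Fin 1 => (1 : Γ(X, U))) := by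
  intro V h
  have h1 : res (structureModule X) h (1 : Γ(X, U)) = (1 : Γ(X, V)) := map_one (resRing h)
  have h2 : (fun c : Fin 1 → Γ(X, V) => ∑ i, c i • res (structureModule X) h (1 : Γ(X, U))) =
      fun c => c 0 := by
    funext c
    rw [h1, Fin.sum_univ_one]
    exact mul_one (c 0)
  rw [h2]
  exact (Equiv.funUnique (Fin 1) Γ(X, V)).bijective

lemma IsFrameOn.tensorSection {m : ι → Γ(M, U)} {n : κ → Γ(N, U)} (hm : IsFrameOn m)
    (hn : IsFrameOn n) :
    IsFrameOn fun p : ι × κ => Grass.tensorSection (m p.1) (n p.2) :=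
  PreMod.isFrameOn_toSection fun V h =>
    bijective_of_basis ((hm.basis h).tensorProduct (hn.basis h)) fun p => by
      rw [Module.Basis.tensorProduct_apply, hm.basis_apply, hn.basis_apply]
      rfl

lemma IsFrameOn.wedge {n : ℕ} {m : Fin n → Γ(M, U)} (hm : IsFrameOn m) :
    IsFrameOn fun _ : Fin 1 => Grass.wedge m :=
  PreMod.isFrameOn_toSection fun V h => by
    have h2 : ⇑(hm.basis h) = res M h ∘ m := funext fun i => hm.basis_apply h i
    convert (bijective_smul_ιMulti (hm.basis h)).comp
      (Equiv.funUnique (Fin 1) Γ(X, V)).bijective using 1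
    funext c
    rw [Fin.sum_univ_one, h2]
    exact congrArg (c 0 • ·) (extMap_ιMulti (resRing h) n (res M h) m)

lemma wedge_linearCombination {n : ℕ} (A : Matrix (Fin n) (Fin n) Γ(X, U)) (m : Fin n → Γ(M, U)) :
    wedge (fun i => ∑ j, A i j • m j) = A.det • wedge m := by
  rw [wedge, ιMulti_linearCombination]
  exact PreMod.toSection_smul _ _

lemma res_wedge {V : X.Opens} {n : ℕ} (h : V ≤ U) (m : Fin n → Γ(M, U)) :
    res _ h (wedge m) = wedge fun i => res M h (m i) :=
  (PreMod.res_toSection h _).trans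
    (congrArg (PreMod.toSection _) (extMap_ιMulti (resRing h) n (res M h) m))

lemma res_tensorSection {V : X.Opens} (h : V ≤ U) (m : Γ(M, U)) (n : Γ(N, U)) :
    res _ h (tensorSection m n) = tensorSection (res M h m) (res N h n) :=
  PreMod.res_toSection h _

lemma tensorSection_smul_smul (a b : Γ(X, U)) (m : Γ(M, U)) (n : Γ(N, U)) :
    tensorSection (a • m) (b • n) = (a * b) • tensorSection m n := by
  rw [tensorSection, TensorProduct.smul_tmul_smul]
  exact PreMod.toSection_smul _ _

lemma res_tensorPowSection {V : X.Opens} (h : V ≤ U) (m : Γ(M, U)) (n : ℕ) :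
    res _ h (tensorPowSection m n) = tensorPowSection (res M h m) n := by
  induction n with
  | zero => exact map_one (resRing h)
  | succ n ih => exact (res_tensorSection h _ _).trans (by rw [ih]; rfl)

lemma tensorPowSection_smul (a : Γ(X, U)) (m : Γ(M, U)) (n : ℕ) :
    tensorPowSection (a • m) n = a ^ n • tensorPowSection m n := by
  induction n with
  | zero => rw [pow_zero, one_smul]; rfl
  | succ n ih =>
    change tensorSection (tensorPowSection (a • m) n) (a • m) = _
    rw [ih, tensorSection_smul_smul, ← pow_succ]
    rfl

/-- The tensor product of generators of two line bundles is a generator. -/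
lemma IsFrameOn.tensorSection_single {m : Γ(M, U)} {n : Γ(N, U)}
    (hm : IsFrameOn fun _ : Fin 1 => m) (hn : IsFrameOn fun _ : Fin 1 => n) :
    IsFrameOn fun _ : Fin 1 => Grass.tensorSection m n :=
  (hm.tensorSection hn).reindex (Equiv.prodUnique (Fin 1) (Fin 1)).symm

lemma IsFrameOn.tensorPowSection {m : Γ(M, U)} (hm : IsFrameOn fun _ : Fin 1 => m) (n : ℕ) :
    IsFrameOn fun _ : Fin 1 => Grass.tensorPowSection m n := by
  induction n with
  | zero => exact isFrameOn_one (U := U)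
  | succ n ih => exact ih.tensorSection_single hm

lemma res_symSection {V : X.Opens} {n : ℕ} (h : V ≤ U) (m : Fin n → Γ(M, U)) :
    res _ h (symSection m) = symSection fun i => res M h (m i) := by
  refine (PreMod.res_toSection h _).trans (congrArg (PreMod.toSection _) (Subtype.ext ?_))
  change symAlgMap (resRing h) (res M h) (∏ i : Fin n, _) = ∏ i : Fin n, _
  rw [map_prod]
  exact Finset.prod_congr rfl fun i _ => symAlgMap_ι _ _ _

/-- The product `x₀^(5 - i) x₁^i` in the fifth symmetric power. -/
def quinticMonomial {R L : Type u} [CommRing R] [AddCommGroup L] [Module R L] (x : Fin 2 → L)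
    (i : Fin 6) : symPart R 5 L :=
  symProd fun b : Fin 5 => if (b : ℕ) + i < 5 then x 0 else x 1

lemma coe_quinticMonomial {R L : Type u} [CommRing R] [AddCommGroup L] [Module R L] (x : Fin 2 → L)
    (i : Fin 6) : (quinticMonomial (R := R) x i : SymmetricAlgebra R L) =
      SymmetricAlgebra.ι R L (x 0) ^ (5 - i : ℕ) * SymmetricAlgebra.ι R L (x 1) ^ (i : ℕ) := by
  change ∏ b : Fin 5, SymmetricAlgebra.ι R L (if (b : ℕ) + i < 5 then x 0 else x 1) = _
  fin_cases i <;> simp [Fin.prod_univ_succ] <;> ring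

lemma quinticMonomial_linearCombination {R L : Type u} [CommRing R] [AddCommGroup L] [Module R L]
    (A : Matrix (Fin 2) (Fin 2) R) (x : Fin 2 → L) (i : Fin 6) :
    quinticMonomial (R := R) (fun i => ∑ j, A i j • x j) i =
      ∑ j, symMatrix 5 A i j • quinticMonomial x j := by
  apply Subtype.ext
  have h := linear_pow_mul_linear_pow 5 A (SymmetricAlgebra.ι R L (x 0))
    (SymmetricAlgebra.ι R L (x 1)) i
  rw [coe_quinticMonomial, Submodule.coe_sum]
  simp only [Submodule.coe_smul, coe_quinticMonomial, Fin.sum_univ_two, map_add, map_smul]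
  exact h

/-- The section `x₀^(5 - i) x₁^i` of the fifth symmetric power of `M`. For `M = S^*` it is
`monomialSection` by definition. -/
def quinticSection (x : Fin 2 → Γ(M, U)) (i : Fin 6) : Γ(symPow 5 M, U) :=
  symSection fun b : Fin 5 => if (b : ℕ) + i < 5 then x 0 else x 1

lemma IsFrameOn.quinticSection {x : Fin 2 → Γ(M, U)} (hx : IsFrameOn x) :
    IsFrameOn (Grass.quinticSection x) :=
  PreMod.isFrameOn_toSection fun V h => by
    refine bijective_symPart 5 (hx.basis h) _ fun i => ?_
    rw [hx.basis_apply, hx.basis_apply]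
    refine Eq.trans ?_ (coe_quinticMonomial (fun i => res M h (x i)) i)
    change symAlgMap (resRing h) (res M h) (∏ b : Fin 5, _) = ∏ b : Fin 5, _
    rw [map_prod]
    refine Finset.prod_congr rfl fun b _ => ?_
    rw [symAlgMap_ι]
    dsimp only
    split_ifs <;> rfl

lemma quinticSection_linearCombination (A : Matrix (Fin 2) (Fin 2) Γ(X, U)) (x : Fin 2 → Γ(M, U))
    (i : Fin 6) :
    quinticSection (fun i => ∑ j, A i j • x j) i = ∑ j, symMatrix 5 A i j • quinticSection x j := by
  refine (congrArg (PreMod.toSection _) (quinticMonomial_linearCombination A x i)).trans ?_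
  change PreMod.toSectionₗ _ U _ = _
  rw [map_sum]
  refine Finset.sum_congr rfl fun j _ => ?_
  rw [map_smul]
  rfl

lemma res_quinticSection {V : X.Opens} (h : V ≤ U) (x : Fin 2 → Γ(M, U)) (i : Fin 6) :
    res _ h (quinticSection x i) = quinticSection (fun i => res M h (x i)) i := by
  refine (res_symSection h _).trans (congrArg symSection (funext fun b => ?_))
  split_ifs <;> rfl

/-- The determinant of `Sym⁵` of a change of frame is the fifteenth power of its determinant. -/
lemma wedge_quinticSection_linearCombination (A : Matrix (Fin 2) (Fin 2) Γ(X, U))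
    (x : Fin 2 → Γ(M, U)) :
    wedge (quinticSection fun i => ∑ j, A i j • x j) = A.det ^ 15 • wedge (quinticSection x) := by
  have h : quinticSection (fun i => ∑ j, A i j • x j) =
      fun i => ∑ j, symMatrix 5 A i j • quinticSection x j :=
    funext fun i => quinticSection_linearCombination A x i
  have h15 : ∑ i : Fin (5 + 1), (Finset.Ioi i).card = 15 := by decide
  rw [h, wedge_linearCombination, det_symMatrix, h15]

/-- The coordinates of one frame with respect to another one form an invertible matrix. -/
lemma IsFrameOn.exists_matrix [DecidableEq ι] {e e' : ι → Γ(M, U)} (he : IsFrameOn e)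
    (he' : IsFrameOn e') :
    ∃ A : Matrix ι ι Γ(X, U), IsUnit A.det ∧ e' = fun i => ∑ j, A i j • e j := by
  have hb : ∀ i, he.basis le_rfl i = e i := fun i => (he.basis_apply _ i).trans (res_id M U _ _)
  have hb' : ∀ i, he'.basis le_rfl i = e' i := fun i =>
    (he'.basis_apply _ i).trans (res_id M U _ _)
  refine ⟨((he.basis le_rfl).toMatrix (he'.basis le_rfl)).transpose, ?_, ?_⟩
  · rw [Matrix.det_transpose]
    refine Matrix.isUnit_det_of_right_inverse
      (B := (he'.basis le_rfl).toMatrix (he.basis le_rfl)) ?_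
    exact Module.Basis.toMatrix_mul_toMatrix_flip _ _
  · funext i
    rw [← hb' i, ← (he.basis le_rfl).sum_toMatrix_smul_self (he'.basis le_rfl) i]
    refine Finset.sum_congr rfl fun j _ => ?_
    rw [hb]
    rfl

/-- A matrix with invertible determinant carries a frame to a frame. -/
lemma IsFrameOn.of_matrix [DecidableEq ι] {e : ι → Γ(M, U)} (he : IsFrameOn e)
    {A : Matrix ι ι Γ(X, U)} (hA : IsUnit A.det) : IsFrameOn fun i => ∑ j, A i j • e j := by
  intro V h
  have hA' : IsUnit (A.map (resRing h)) := by
    rw [Matrix.isUnit_iff_isUnit_det]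
    have := hA.map (resRing h)
    rwa [RingHom.map_det] at this
  have hvec : Function.Bijective fun c : ι → Γ(X, V) => Matrix.vecMul c (A.map (resRing h)) :=
    ⟨Matrix.vecMul_injective_of_isUnit hA', Matrix.vecMul_surjective_iff_isUnit.2 hA'⟩
  convert (he V h).comp hvec using 1
  funext c
  simp only [Function.comp_apply, map_sum, LinearMap.map_smulₛₗ, Finset.smul_sum, Matrix.vecMul,
    dotProduct, Finset.sum_smul, Matrix.map_apply, mul_smul]
  exact Finset.sum_comm

/-- The homomorphism on `U` with given values on a frame. -/
def LocalHom.ofFrame {e : ι → Γ(M, U)} (he : IsFrameOn e) (n : ι → Γ(N, U)) : LocalHom M N U where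
  app V hV := (he.basis hV).constr Γ(X, V) fun i => res N hV (n i)
  naturality V W hV h x := by
    rw [Module.Basis.constr_apply_fintype, Module.Basis.constr_apply_fintype, map_sum]
    refine Finset.sum_congr rfl fun i _ => ?_
    rw [LinearMap.map_smulₛₗ, res_res]
    congr 1
    exact he.repr_res hV h x i

lemma LocalHom.ofFrame_apply {e : ι → Γ(M, U)} (he : IsFrameOn e) (n : ι → Γ(N, U)) (i : ι) :
    (LocalHom.ofFrame he n).app U le_rfl (e i) = n i := by
  have h := he.basis_apply le_rfl i
  rw [res_id] at h
  change (he.basis le_rfl).constr Γ(X, U) _ _ = _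
  rw [← h, Module.Basis.constr_basis, res_id]

lemma LocalHom.app_res {V W : X.Opens} (f : LocalHom M N U) (hV : V ≤ U) (h : W ≤ V) (x : Γ(M, V)) :
    f.app W (h.trans hV) (res M h x) = res N h (f.app V hV x) := f.naturality V W hV h x

/-- Homomorphisms that agree on a frame are equal. -/
lemma LocalHom.ext_frame {e : ι → Γ(M, U)} (he : IsFrameOn e) {f g : LocalHom M N U}
    (h : ∀ i, f.app U le_rfl (e i) = g.app U le_rfl (e i)) : f = g := by
  refine LocalHom.ext (funext fun V => funext fun hV => (he.basis hV).ext fun i => ?_)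
  rw [he.basis_apply]
  have := congrArg (res N hV) (h i)
  rwa [← f.app_res, ← g.app_res] at this

lemma evalHom_ext {e : ι → Γ(M, U)} (he : IsFrameOn e) {f g : Γ(sheafHom M N, U)}
    (h : ∀ i, evalHom f le_rfl (e i) = evalHom g le_rfl (e i)) : f = g :=
  LocalHom.ext_frame he h

lemma evalHom_smul {V : X.Opens} (h : V ≤ U) (r : Γ(X, U)) (f : Γ(sheafHom M N, U)) (x : Γ(M, V)) :
    evalHom (r • f) h x = resRing h r • evalHom f h x := rfl

lemma res_evalHom {V W : X.Opens} (h : V ≤ U) (h' : W ≤ V) (f : Γ(sheafHom M N, U)) (x : Γ(M, V)) :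
    res N h' (evalHom f h x) = evalHom f (h'.trans h) (res M h' x) :=
  (LocalHom.app_res (M := M) (N := N) f h h' x).symm

/-- Evaluation of local homomorphisms at a section, as a linear map. -/
def evalHomₗ (x : Γ(M, U)) : Γ(sheafHom M N, U) →ₗ[Γ(X, U)] Γ(N, U) where
  toFun f := evalHom f le_rfl x
  map_add' _ _ := rfl
  map_smul' r f := by
    rw [evalHom_smul, resRing_id]; rfl

/-- The homomorphisms that carry one member of a frame of `M` to the generator of a line bundle `N`
and the other members to zero form a frame of the sheaf of homomorphisms. -/
lemma IsFrameOn.sheafHom [DecidableEq ι] {e : ι → Γ(M, U)} {n : Γ(N, U)} (he : IsFrameOn e)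
    (hn : IsFrameOn fun _ : Fin 1 => n) {f : ι → Γ(sheafHom M N, U)}
    (hf : ∀ i j, evalHom (f i) le_rfl (e j) = if i = j then n else 0) : IsFrameOn f := by
  have key : ∀ V (h : V ≤ U) (c : ι → Γ(X, V)) (j : ι),
      evalHom (∑ i, c i • res _ h (f i)) le_rfl (res M h (e j)) = c j • res N h n := by
    intro V h c j
    change evalHomₗ _ _ = _
    rw [map_sum]
    have : ∀ i, evalHomₗ (res M h (e j)) (c i • res (Grass.sheafHom M N) h (f i)) =
        if i = j then c i • res N h n else 0 := by
      intro i
      rw [map_smul]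
      change _ • evalHom (f i) _ (res M h (e j)) = _
      rw [← res_evalHom le_rfl h, hf]
      split_ifs <;> simp
    simp [this]
  intro V h
  constructor
  · intro c c' hcc
    funext j
    have h1 := congrArg (fun f => evalHom f le_rfl (res M h (e j))) hcc
    simp only [key] at h1
    have h2 := (hn V h).1 (a₁ := fun _ => c j) (a₂ := fun _ => c' j) (by simpa using h1)
    exact congrFun h2 0
  · intro g
    have : ∀ j, ∃ r : Γ(X, V), r • res N h n = evalHom g le_rfl (res M h (e j)) := by
      intro j
      obtain ⟨c, hc⟩ := (hn V h).2 (evalHom g le_rfl (res M h (e j)))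
      exact ⟨c 0, by simpa using hc⟩
    choose c hc using this
    refine ⟨c, LocalHom.ext_frame (he.restrict h) fun j => ?_⟩
    exact (key V h c j).trans (hc j)

/-! ### Homomorphisms of sheaves of modules that are prescribed on generators -/

/-- A homomorphism of sheaves of modules, given by its maps on sections. The open subset `U` is
the whole scheme; the hypothesis `hU` says so in the form that `LocalHom.app` takes. -/
def LocalHom.toHom (f : LocalHom M N U) (hU : ∀ V, V ≤ U) : M ⟶ N :=
  ⟨PresheafOfModules.homMk (M₁ := M.val) (M₂ := N.val)
    { app := fun V => AddCommGrpCat.ofHom (f.app V.unop (hU _)).toAddMonoidHom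
      naturality := fun V W i => by
        ext x
        exact f.naturality V.unop W.unop (hU _) i.unop.le x }
    (fun V r x => (f.app V.unop (hU _)).map_smul r x)⟩

lemma hom_app_res (φ : M ⟶ N) {V : X.Opens} (h : V ≤ U) (x : Γ(M, U)) :
    φ.app V (res M h x) = res N h (φ.app U x) :=
  congrArg (fun g => g x) (φ.mapPresheaf.naturality (homOfLE h).op)

lemma hom_ext_of_generators {φ ψ : M ⟶ N}
    (h : ∀ x : X, ∃ (U : X.Opens) (m : Γ(M, U)), x ∈ U ∧ IsFrameOn (fun _ : Fin 1 => m) ∧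
      φ.app U m = ψ.app U m) : φ = ψ := by
  ext V s
  refine Modules.eq_of_forall_mem N fun x hx => ?_
  obtain ⟨U, m, hxU, hm, he⟩ := h x
  refine ⟨V ⊓ U, inf_le_left, ⟨hx, hxU⟩, ?_⟩
  obtain ⟨c, hc⟩ := (hm (V ⊓ U) inf_le_right).2 (res M inf_le_left s)
  simp only [Fin.sum_univ_one] at hc
  change res N _ (φ.app V s) = res N _ (ψ.app V s)
  rw [← hom_app_res, ← hom_app_res, ← hc, Scheme.Modules.Hom.app_smul,
    Scheme.Modules.Hom.app_smul, hom_app_res, hom_app_res, he]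

/-- Local generators `m` of `M` and local sections `n` of `N`, paired by the relation `C`, define a
homomorphism `m ↦ n` as soon as any two pairs change by the same factor. -/
lemma exists_hom_of_generators (C : ∀ U : X.Opens, Γ(M, U) → Γ(N, U) → Prop)
    (hM : ∀ U m n, C U m n → IsFrameOn fun _ : Fin 1 => m)
    (hC : ∀ U U' m m' n n', C U m n → C U' m' n' → ∃ c : Γ(X, U ⊓ U'),
      res M inf_le_right m' = c • res M inf_le_left m ∧
        res N inf_le_right n' = c • res N inf_le_left n)
    (hcov : ∀ x : X, ∃ U m n, x ∈ U ∧ C U m n) :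
    ∃ φ : M ⟶ N, ∀ U m n, C U m n → φ.app U m = n := by
  let ι : Type u := {p : Σ U : X.Opens, Γ(M, U) × Γ(N, U) // C p.1 p.2.1 p.2.2}
  let V : ι → X.Opens := fun p => p.1.1
  let s : ∀ p : ι, LocalHom M N (V p) := fun p =>
    LocalHom.ofFrame (hM _ _ _ p.2) fun _ => p.1.2.2
  have hs : ∀ p, (s p).app _ le_rfl p.1.2.1 = p.1.2.2 := fun p =>
    LocalHom.ofFrame_apply (hM _ _ _ p.2) _ 0
  have htop : iSup V = ⊤ := by
    refine top_le_iff.1 fun x _ => ?_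
    obtain ⟨U, m, n, hx, h⟩ := hcov x
    exact Opens.mem_iSup.2 ⟨⟨⟨U, m, n⟩, h⟩, hx⟩
  obtain ⟨t, ht, -⟩ := LocalHom.uniqueGluing (M := M) (N := N) V s (by
    intro p q
    refine LocalHom.ext_frame ((hM _ _ _ q.2).restrict (inf_le_right : V p ⊓ V q ≤ V q)) fun _ => ?_
    obtain ⟨c, hc, hc'⟩ := hC _ _ _ _ _ _ p.2 q.2
    have e1 : (s p).app (V p ⊓ V q) inf_le_left (res M inf_le_left p.1.2.1) =
        res N inf_le_left p.1.2.2 :=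
      ((s p).app_res le_rfl inf_le_left _).trans (congrArg _ (hs p))
    have e2 : (s q).app (V p ⊓ V q) inf_le_right (res M inf_le_right q.1.2.1) =
        res N inf_le_right q.1.2.2 :=
      ((s q).app_res le_rfl inf_le_right _).trans (congrArg _ (hs q))
    refine Eq.trans ?_ e2.symm
    refine (congrArg ((s p).app (V p ⊓ V q) inf_le_left) hc).trans ?_
    rw [map_smul, e1, hc'])
  have hle : ∀ W, W ≤ iSup V := fun W => htop ▸ le_top
  refine ⟨LocalHom.toHom t hle, fun U m n h => ?_⟩
  let p : ι := ⟨⟨U, m, n⟩, h⟩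
  have := congrArg (fun f : LocalHom M N (V p) => f.app U le_rfl m) (ht p)
  exact this.trans (hs p)

/-- Local generators of two line bundles that are pairwise proportional with the same factor define
a unique isomorphism between the line bundles. -/
lemma existsUnique_iso_of_generators (C : ∀ U : X.Opens, Γ(M, U) → Γ(N, U) → Prop)
    (hM : ∀ U m n, C U m n → IsFrameOn fun _ : Fin 1 => m)
    (hN : ∀ U m n, C U m n → IsFrameOn fun _ : Fin 1 => n)
    (hC : ∀ U U' m m' n n', C U m n → C U' m' n' → ∃ c : Γ(X, U ⊓ U'),
      res M inf_le_right m' = c • res M inf_le_left m ∧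
        res N inf_le_right n' = c • res N inf_le_left n)
    (hcov : ∀ x : X, ∃ U m n, x ∈ U ∧ C U m n) :
    ∃! φ : M ≅ N, ∀ U m n, C U m n → φ.hom.app U m = n := by
  obtain ⟨φ, hφ⟩ := exists_hom_of_generators C hM hC hcov
  obtain ⟨ψ, hψ⟩ := exists_hom_of_generators (M := N) (N := M) (fun U n m => C U m n)
    (fun U n m => hN U m n)
    (fun U U' n n' m m' h h' => by
      obtain ⟨c, hc, hc'⟩ := hC U U' m m' n n' h h'
      exact ⟨c, hc', hc⟩)
    (fun x => by
      obtain ⟨U, m, n, hx, h⟩ := hcov x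
      exact ⟨U, n, m, hx, h⟩)
  refine ⟨⟨φ, ψ, ?_, ?_⟩, hφ, fun φ' hφ' => Iso.ext ?_⟩
  · refine hom_ext_of_generators fun x => ?_
    obtain ⟨U, m, n, hx, h⟩ := hcov x
    refine ⟨U, m, hx, hM _ _ _ h, ?_⟩
    change ψ.app U (φ.app U m) = m
    rw [hφ _ _ _ h, hψ _ _ _ h]
  · refine hom_ext_of_generators fun x => ?_
    obtain ⟨U, m, n, hx, h⟩ := hcov x
    refine ⟨U, n, hx, hN _ _ _ h, ?_⟩
    change φ.app U (ψ.app U n) = n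
    rw [hψ _ _ _ h, hφ _ _ _ h]
  · refine hom_ext_of_generators fun x => ?_
    obtain ⟨U, m, n, hx, h⟩ := hcov x
    exact ⟨U, m, hx, hM _ _ _ h, (hφ' _ _ _ h).trans (hφ _ _ _ h).symm⟩

end Bundles

/-! ### Coordinate functions on the charts of the Grassmannian -/

section Coordinates
variable {k : Type u} [CommRing k] {d n : ℕ} {U V : (Gr k d n).Opens}

variable (k) in
/-- The open subset of the Grassmannian that is the chart `I`. -/
abbrev chartOpen (I : Fin d ↪o Fin n) : (Gr k d n).Opens := (chartι k I).opensRange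

lemma exists_mem_chartOpen (x : Gr k d n) : ∃ I, x ∈ chartOpen k I := by
  obtain ⟨I, y, hy⟩ := (glueData k d n).ι_jointly_surjective x
  exact ⟨I.down, y, hy⟩

lemma bijective_chartPull (I : Fin d ↪o Fin n) (h : U ≤ chartOpen k I) :
    Function.Bijective (chartPull I U) := by
  have := (chartι k I).isIso_app U h
  exact ConcreteCategory.bijective_of_isIso ((chartι k I).app U)

/-- The coordinate functions of the chart `I`, as functions on an open subset of the Grassmannian
that is contained in the chart. -/
def chartCoord (I : Fin d ↪o Fin n) (h : U ≤ chartOpen k I) : ChartRing k I →+* Γ(Gr k d n, U) :=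
  (RingEquiv.ofBijective (chartPull I U) (bijective_chartPull I h)).symm.toRingHom.comp
    (chartFn I _)

lemma chartPull_chartCoord (I : Fin d ↪o Fin n) (h : U ≤ chartOpen k I) (r : ChartRing k I) :
    chartPull I U (chartCoord I h r) = chartFn I _ r :=
  (RingEquiv.ofBijective (chartPull I U) (bijective_chartPull I h)).apply_symm_apply _

lemma resRing_chartCoord (I : Fin d ↪o Fin n) (h : U ≤ chartOpen k I) (h' : V ≤ U)
    (r : ChartRing k I) : resRing h' (chartCoord I h r) = chartCoord I (h'.trans h) r := by
  apply (bijective_chartPull I (h'.trans h)).1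
  rw [chartPull_resRing, chartPull_chartCoord, chartPull_chartCoord, resRing_chartFn]

lemma chartCoord_bijective (I : Fin d ↪o Fin n) :
    Function.Bijective (chartCoord I (le_refl (chartOpen k I))) := by
  refine (RingEquiv.ofBijective (chartPull I _) (bijective_chartPull I le_rfl)).symm.bijective.comp ?_
  have htop : chartι k I ⁻¹ᵁ chartOpen k I = ⊤ := (chartι k I).preimage_opensRange
  have h1 : Function.Bijective (chartFn I (⊤ : (chart k I).Opens)) := by
    have : IsIso ((chart k I).presheaf.map (homOfLE (le_refl (⊤ : (chart k I).Opens))).op) := by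
      have : homOfLE (le_refl (⊤ : (chart k I).Opens)) = 𝟙 _ := rfl
      rw [this]
      infer_instance
    exact ConcreteCategory.bijective_of_isIso ((Scheme.ΓSpecIso (.of (ChartRing k I))).inv ≫
      (chart k I).presheaf.map (homOfLE (le_refl (⊤ : (chart k I).Opens))).op)
  have h2 : ∀ W : (chart k I).Opens, W = ⊤ → Function.Bijective (chartFn I W) := by
    rintro _ rfl; exact h1
  exact h2 _ htop

/-- A coordinate function of a chart, pulled back along a morphism to the chart. -/
lemma app_chartFn {T : Scheme.{u}} (I : Fin d ↪o Fin n) (f : T ⟶ chart k I) (W : (chart k I).Opens)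
    (r : ChartRing k I) :
    (f.app W).hom (chartFn I W r) = resRing (le_top : f ⁻¹ᵁ W ≤ ⊤) (coords f r) :=
  congrArg (fun g => g.hom ((Scheme.ΓSpecIso (.of (ChartRing k I))).inv.hom r))
    (f.naturality (homOfLE (le_top : W ≤ ⊤)).op)

lemma chart_glue_condition (I J : Fin d ↪o Fin n) :
    (transition k I J ≫ overlapToChart k J I) ≫ chartι k J = overlapToChart k I J ≫ chartι k I := by
  rw [Category.assoc]
  exact (glueData k d n).glue_condition ⟨I⟩ ⟨J⟩

/-- The overlap of the glue data is the intersection of the two charts. -/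
lemma le_opensRange_overlap (I J : Fin d ↪o Fin n) (hI : U ≤ chartOpen k I)
    (hJ : U ≤ chartOpen k J) : U ≤ (overlapToChart k I J ≫ chartι k I).opensRange := by
  intro x hx
  obtain ⟨y, hy⟩ := hI hx
  obtain ⟨z, hz⟩ := hJ hx
  obtain ⟨w, hw, -⟩ := ((glueData k d n).ι_eq_iff ⟨I⟩ ⟨J⟩ y z).1 (hy.trans hz.symm)
  have hw' : overlapToChart k I J w = y := hw
  exact ⟨w, (congrArg (chartι k I) hw').trans hy⟩

lemma overlap_pull_chartCoord {T : Scheme.{u}} (I : Fin d ↪o Fin n) (f : T ⟶ chart k I)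
    (z : T ⟶ Gr k d n) (hz : z = f ≫ chartι k I) (hI : U ≤ chartOpen k I) (r : ChartRing k I) :
    (z.app U).hom (chartCoord I hI r) = resRing (le_top : z ⁻¹ᵁ U ≤ ⊤) (coords f r) := by
  subst hz
  refine Eq.trans ?_ (app_chartFn I f (chartι k I ⁻¹ᵁ U) r)
  rw [Scheme.Hom.comp_app, ← chartPull_chartCoord I hI]
  rfl

lemma isUnit_chartCoord_minor (I J : Fin d ↪o Fin n) (hI : U ≤ chartOpen k I)
    (hJ : U ≤ chartOpen k J) : IsUnit (chartCoord I hI (chartMinor k I J)) := by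
  let z := overlapToChart k I J ≫ chartι k I
  have hz : IsIso (z.app U) := z.isIso_app U (le_opensRange_overlap I J hI hJ)
  refine (isUnit_map_iff (z.app U).hom _).1 ?_
  rw [overlap_pull_chartCoord I (overlapToChart k I J) z rfl]
  refine IsUnit.map _ ?_
  have := isUnit_minor (𝟙 (overlap k I J))
  rwa [Category.id_comp] at this

/-- On the intersection of two charts their coordinates are related by the change of charts. -/
lemma chartCoord_eq_changeChart (I J : Fin d ↪o Fin n) (hI : U ≤ chartOpen k I)
    (hJ : U ≤ chartOpen k J) : chartCoord J hJ = changeChart J (chartCoord I hI) := by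
  let z := overlapToChart k I J ≫ chartι k I
  have hz : IsIso (z.app U) := z.isIso_app U (le_opensRange_overlap I J hI hJ)
  have hinj : Function.Injective (z.app U).hom := (ConcreteCategory.bijective_of_isIso (z.app U)).1
  let ρ : Γ(overlap k I J, ⊤) →+* Γ(overlap k I J, z ⁻¹ᵁ U) := resRing le_top
  have e1 : (z.app U).hom.comp (chartCoord I hI) = ρ.comp (coords (overlapToChart k I J)) :=
    RingHom.ext fun r => overlap_pull_chartCoord I _ z rfl hI r
  have e2 : (z.app U).hom.comp (chartCoord J hJ) =
      ρ.comp (coords (transition k I J ≫ overlapToChart k J I)) :=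
    RingHom.ext fun r => overlap_pull_chartCoord J _ z (chart_glue_condition I J).symm hJ r
  have e3 := coords_transition (𝟙 (overlap k I J))
  rw [Category.id_comp, Category.id_comp] at e3
  have hu : IsUnit (coords (overlapToChart k I J) (chartMinor k I J)) := by
    have := isUnit_minor (𝟙 (overlap k I J))
    rwa [Category.id_comp] at this
  refine RingHom.ext fun r => hinj ?_
  have e4 : (z.app U).hom.comp (chartCoord J hJ) =
      (z.app U).hom.comp (changeChart J (chartCoord I hI)) := by
    rw [e2, e3, comp_changeChart J _ hu, ← e1,
      comp_changeChart J _ (isUnit_chartCoord_minor I J hI hJ)]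
  exact congrArg (fun g => g r) e4

end Coordinates

/-! ### Frames of the tautological bundle and of the quotient bundle over a chart -/

section TautologicalFrames
variable {k : Type u} [CommRing k] {d n : ℕ} {U V : (Gr k d n).Opens}

/-- The universal matrix of the chart `I`, over an open subset of the chart. -/
def coordMatrix (I : Fin d ↪o Fin n) (h : U ≤ chartOpen k I) : Matrix (Fin d) (Fin n) Γ(Gr k d n, U) :=
  pointMatrix (chartCoord I h)

lemma coordMatrix_self (I : Fin d ↪o Fin n) (h : U ≤ chartOpen k I) (a b : Fin d) :
    coordMatrix I h a (I b) = if a = b then 1 else 0 :=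
  congrFun (congrFun (pointMatrix_self (chartCoord I h)) a) b

lemma resRing_coordMatrix (I : Fin d ↪o Fin n) (h : U ≤ chartOpen k I) (h' : V ≤ U) (a : Fin d)
    (j : Fin n) : resRing h' (coordMatrix I h a j) = coordMatrix I (h'.trans h) a j :=
  resRing_chartCoord I h h' _

lemma resRing_injective_of_le {X : Scheme.{u}} {U V : X.Opens} (h : V ≤ U) (h' : U ≤ V) :
    Function.Injective (resRing h) := by
  intro x y hxy
  have := congrArg (resRing h') hxy
  rwa [resRing_comp, resRing_comp, resRing_id, resRing_id] at this

/-- Over an open subset of one chart, the condition on that chart implies the other ones. -/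
lemma mem_tautSections_iff (I : Fin d ↪o Fin n) (h : U ≤ chartOpen k I)
    (s : Fin n → Γ(Gr k d n, U)) :
    s ∈ tautSections k d n U ↔ ∀ j, s j = ∑ a, s (I a) * coordMatrix I h a j := by
  constructor
  · intro hs j
    apply (bijective_chartPull I h).1
    rw [hs I j, map_sum]
    refine Finset.sum_congr rfl fun a _ => ?_
    rw [map_mul]
    exact congrArg _ (chartPull_chartCoord I h _).symm
  · intro hs J j
    -- the condition for `J` only concerns `U ∩ J`, which is contained in both charts
    let W := U ⊓ chartOpen k J
    have hWU : W ≤ U := inf_le_left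
    have hWJ : W ≤ chartOpen k J := inf_le_right
    have hWI : W ≤ chartOpen k I := hWU.trans h
    have hle : chartι k J ⁻¹ᵁ U ≤ chartι k J ⁻¹ᵁ W := fun x hx => ⟨hx, ⟨x, rfl⟩⟩
    apply resRing_injective_of_le ((chartι k J).preimage_mono hWU) hle
    let t : Fin n → Γ(Gr k d n, W) := fun j => resRing hWU (s j)
    have ht : ∀ j, resRing ((chartι k J).preimage_mono hWU) (chartPull J U (s j)) =
        chartPull J W (t j) := fun j => (chartPull_resRing J hWU (s j)).symm
    simp only [map_sum, map_mul, resRing_chartFn, ht]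
    have h1 : t = Matrix.vecMul (t ∘ I) (coordMatrix I hWI) := by
      funext j
      have := congrArg (resRing hWU) (hs j)
      simp only [map_sum, map_mul, resRing_coordMatrix] at this
      exact this
    have hu := isUnit_chartCoord_minor I J hWI hWJ
    have h2 : coordMatrix J hWJ =
        ((coordMatrix I hWI).submatrix id J)⁻¹ * coordMatrix I hWI := by
      rw [coordMatrix, chartCoord_eq_changeChart I J hWI hWJ, pointMatrix_changeChart _ _ hu]
      rfl
    have h3 : t ∘ J = Matrix.vecMul (t ∘ I) ((coordMatrix I hWI).submatrix id J) := by
      funext b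
      exact congrFun h1 (J b)
    rw [← det_pointMatrix] at hu
    have h4 : t = Matrix.vecMul (t ∘ J) (coordMatrix J hWJ) := by
      rw [h2, h3, Matrix.vecMul_vecMul, ← Matrix.mul_assoc]
      refine h1.trans ?_
      congr 1
      exact (congrArg (· * coordMatrix I hWI) (Matrix.mul_nonsing_inv _ hu)).trans
        (Matrix.one_mul _) |>.symm
    have h5 := congrArg (chartPull J W) (congrFun h4 j)
    refine h5.trans ?_
    rw [Matrix.vecMul, dotProduct, map_sum]
    refine Finset.sum_congr rfl fun a _ => ?_
    rw [map_mul]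
    exact congrArg _ (chartPull_chartCoord J hWJ _)

/-- The rows of the universal matrix, as sections of the tautological bundle over a chart. -/
def tautRow (I : Fin d ↪o Fin n) (h : U ≤ chartOpen k I) (a : Fin d) : Γ(tautSub k d n, U) :=
  (⟨coordMatrix I h a, (mem_tautSections_iff I h _).2 fun j => by
    simp [coordMatrix_self]⟩ : tautSections k d n U)

lemma vec_tautRow (I : Fin d ↪o Fin n) (h : U ≤ chartOpen k I) (a : Fin d) :
    tautSub.vec (tautRow I h a) = coordMatrix I h a := rfl

lemma tautSub.vec_injective : Function.Injective (tautSub.vec (k := k) (d := d) (n := n) (U := U)) :=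
  Subtype.val_injective

/-- The components of a section of the tautological bundle, as a linear map. -/
def tautSub.vecₗ (U : (Gr k d n).Opens) :
    Γ(tautSub k d n, U) →ₗ[Γ(Gr k d n, U)] (Fin n → Γ(Gr k d n, U)) :=
  (tautSections k d n U).subtype

lemma res_tautRow (I : Fin d ↪o Fin n) (h : U ≤ chartOpen k I) (h' : V ≤ U) (a : Fin d) :
    res _ h' (tautRow I h a) = tautRow I (h'.trans h) a :=
  tautSub.vec_injective (funext fun j => resRing_coordMatrix I h h' a j)

lemma vec_sum_tautRow (I : Fin d ↪o Fin n) (h : U ≤ chartOpen k I) (c : Fin d → Γ(Gr k d n, U))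
    (j : Fin n) :
    tautSub.vec (∑ a, c a • tautRow I h a) j = ∑ a, c a * coordMatrix I h a j := by
  change tautSub.vecₗ U _ j = _
  rw [map_sum, Finset.sum_apply]
  refine Finset.sum_congr rfl fun a _ => ?_
  rw [map_smul]
  rfl

lemma eq_sum_tautRow (I : Fin d ↪o Fin n) (h : U ≤ chartOpen k I) (s : Γ(tautSub k d n, U)) :
    s = ∑ a, tautSub.vec s (I a) • tautRow I h a :=
  tautSub.vec_injective (funext fun j =>
    ((mem_tautSections_iff I h _).1 (Subtype.prop (p := (· ∈ tautSections k d n U)) s) j).trans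
      (vec_sum_tautRow I h _ j).symm)

lemma isFrameOn_tautRow (I : Fin d ↪o Fin n) (h : U ≤ chartOpen k I) :
    IsFrameOn (tautRow I h) := by
  intro V hV
  simp only [res_tautRow]
  refine ⟨fun c c' hcc => ?_, fun s => ⟨_, (eq_sum_tautRow I (hV.trans h) s).symm⟩⟩
  funext b
  have := congrFun (congrArg tautSub.vec hcc) (I b)
  simpa [vec_sum_tautRow, coordMatrix_self] using this

/-- The classes in `Q` of the standard basis vectors. -/
def quotClass (U : (Gr k d n).Opens) (j : Fin n) : Γ(tautQuot k d n, U) :=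
  tautQuot.mk (Pi.single j 1)

/-- The class of a vector of functions, as a linear map. -/
def tautQuot.mkₗ (U : (Gr k d n).Opens) :
    (Fin n → Γ(Gr k d n, U)) →ₗ[Γ(Gr k d n, U)] Γ(tautQuot k d n, U) :=
  ((quotPre k d n).toSectionₗ U).comp (tautSections k d n U).mkQ

lemma mk_eq_zero {s : Fin n → Γ(Gr k d n, U)} (hs : s ∈ tautSections k d n U) :
    tautQuot.mk s = 0 := by
  have : (Submodule.Quotient.mk s : _ ⧸ tautSections k d n U) = 0 :=
    (Submodule.Quotient.mk_eq_zero _).2 hs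
  rw [tautQuot.mk, this]
  exact map_zero ((quotPre k d n).toSectionₗ U)

lemma res_mk (h : V ≤ U) (s : Fin n → Γ(Gr k d n, U)) :
    res _ h (tautQuot.mk s) = tautQuot.mk fun j => resRing h (s j) :=
  PreMod.res_toSection h _

lemma res_quotClass (h : V ≤ U) (j : Fin n) :
    res _ h (quotClass (k := k) (d := d) U j) = quotClass V j := by
  refine (res_mk h _).trans (congrArg tautQuot.mk (funext fun i => ?_))
  by_cases hij : i = j
  · subst hij; simp
  · simp [hij]

/-- On the chart `I`, the classes of the standard basis vectors outside `I` are a frame of `Q`. -/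
lemma isFrameOn_quotClass (I : Fin d ↪o Fin n) (h : U ≤ chartOpen k I) :
    IsFrameOn fun j : {j : Fin n // j ∉ Set.range I} => quotClass (k := k) (d := d) U j := by
  refine PreMod.isFrameOn_toSection (P := quotPre k d n) fun V hV => ?_
  have hVI := hV.trans h
  have hmk : ∀ c : {j : Fin n // j ∉ Set.range I} → Γ(Gr k d n, V),
      ∑ j, c j • (quotPre k d n).res hV (Submodule.Quotient.mk (Pi.single j.1 1)) =
        (tautSections k d n V).mkQ (∑ j, c j • Pi.single j.1 1) := by
    intro c
    rw [map_sum]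
    refine Finset.sum_congr rfl fun j _ => ?_
    rw [map_smul]
    congr 1
    refine congrArg (Submodule.Quotient.mk) (funext fun i => ?_)
    change resRing hV _ = _
    by_cases hij : i = j
    · subst hij; simp
    · simp [hij]
  have hc : ∀ (c : {j : Fin n // j ∉ Set.range I} → Γ(Gr k d n, V)) (i),
      (∑ j, c j • (Pi.single j.1 1 : Fin n → Γ(Gr k d n, V))) i =
        if hi : i ∉ Set.range I then c ⟨i, hi⟩ else 0 := by
    intro c i
    simp only [Finset.sum_apply, Pi.smul_apply, Pi.single_apply, smul_eq_mul, mul_ite, mul_one,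
      mul_zero]
    by_cases hi : i ∈ Set.range I
    · rw [dif_neg (not_not.2 hi)]
      refine Finset.sum_eq_zero fun j _ => if_neg ?_
      rintro rfl
      exact j.2 hi
    · rw [dif_pos hi, Finset.sum_eq_single ⟨i, hi⟩]
      · simp
      · intro j _ hj
        rw [if_neg]
        rintro rfl
        exact hj rfl
      · simp
  constructor
  · intro c c' hcc
    have hm := (Submodule.Quotient.eq _).1 ((hmk c).symm.trans (hcc.trans (hmk c')))
    rw [mem_tautSections_iff I hVI] at hm
    funext j
    have := hm j
    simp only [Pi.sub_apply, hc] at this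
    simpa [j.2, sub_eq_zero] using this
  · intro x
    obtain ⟨s, rfl⟩ := Submodule.Quotient.mk_surjective _ x
    -- the coordinates of the class of `s` are the entries outside `I` of `s - ∑ a, s (I a) • row a`
    refine ⟨fun j => s j - ∑ a, s (I a) * coordMatrix I hVI a j, ?_⟩
    refine (hmk _).trans ((Submodule.Quotient.eq _).2 ?_)
    rw [mem_tautSections_iff I hVI]
    intro j
    have hI : ∀ a, I a ∈ Set.range I := fun a => ⟨a, rfl⟩
    simp only [Pi.sub_apply, hc]
    by_cases hj : j ∈ Set.range I
    · obtain ⟨b, rfl⟩ := hj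
      simp [coordMatrix_self]
    · rw [dif_pos hj]
      simp

end TautologicalFrames

/-! ### Vector fields on affine open subsets -/

section Derivations
variable {X : Scheme.{u}} {V₀ : X.Opens}

/-- On an affine open subset every function is locally a fraction of global functions. -/
lemma exists_fraction (hV₀ : IsAffineOpen V₀) {V : X.Opens} (hV : V ≤ V₀) (s : Γ(X, V)) {x : X}
    (hx : x ∈ V) : ∃ (W : X.Opens) (hW : W ≤ V) (f g : Γ(X, V₀)), x ∈ W ∧
      IsUnit (resRing (hW.trans hV) g) ∧
        resRing hW s * resRing (hW.trans hV) g = resRing (hW.trans hV) f := by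
  obtain ⟨g, hg, hxg⟩ := hV₀.exists_basicOpen_le ⟨x, hx⟩ (hV hx)
  have hloc := hV₀.isLocalization_basicOpen g
  obtain ⟨⟨f, ⟨_, m, rfl⟩⟩, hf⟩ :=
    IsLocalization.surj (M := Submonoid.powers g) (resRing hg s)
  refine ⟨X.basicOpen g, hg, f, g ^ m, hxg, ?_, hf⟩
  exact IsLocalization.map_units Γ(X, X.basicOpen g) (⟨g ^ m, m, rfl⟩ : Submonoid.powers g)

/-- A function on an affine open subset that vanishes near a point is annihilated by a function that
does not vanish at the point. -/
lemma exists_mul_eq_zero (hV₀ : IsAffineOpen V₀) {V : X.Opens} (hV : V ≤ V₀) {f : Γ(X, V₀)}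
    (hf : resRing hV f = 0) {x : X} (hx : x ∈ V) : ∃ (W : X.Opens) (hW : W ≤ V) (g : Γ(X, V₀)),
      x ∈ W ∧ IsUnit (resRing (hW.trans hV) g) ∧ g * f = 0 := by
  obtain ⟨g, hg, hxg⟩ := hV₀.exists_basicOpen_le ⟨x, hx⟩ (hV hx)
  have hloc := hV₀.isLocalization_basicOpen g
  have h0 : algebraMap Γ(X, V₀) Γ(X, X.basicOpen g) f = 0 := by
    have := congrArg (resRing hg) hf
    rwa [resRing_comp, map_zero] at this
  obtain ⟨⟨_, m, rfl⟩, hm⟩ := (IsLocalization.map_eq_zero_iff (Submonoid.powers g) _ f).1 h0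
  refine ⟨X.basicOpen g, hg, g ^ m, hxg, ?_, hm⟩
  exact IsLocalization.map_units Γ(X, X.basicOpen g) (⟨g ^ m, m, rfl⟩ : Submonoid.powers g)

/-- A derivation is local: functions that agree on an open subset have derivatives that agree
there. -/
lemma resRing_derivation_congr (hV₀ : IsAffineOpen V₀) (d : Derivation ℤ Γ(X, V₀) Γ(X, V₀))
    {V : X.Opens} (hV : V ≤ V₀) {f f' : Γ(X, V₀)} (h : resRing hV f = resRing hV f') :
    resRing hV (d f) = resRing hV (d f') := by
  rw [← sub_eq_zero, ← map_sub] at h ⊢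
  rw [← map_sub]
  refine eq_of_forall_mem fun x hx => ?_
  obtain ⟨W, hW, g, hxW, hg, hgf⟩ := exists_mul_eq_zero hV₀ hV h hx
  refine ⟨W, hW, hxW, hg.mul_left_cancel ?_⟩
  have h1 := congrArg (resRing (hW.trans hV)) (congrArg d hgf)
  have h2 := congrArg (resRing hW) h
  rw [d.leibniz, map_zero, map_zero, map_add] at h1
  simp only [smul_eq_mul, map_mul] at h1
  rw [resRing_comp, map_zero] at h2
  rw [h2, zero_mul, add_zero] at h1
  rw [resRing_comp, map_zero, mul_zero, h1]

/-- `t` is the value at `s` of the extension of the derivation `d` to `V`: it satisfies the quotient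
rule wherever `s` is a fraction. -/
def IsDerValue (d : Derivation ℤ Γ(X, V₀) Γ(X, V₀)) {V : X.Opens} (hV : V ≤ V₀) (s t : Γ(X, V)) :
    Prop :=
  ∀ (W : X.Opens) (hW : W ≤ V) (f g : Γ(X, V₀)), IsUnit (resRing (hW.trans hV) g) →
    resRing hW s * resRing (hW.trans hV) g = resRing (hW.trans hV) f →
    resRing hW t * resRing (hW.trans hV) g + resRing hW s * resRing (hW.trans hV) (d g) =
      resRing (hW.trans hV) (d f)

lemma IsDerValue.restrict {d : Derivation ℤ Γ(X, V₀) Γ(X, V₀)} {V W : X.Opens} {hV : V ≤ V₀}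
    {s t : Γ(X, V)} (h : IsDerValue d hV s t) (hW : W ≤ V) :
    IsDerValue d (hW.trans hV) (resRing hW s) (resRing hW t) := by
  intro W' hW' f g
  rw [resRing_comp, resRing_comp]
  exact h W' (hW'.trans hW) f g

lemma IsDerValue.unique (hV₀ : IsAffineOpen V₀) {d : Derivation ℤ Γ(X, V₀) Γ(X, V₀)} {V : X.Opens}
    {hV : V ≤ V₀} {s t t' : Γ(X, V)} (h : IsDerValue d hV s t) (h' : IsDerValue d hV s t') :
    t = t' := by
  refine eq_of_forall_mem fun x hx => ?_
  obtain ⟨W, hW, f, g, hxW, hg, hf⟩ := exists_fraction hV₀ hV s hx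
  refine ⟨W, hW, hxW, hg.mul_right_cancel ?_⟩
  exact add_right_cancel ((h W hW f g hg hf).trans (h' W hW f g hg hf).symm)

/-- The value that the quotient rule gives does not depend on the presentation as a fraction. -/
lemma quotient_rule_congr (hV₀ : IsAffineOpen V₀) (d : Derivation ℤ Γ(X, V₀) Γ(X, V₀))
    {W : X.Opens} (hW : W ≤ V₀) {s t t' : Γ(X, W)} {f g f' g' : Γ(X, V₀)}
    (hg : IsUnit (resRing hW g)) (hg' : IsUnit (resRing hW g'))
    (hf : s * resRing hW g = resRing hW f) (hf' : s * resRing hW g' = resRing hW f')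
    (ht : t * resRing hW g + s * resRing hW (d g) = resRing hW (d f))
    (ht' : t' * resRing hW g' + s * resRing hW (d g') = resRing hW (d f')) : t = t' := by
  have h : resRing hW (f * g') = resRing hW (f' * g) := by
    rw [map_mul, map_mul, ← hf, ← hf']; ring
  have h2 := resRing_derivation_congr hV₀ d hW h
  simp only [d.leibniz, smul_eq_mul, map_add, map_mul] at h2
  refine (hg.mul hg').mul_right_cancel ?_
  linear_combination resRing hW g' * ht - resRing hW g * ht' + h2 - resRing hW (d g) * hf' +
    resRing hW (d g') * hf

lemma exists_isDerValue (hV₀ : IsAffineOpen V₀) (d : Derivation ℤ Γ(X, V₀) Γ(X, V₀)) {V : X.Opens}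
    (hV : V ≤ V₀) (s : Γ(X, V)) : ∃ t, IsDerValue d hV s t := by
  have hex := Modules.exists_glue (structureModule X) (V := V) (fun W (t : Γ(X, W)) =>
    ∃ (hW : W ≤ V) (f g : Γ(X, V₀)), IsUnit (resRing (hW.trans hV) g) ∧
      resRing hW s * resRing (hW.trans hV) g = resRing (hW.trans hV) f ∧
      t * resRing (hW.trans hV) g + resRing hW s * resRing (hW.trans hV) (d g) =
        resRing (hW.trans hV) (d f)) ?_ ?_
  · obtain ⟨t, ht⟩ := hex
    refine ⟨t, fun W hW f g hg hf => ?_⟩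
    obtain ⟨t', ht'⟩ : ∃ t' : Γ(X, W), t' * resRing (hW.trans hV) g +
        resRing hW s * resRing (hW.trans hV) (d g) = resRing (hW.trans hV) (d f) := by
      obtain ⟨u, hu⟩ := hg.exists_left_inv
      refine ⟨(resRing (hW.trans hV) (d f) - resRing hW s * resRing (hW.trans hV) (d g)) * u, ?_⟩
      rw [mul_assoc, hu]
      ring
    have : resRing hW t = t' := ht W hW t' ⟨hW, f, g, hg, hf, ht'⟩
    rw [this, ht']
  · rintro W W' hW hW' (t : Γ(X, W)) (t' : Γ(X, W')) ⟨_, f, g, hg, hf, ht⟩ ⟨_, f', g', hg', hf', ht'⟩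
    have hl : W ⊓ W' ≤ W := inf_le_left
    have hr : W ⊓ W' ≤ W' := inf_le_right
    have hg1 := hg.map (resRing hl)
    have hg2 := hg'.map (resRing hr)
    have hf1 := congrArg (resRing hl) hf
    have hf2 := congrArg (resRing hr) hf'
    have ht1 := congrArg (resRing hl) ht
    have ht2 := congrArg (resRing hr) ht'
    change resRing hl (t * _ + _) = _ at ht1
    change resRing hr (t' * _ + _) = _ at ht2
    simp only [map_add, map_mul, resRing_comp] at hg1 hg2 hf1 hf2 ht1 ht2
    exact quotient_rule_congr hV₀ d (hl.trans (hW.trans hV)) hg1 hg2 hf1 hf2 ht1 ht2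
  · intro x hx
    obtain ⟨W, hW, f, g, hxW, hg, hf⟩ := exists_fraction hV₀ hV s hx
    obtain ⟨u, hu⟩ := hg.exists_left_inv
    refine ⟨W, hW, hxW, (resRing (hW.trans hV) (d f) -
      resRing hW s * resRing (hW.trans hV) (d g)) * u, hW, f, g, hg, hf, ?_⟩
    rw [mul_assoc, hu]
    ring

/-- Two functions are near each point fractions with a common open subset of definition. -/
lemma exists_fraction₂ (hV₀ : IsAffineOpen V₀) {V : X.Opens} (hV : V ≤ V₀) (s s' : Γ(X, V)) {x : X}
    (hx : x ∈ V) : ∃ (W : X.Opens) (hW : W ≤ V) (f g f' g' : Γ(X, V₀)), x ∈ W ∧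
      IsUnit (resRing (hW.trans hV) g) ∧ IsUnit (resRing (hW.trans hV) g') ∧
        resRing hW s * resRing (hW.trans hV) g = resRing (hW.trans hV) f ∧
        resRing hW s' * resRing (hW.trans hV) g' = resRing (hW.trans hV) f' := by
  obtain ⟨W, hW, f, g, hxW, hg, hf⟩ := exists_fraction hV₀ hV s hx
  obtain ⟨W', hW', f', g', hxW', hg', hf'⟩ := exists_fraction hV₀ hV s' hx
  have hl : W ⊓ W' ≤ W := inf_le_left
  have hr : W ⊓ W' ≤ W' := inf_le_right
  have hg1 := hg.map (resRing hl)
  have hg2 := hg'.map (resRing hr)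
  have hf1 := congrArg (resRing hl) hf
  have hf2 := congrArg (resRing hr) hf'
  simp only [map_mul, resRing_comp] at hg1 hg2 hf1 hf2
  exact ⟨W ⊓ W', hl.trans hW, f, g, f', g', ⟨hxW, hxW'⟩, hg1, hg2, hf1, hf2⟩

/-- The value of the extension of a derivation of `Γ(X, V₀)` to functions on an open subset. -/
def derValue (hV₀ : IsAffineOpen V₀) (d : Derivation ℤ Γ(X, V₀) Γ(X, V₀)) {V : X.Opens}
    (hV : V ≤ V₀) (s : Γ(X, V)) : Γ(X, V) :=
  (exists_isDerValue hV₀ d hV s).choose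

lemma isDerValue_derValue (hV₀ : IsAffineOpen V₀) (d : Derivation ℤ Γ(X, V₀) Γ(X, V₀))
    {V : X.Opens} (hV : V ≤ V₀) (s : Γ(X, V)) : IsDerValue d hV s (derValue hV₀ d hV s) :=
  (exists_isDerValue hV₀ d hV s).choose_spec

lemma derValue_res (hV₀ : IsAffineOpen V₀) (d : Derivation ℤ Γ(X, V₀) Γ(X, V₀)) {V W : X.Opens}
    (hV : V ≤ V₀) (hW : W ≤ V) (s : Γ(X, V)) :
    derValue hV₀ d (hW.trans hV) (resRing hW s) = resRing hW (derValue hV₀ d hV s) :=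
  (isDerValue_derValue hV₀ d _ _).unique hV₀ ((isDerValue_derValue hV₀ d hV s).restrict hW)

lemma derValue_resRing (hV₀ : IsAffineOpen V₀) (d : Derivation ℤ Γ(X, V₀) Γ(X, V₀)) {V : X.Opens}
    (hV : V ≤ V₀) (a : Γ(X, V₀)) : derValue hV₀ d hV (resRing hV a) = resRing hV (d a) := by
  have := isDerValue_derValue hV₀ d hV (resRing hV a) V le_rfl a 1 (by simp)
    (by rw [resRing_id]; simp)
  simpa [resRing_id] using this

lemma derValue_add (hV₀ : IsAffineOpen V₀) (d : Derivation ℤ Γ(X, V₀) Γ(X, V₀)) {V : X.Opens}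
    (hV : V ≤ V₀) (s s' : Γ(X, V)) :
    derValue hV₀ d hV (s + s') = derValue hV₀ d hV s + derValue hV₀ d hV s' := by
  refine eq_of_forall_mem fun x hx => ?_
  obtain ⟨W, hW, f, g, f', g', hxW, hg, hg', hf, hf'⟩ := exists_fraction₂ hV₀ hV s s' hx
  refine ⟨W, hW, hxW, (hg.mul hg').mul_right_cancel ?_⟩
  have h1 := isDerValue_derValue hV₀ d hV s W hW f g hg hf
  have h2 := isDerValue_derValue hV₀ d hV s' W hW f' g' hg' hf'
  have h3 := isDerValue_derValue hV₀ d hV (s + s') W hW (f * g' + f' * g) (g * g')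
    (by rw [map_mul]; exact hg.mul hg') (by
      simp only [map_add, map_mul, ← hf, ← hf']; ring)
  simp only [map_add, map_mul, d.leibniz, smul_eq_mul] at h3 ⊢
  linear_combination h3 - resRing (hW.trans hV) g' * h1 - resRing (hW.trans hV) g * h2 -
    resRing (hW.trans hV) (d g') * hf - resRing (hW.trans hV) (d g) * hf'

lemma derValue_mul (hV₀ : IsAffineOpen V₀) (d : Derivation ℤ Γ(X, V₀) Γ(X, V₀)) {V : X.Opens}
    (hV : V ≤ V₀) (s s' : Γ(X, V)) :
    derValue hV₀ d hV (s * s') = s * derValue hV₀ d hV s' + s' * derValue hV₀ d hV s := by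
  refine eq_of_forall_mem fun x hx => ?_
  obtain ⟨W, hW, f, g, f', g', hxW, hg, hg', hf, hf'⟩ := exists_fraction₂ hV₀ hV s s' hx
  refine ⟨W, hW, hxW, (hg.mul hg').mul_right_cancel ?_⟩
  have h1 := isDerValue_derValue hV₀ d hV s W hW f g hg hf
  have h2 := isDerValue_derValue hV₀ d hV s' W hW f' g' hg' hf'
  have h3 := isDerValue_derValue hV₀ d hV (s * s') W hW (f * f') (g * g')
    (by rw [map_mul]; exact hg.mul hg') (by
      simp only [map_mul, ← hf, ← hf']; ring)
  simp only [map_add, map_mul, d.leibniz, smul_eq_mul] at h3 ⊢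
  linear_combination h3 - resRing (hW.trans hV) f' * h1 - resRing (hW.trans hV) f * h2 -
    (resRing (hW.trans hV) g * resRing hW (derValue hV₀ d hV s) +
      resRing hW s * resRing (hW.trans hV) (d g)) * hf' -
    (resRing (hW.trans hV) g' * resRing hW (derValue hV₀ d hV s') +
      resRing hW s' * resRing (hW.trans hV) (d g')) * hf

/-- The vector field on an affine open subset that extends a derivation of the ring of functions,
provided that the derivation kills the functions that come from the base. -/
def LocalDer.ofDerivation {S : Scheme.{u}} (f : X ⟶ S) (hV₀ : IsAffineOpen V₀)
    (d : Derivation ℤ Γ(X, V₀) Γ(X, V₀))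
    (hd : ∀ (V : X.Opens) (hV : V ≤ V₀) (W : S.Opens) (e : V ≤ f ⁻¹ᵁ W) (a : Γ(S, W)),
      ∃ b, d b = 0 ∧ f.appLE W V e a = resRing hV b) : LocalDer f V₀ where
  app V hV := Derivation.mk' (AddMonoidHom.mk' (derValue hV₀ d hV)
    (derValue_add hV₀ d hV)).toIntLinearMap (derValue_mul hV₀ d hV)
  naturality V W hV h x := derValue_res hV₀ d hV h x
  map_base V hV W e a := by
    obtain ⟨b, hb, hab⟩ := hd V hV W e a
    change derValue hV₀ d hV (f.appLE W V e a) = 0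
    rw [hab, derValue_resRing, hb, map_zero]

lemma LocalDer.ofDerivation_app {S : Scheme.{u}} (f : X ⟶ S) (hV₀ : IsAffineOpen V₀)
    (d : Derivation ℤ Γ(X, V₀) Γ(X, V₀)) (hd) (a : Γ(X, V₀)) :
    (LocalDer.ofDerivation f hV₀ d hd).app V₀ le_rfl a = d a := by
  have := derValue_resRing hV₀ d le_rfl a
  rwa [resRing_id, resRing_id] at this

/-- A vector field on an open part of an affine open subset is determined by its values on the
functions on the affine open subset. -/
lemma LocalDer.ext_affine {S : Scheme.{u}} {f : X ⟶ S} (hV₀ : IsAffineOpen V₀) {U : X.Opens}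
    (hU : U ≤ V₀) {D E : LocalDer f U}
    (h : ∀ a : Γ(X, V₀), D.app U le_rfl (resRing hU a) = E.app U le_rfl (resRing hU a)) :
    D = E := by
  have h' : ∀ W (hW : W ≤ U) (a : Γ(X, V₀)), D.app W hW (resRing (hW.trans hU) a) =
      E.app W hW (resRing (hW.trans hU) a) := by
    intro W hW a
    rw [← resRing_comp hU hW, D.naturality U W le_rfl hW, E.naturality U W le_rfl hW, h]
  refine LocalDer.ext (funext fun V => funext fun hV => Derivation.ext fun s => ?_)
  refine eq_of_forall_mem fun x hx => ?_
  obtain ⟨W, hW, a, g, hxW, hg, ha⟩ := exists_fraction hV₀ (hV.trans hU) s hx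
  refine ⟨W, hW, hxW, hg.mul_left_cancel ?_⟩
  rw [← D.naturality V W hV hW, ← E.naturality V W hV hW]
  have h1 := congrArg (D.app W (hW.trans hV)) ha
  have h2 := congrArg (E.app W (hW.trans hV)) ha
  rw [Derivation.leibniz, h', h'] at h1
  rw [Derivation.leibniz] at h2
  simp only [smul_eq_mul] at h1 h2
  linear_combination h1 - h2

end Derivations

/-! ### The coordinate vector fields of a chart -/

section Tangent
variable {k : Type u} [Field k] {d n : ℕ} {U V : (Gr k d n).Opens}

lemma isAffineOpen_chartOpen (I : Fin d ↪o Fin n) : IsAffineOpen (chartOpen k I) :=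
  isAffineOpen_opensRange _

lemma chartι_toBase (I : Fin d ↪o Fin n) : chartι k I ≫ Gr.toBase k d n =
    Spec.map (CommRingCat.ofHom (MvPolynomial.C : k →+* ChartRing k I)) :=
  Multicoequalizer.π_desc (glueData k d n).toGlueData.diagram _ _ _ (⟨I⟩ : ULift (Fin d ↪o Fin n))

/-- Constants, as functions on an open subset of a chart, are pulled back from the base. -/
lemma appLE_toBase (I : Fin d ↪o Fin n) (h : U ≤ chartOpen k I)
    (e : U ≤ Gr.toBase k d n ⁻¹ᵁ ⊤) (c : k) :
    ((Gr.toBase k d n).appLE ⊤ U e).hom ((Scheme.ΓSpecIso (.of k)).inv.hom c) =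
      chartCoord I h (MvPolynomial.C c) := by
  apply (bijective_chartPull I h).1
  rw [chartPull_chartCoord]
  refine (chartPull_resRing I (le_top : U ≤ ⊤) _).trans ?_
  have h1 : coords (chartι k I ≫ Gr.toBase k d n) =
      coords (Spec.map (CommRingCat.ofHom (MvPolynomial.C : k →+* ChartRing k I))) := by
    rw [chartι_toBase]
  have h2 := coords_comp_map (𝟙 (chart k I))
    (CommRingCat.ofHom (MvPolynomial.C : k →+* ChartRing k I))
  rw [Category.id_comp] at h2
  have h3 := congrArg (fun g => g c) (h1.trans h2)
  refine (congrArg (resRing le_top) h3).trans ?_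
  rfl

/-- Functions that are pulled back from the base are constants, because the base is a point. -/
lemma exists_appLE_toBase (I : Fin d ↪o Fin n) (h : U ≤ chartOpen k I)
    (W : (Spec (.of k)).Opens) (e : U ≤ Gr.toBase k d n ⁻¹ᵁ W) (a : Γ(Spec (.of k), W)) :
    ∃ c : k, ((Gr.toBase k d n).appLE W U e).hom a = chartCoord I h (MvPolynomial.C c) := by
  by_cases hU : ∃ x, x ∈ U
  · obtain ⟨x, hx⟩ := hU
    obtain rfl : W = ⊤ := by
      refine top_le_iff.1 fun y _ => ?_
      have : y = Gr.toBase k d n x := Subsingleton.elim (α := PrimeSpectrum k) _ _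
      rw [this]
      exact e hx
    obtain ⟨c, rfl⟩ : ∃ c : k, (Scheme.ΓSpecIso (.of k)).inv.hom c = a :=
      ⟨(Scheme.ΓSpecIso (.of k)).hom.hom a,
        congrArg (fun g => g.hom a) (Scheme.ΓSpecIso (.of k)).hom_inv_id⟩
    exact ⟨c, appLE_toBase I h e c⟩
  · exact ⟨0, eq_of_forall_mem fun x hx => absurd ⟨x, hx⟩ hU⟩

/-- The coordinate ring of a chart, as the ring of functions on the chart. -/
def chartCoordEquiv (I : Fin d ↪o Fin n) : ChartRing k I ≃+* Γ(Gr k d n, chartOpen k I) :=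
  RingEquiv.ofBijective (chartCoord I le_rfl) (chartCoord_bijective I)

/-- The partial derivative with respect to a coordinate, on the ring of functions on the chart. -/
def chartDerivation (I : Fin d ↪o Fin n) (p : Fin d × {j : Fin n // j ∉ Set.range I}) :
    Derivation ℤ Γ(Gr k d n, chartOpen k I) Γ(Gr k d n, chartOpen k I) :=
  Derivation.mk' (AddMonoidHom.mk'
    (fun x => chartCoordEquiv I (MvPolynomial.pderiv p ((chartCoordEquiv I).symm x)))
    (fun x y => by simp only [map_add])).toIntLinearMap (fun x y => by
      change chartCoordEquiv I _ = x * chartCoordEquiv I _ + y * chartCoordEquiv I _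
      rw [map_mul, Derivation.leibniz, map_add, smul_eq_mul, smul_eq_mul, map_mul, map_mul,
        RingEquiv.apply_symm_apply, RingEquiv.apply_symm_apply])

lemma chartDerivation_chartCoord (I : Fin d ↪o Fin n)
    (p : Fin d × {j : Fin n // j ∉ Set.range I}) (r : ChartRing k I) :
    chartDerivation I p (chartCoord I le_rfl r) = chartCoord I le_rfl (MvPolynomial.pderiv p r) := by
  change chartCoordEquiv I (MvPolynomial.pderiv p ((chartCoordEquiv I).symm (chartCoordEquiv I r))) = _
  rw [RingEquiv.symm_apply_apply]
  rfl

/-- The coordinate vector field `∂/∂x_p` on a chart. -/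
def coordField (I : Fin d ↪o Fin n) (p : Fin d × {j : Fin n // j ∉ Set.range I}) :
    Γ(tangentSheaf (Gr.toBase k d n), chartOpen k I) :=
  LocalDer.ofDerivation (Gr.toBase k d n) (isAffineOpen_chartOpen I) (chartDerivation I p)
    fun V hV W e a => by
      obtain ⟨c, hc⟩ := exists_appLE_toBase I hV W e a
      refine ⟨chartCoord I le_rfl (MvPolynomial.C c), ?_, ?_⟩
      · rw [chartDerivation_chartCoord, MvPolynomial.pderiv_C, map_zero]
      · rw [resRing_chartCoord]
        exact hc

lemma applyDer_res {W : (Gr k d n).Opens} (D : Γ(tangentSheaf (Gr.toBase k d n), U)) (h : V ≤ U)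
    (h' : W ≤ V) (x : Γ(Gr k d n, V)) :
    applyDer D (h'.trans h) (resRing h' x) = resRing h' (applyDer D h x) :=
  LocalDer.naturality (f := Gr.toBase k d n) (U := U) D V W h h' x

lemma applyDer_mul (D : Γ(tangentSheaf (Gr.toBase k d n), U)) (h : V ≤ U) (x y : Γ(Gr k d n, V)) :
    applyDer D h (x * y) = x * applyDer D h y + y * applyDer D h x :=
  (LocalDer.app (f := Gr.toBase k d n) (U := U) D V h).leibniz x y

lemma applyDer_add (D : Γ(tangentSheaf (Gr.toBase k d n), U)) (h : V ≤ U) (x y : Γ(Gr k d n, V)) :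
    applyDer D h (x + y) = applyDer D h x + applyDer D h y :=
  map_add (LocalDer.app (f := Gr.toBase k d n) (U := U) D V h) x y

lemma applyDer_chartCoord_C (I : Fin d ↪o Fin n) (D : Γ(tangentSheaf (Gr.toBase k d n), U))
    (h : V ≤ U) (hV : V ≤ chartOpen k I) (c : k) :
    applyDer D h (chartCoord I hV (MvPolynomial.C c)) = 0 := by
  rw [← appLE_toBase I hV (fun _ _ => trivial) c]
  exact LocalDer.map_base (f := Gr.toBase k d n) (U := U) D V h ⊤ (fun _ _ => trivial) _

/-- The chain rule on a chart. -/
lemma applyDer_chartCoord (I : Fin d ↪o Fin n) (D : Γ(tangentSheaf (Gr.toBase k d n), U))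
    (h : V ≤ U) (hV : V ≤ chartOpen k I) (r : ChartRing k I) :
    applyDer D h (chartCoord I hV r) = ∑ p, chartCoord I hV (MvPolynomial.pderiv p r) *
      applyDer D h (chartCoord I hV (MvPolynomial.X p)) := by
  induction r using MvPolynomial.induction_on with
  | C c => simp [applyDer_chartCoord_C]
  | add r s hr hs =>
    rw [map_add, applyDer_add, hr, hs, ← Finset.sum_add_distrib]
    simp only [map_add, add_mul]
  | mul_X r q hr =>
    rw [map_mul, applyDer_mul, hr]
    simp only [Derivation.leibniz, smul_eq_mul, map_add, map_mul, add_mul, Finset.sum_add_distrib,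
      MvPolynomial.pderiv_X, Finset.mul_sum]
    congr 1
    · rw [Finset.sum_eq_single q]
      · simp
      · intro p _ hp
        simp [Pi.single_eq_of_ne hp.symm]
      · simp
    · exact Finset.sum_congr rfl fun p _ => by ring

/-- A vector field on a chart is determined by the derivatives of the coordinates. -/
lemma tangent_ext_chart (I : Fin d ↪o Fin n) (hU : U ≤ chartOpen k I)
    {D E : Γ(tangentSheaf (Gr.toBase k d n), U)}
    (h : ∀ p, applyDer D le_rfl (chartCoord I hU (MvPolynomial.X p)) =
      applyDer E le_rfl (chartCoord I hU (MvPolynomial.X p))) : D = E := by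
  refine LocalDer.ext_affine (f := Gr.toBase k d n) (isAffineOpen_chartOpen I) hU fun a => ?_
  obtain ⟨r, rfl⟩ := (chartCoord_bijective I).2 a
  rw [resRing_chartCoord]
  refine (applyDer_chartCoord I D le_rfl hU r).trans
    (Eq.trans ?_ (applyDer_chartCoord I E le_rfl hU r).symm)
  exact Finset.sum_congr rfl fun p _ => by rw [h]

/-- Application of vector fields to a function, as a linear map. -/
def applyDerₗ (x : Γ(Gr k d n, U)) :
    Γ(tangentSheaf (Gr.toBase k d n), U) →ₗ[Γ(Gr k d n, U)] Γ(Gr k d n, U) where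
  toFun D := applyDer D le_rfl x
  map_add' _ _ := rfl
  map_smul' r D := by
    change resRing le_rfl r * _ = r * _
    rw [resRing_id]
    rfl

lemma applyDer_coordField (I : Fin d ↪o Fin n) (p q : Fin d × {j : Fin n // j ∉ Set.range I})
    (hU : U ≤ chartOpen k I) :
    applyDer (coordField I p) hU (chartCoord I hU (MvPolynomial.X q)) = if p = q then 1 else 0 := by
  rw [← resRing_chartCoord I le_rfl hU, applyDer_res _ le_rfl hU]
  have h : applyDer (coordField I p) le_rfl (chartCoord I le_rfl (MvPolynomial.X q)) =
      chartCoord I le_rfl (MvPolynomial.pderiv p (MvPolynomial.X q)) :=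
    (LocalDer.ofDerivation_app (Gr.toBase k d n) (isAffineOpen_chartOpen I) (chartDerivation I p) _
      _).trans (chartDerivation_chartCoord I p _)
  rw [h, MvPolynomial.pderiv_X]
  by_cases hpq : p = q
  · subst hpq; simp
  · simp [hpq]

/-- The coordinates of a vector field with respect to the fields `∂/∂x_p` are the derivatives of the
coordinate functions. -/
lemma isFrameOn_coordField (I : Fin d ↪o Fin n) :
    IsFrameOn (coordField (k := k) I) := by
  intro V hV
  have key : ∀ (c : Fin d × {j : Fin n // j ∉ Set.range I} → Γ(Gr k d n, V)) q,
      applyDer (∑ p, c p • res _ hV (coordField I p)) le_rfl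
        (chartCoord I hV (MvPolynomial.X q)) = c q := by
    intro c q
    change applyDerₗ _ _ = _
    rw [map_sum]
    have : ∀ p, applyDerₗ (chartCoord I hV (MvPolynomial.X q)) (c p • res _ hV (coordField I p)) =
        c p * if p = q then 1 else 0 := by
      intro p
      rw [map_smul, ← applyDer_coordField I p q hV]
      rfl
    simp [this]
  refine ⟨fun c c' hcc => ?_, fun D => ⟨fun p =>
    applyDer D le_rfl (chartCoord I hV (MvPolynomial.X p)), ?_⟩⟩
  · funext q
    rw [← key c q, ← key c' q]
    exact congrArg (fun D => applyDer D le_rfl (chartCoord I hV (MvPolynomial.X q))) hcc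
  · exact tangent_ext_chart I hV fun p => key _ p

end Tangent

/-! ### The map from the tangent bundle to the homomorphisms from `S` to `Q` -/

section DerivTaut
variable {k : Type u} [Field k] {d n : ℕ} {U V : (Gr k d n).Opens}

lemma derivTaut_add (D : Γ(tangentSheaf (Gr.toBase k d n), U)) (h : V ≤ U)
    (s t : Γ(tautSub k d n, V)) : derivTaut D h (s + t) = derivTaut D h s + derivTaut D h t := by
  refine Eq.trans ?_ (map_add (tautQuot.mkₗ V) _ _)
  exact congrArg (tautQuot.mk) (funext fun j => applyDer_add D h _ _)

/-- The derivative is linear over functions because it is taken modulo the tautological bundle. -/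
lemma derivTaut_smul (D : Γ(tangentSheaf (Gr.toBase k d n), U)) (h : V ≤ U) (r : Γ(Gr k d n, V))
    (s : Γ(tautSub k d n, V)) : derivTaut D h (r • s) = r • derivTaut D h s := by
  have h1 : (fun j => applyDer D h (tautSub.vec (r • s) j)) =
      r • (fun j => applyDer D h (tautSub.vec s j)) + applyDer D h r • tautSub.vec s := by
    funext j
    refine (applyDer_mul D h r (tautSub.vec s j)).trans ?_
    simp only [Pi.add_apply, Pi.smul_apply, smul_eq_mul]
    ring
  have h2 : tautQuot.mk (applyDer D h r • tautSub.vec s) = 0 :=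
    mk_eq_zero (Submodule.smul_mem _ _ (Subtype.prop (p := (· ∈ tautSections k d n V)) s))
  rw [derivTaut, h1]
  refine (map_add (tautQuot.mkₗ V) _ _).trans ?_
  rw [map_smul]
  exact (congrArg (_ + ·) h2).trans (add_zero _)

/-- The derivative of sections of the tautological bundle along a vector field, as a linear map. -/
def derivTautₗ (D : Γ(tangentSheaf (Gr.toBase k d n), U)) (h : V ≤ U) :
    Γ(tautSub k d n, V) →ₗ[Γ(Gr k d n, V)] Γ(tautQuot k d n, V) where
  toFun := derivTaut D h
  map_add' := derivTaut_add D h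
  map_smul' := derivTaut_smul D h

/-- In the columns of the chart the universal matrix is constant, so that only the other columns
contribute to the derivative of a row. -/
lemma derivTaut_tautRow (I : Fin d ↪o Fin n) (D : Γ(tangentSheaf (Gr.toBase k d n), U)) (h : V ≤ U)
    (hV : V ≤ chartOpen k I) (b : Fin d) :
    derivTaut D h (tautRow I hV b) = ∑ j : {j : Fin n // j ∉ Set.range I},
      applyDer D h (chartCoord I hV (MvPolynomial.X (b, j))) • quotClass V j.1 := by
  have h1 : (fun i => applyDer D h (tautSub.vec (tautRow I hV b) i)) =
      ∑ j : {j : Fin n // j ∉ Set.range I},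
        applyDer D h (chartCoord I hV (MvPolynomial.X (b, j))) •
          (Pi.single j.1 1 : Fin n → Γ(Gr k d n, V)) := by
    funext i
    rw [vec_tautRow]
    simp only [Finset.sum_apply, Pi.smul_apply, Pi.single_apply, smul_eq_mul, mul_ite, mul_one,
      mul_zero]
    by_cases hi : i ∈ Set.range I
    · rw [Finset.sum_eq_zero fun j _ => if_neg (by rintro rfl; exact j.2 hi)]
      obtain ⟨a, rfl⟩ := hi
      rw [coordMatrix_self]
      have h0 : ∀ c : k, applyDer D h (chartCoord I hV (MvPolynomial.C c)) = 0 :=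
        applyDer_chartCoord_C I D h hV
      split_ifs
      · simpa using h0 1
      · simpa using h0 0
    · rw [Finset.sum_eq_single ⟨i, hi⟩]
      · rw [if_pos rfl]
        exact congrArg (applyDer D h) (pointMatrix_of_notMem (chartCoord I hV) b hi)
      · intro j _ hj
        rw [if_neg]
        rintro rfl
        exact hj rfl
      · simp
  rw [derivTaut, h1]
  change tautQuot.mkₗ V _ = _
  rw [map_sum]
  refine Finset.sum_congr rfl fun j _ => ?_
  rw [map_smul]
  rfl

/-- A vector field is determined by the homomorphism `S ⟶ Q` that it defines. -/
lemma derivTaut_injective {D E : Γ(tangentSheaf (Gr.toBase k d n), U)}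
    (h : ∀ (V : (Gr k d n).Opens) (hV : V ≤ U) (s : Γ(tautSub k d n, V)),
      derivTaut D hV s = derivTaut E hV s) : D = E := by
  refine Modules.eq_of_forall_mem _ fun x hx => ?_
  obtain ⟨I, hI⟩ := exists_mem_chartOpen x
  let W := U ⊓ chartOpen k I
  have hWU : W ≤ U := inf_le_left
  have hWI : W ≤ chartOpen k I := inf_le_right
  refine ⟨W, hWU, ⟨hx, hI⟩, tangent_ext_chart I hWI ?_⟩
  rintro ⟨b, j⟩
  have h1 := h W hWU (tautRow I hWI b)
  rw [derivTaut_tautRow, derivTaut_tautRow] at h1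
  have h2 := isFrameOn_quotClass I hWI W le_rfl
  simp only [res_id] at h2
  exact congrFun (h2.1 (a₁ := fun j => applyDer D hWU (chartCoord I hWI (MvPolynomial.X (b, j))))
    (a₂ := fun j => applyDer E hWU (chartCoord I hWI (MvPolynomial.X (b, j)))) h1) j

end DerivTaut

/-! ### Vector fields adapted to frames of `S^*` and `Q` -/

section Adapted
variable {k : Type u} [Field k] {U V : (G25 k).Opens}

/-- Frames `ξ` of `S^*` and `q` of `Q`, and the vector fields `D j i` that correspond to
`ξ i ⊗ q j` under `TG ≅ S^* ⊗ Q`. -/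
structure IsAdapted (ξ : Fin 2 → Γ(dual (bundleS k), U)) (q : Fin 3 → Γ(bundleQ k, U))
    (D : Fin 3 → Fin 2 → Γ(TG k, U)) : Prop where
  frame_dual : IsFrameOn ξ
  frame_quot : IsFrameOn q
  deriv : ∀ i j (V : (G25 k).Opens) (h : V ≤ U) (s : Γ(bundleS k, V)),
    derivTaut (D j i) h s = evalDual (ξ i) h s • res (bundleQ k) h (q j)

lemma IsAdapted.restrict {ξ : Fin 2 → Γ(dual (bundleS k), U)} {q : Fin 3 → Γ(bundleQ k, U)}
    {D : Fin 3 → Fin 2 → Γ(TG k, U)} (hD : IsAdapted ξ q D) (h : V ≤ U) :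
    IsAdapted (fun i => res _ h (ξ i)) (fun j => res _ h (q j)) (fun j i => res _ h (D j i)) where
  frame_dual := hD.frame_dual.restrict h
  frame_quot := hD.frame_quot.restrict h
  deriv i j W h' s := by
    rw [res_res]
    exact hD.deriv i j W (h'.trans h) s

/-- Evaluation of local sections of the dual at a section, as a linear map. -/
def evalDualₗ {X : Scheme.{u}} {M : X.Modules} {U V : X.Opens} (h : V ≤ U) (x : Γ(M, V)) :
    Γ(dual M, U) →ₛₗ[resRing h] Γ(X, V) where
  toFun f := evalDual f h x
  map_add' _ _ := rfl
  map_smul' _ _ := rfl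

/-- A local section of the dual as a linear form on sections. -/
def evalDualArgₗ {X : Scheme.{u}} {M : X.Modules} {U V : X.Opens} (f : Γ(dual M, U)) (h : V ≤ U) :
    Γ(M, V) →ₗ[Γ(X, V)] Γ(X, V) where
  toFun := evalDual f h
  map_add' := map_add (LocalHom.app (M := M) (N := structureModule X) (U := U) f V h)
  map_smul' := map_smul (LocalHom.app (M := M) (N := structureModule X) (U := U) f V h)

/-- The derivative of a section of the tautological bundle along vector fields is linear in the
vector field. -/
def derivTautFieldₗ (h : V ≤ U) (s : Γ(bundleS k, V)) :
    Γ(TG k, U) →ₛₗ[resRing h] Γ(bundleQ k, V) where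
  toFun D := derivTaut D h s
  map_add' _ _ := map_add (tautQuot.mkₗ V) _ _
  map_smul' r _ := map_smul (tautQuot.mkₗ V) (resRing h r) _

/-- The vector fields attached to frames of `S^*` and `Q` change by the Kronecker product of the
matrices of the changes of frames. -/
lemma IsAdapted.change {ξ ξ' : Fin 2 → Γ(dual (bundleS k), U)} {q q' : Fin 3 → Γ(bundleQ k, U)}
    {D D' : Fin 3 → Fin 2 → Γ(TG k, U)} (hD : IsAdapted ξ q D) (hD' : IsAdapted ξ' q' D')
    {A : Matrix (Fin 2) (Fin 2) Γ(G25 k, U)} {B : Matrix (Fin 3) (Fin 3) Γ(G25 k, U)}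
    (hA : ξ' = fun i => ∑ a, A i a • ξ a) (hB : q' = fun j => ∑ c, B j c • q c) (j : Fin 3)
    (i : Fin 2) :
    D' j i = ∑ p : Fin 3 × Fin 2, Matrix.kroneckerMap (· * ·) B A (j, i) p • D p.1 p.2 := by
  refine derivTaut_injective fun V h s => ?_
  rw [hD'.deriv i j V h s]
  change _ = derivTautFieldₗ h s _
  rw [map_sum]
  have h1 : ∀ p : Fin 3 × Fin 2, derivTautFieldₗ h s
      (Matrix.kroneckerMap (· * ·) B A (j, i) p • D p.1 p.2) =
      (resRing h (A i p.2) * evalDual (ξ p.2) h s) • (resRing h (B j p.1) • res _ h (q p.1)) := by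
    intro p
    rw [LinearMap.map_smulₛₗ]
    refine (congrArg _ (hD.deriv p.2 p.1 V h s)).trans ?_
    rw [Matrix.kroneckerMap_apply, map_mul, smul_smul, smul_smul]
    congr 1
    ring
  have h2 : evalDual (ξ' i) h s = ∑ a, resRing h (A i a) * evalDual (ξ a) h s := by
    rw [hA]
    change evalDualₗ h s (∑ a, A i a • ξ a) = _
    rw [map_sum]
    exact Finset.sum_congr rfl fun a _ => LinearMap.map_smulₛₗ _ _ _
  have h3 : res _ h (q' j) = ∑ c, resRing h (B j c) • res _ h (q c) := by
    rw [hB]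
    change res _ h (∑ c, _) = _
    rw [map_sum]
    exact Finset.sum_congr rfl fun a _ => LinearMap.map_smulₛₗ _ _ _
  rw [h2, h3, Fintype.sum_prod_type_right, Finset.sum_smul]
  refine Finset.sum_congr rfl fun a _ => ?_
  rw [Finset.smul_sum]
  exact Finset.sum_congr rfl fun c _ => (h1 (c, a)).symm

variable (I : Fin 2 ↪o Fin 5)

lemma exists_notMem_equiv : Nonempty (Fin 3 ≃ {j : Fin 5 // j ∉ Set.range I}) := by
  refine ⟨(Fintype.equivFinOfCardEq ?_).symm⟩
  have h := Fintype.card_subtype_compl (fun j : Fin 5 => j ∈ Set.range I)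
  rw [h]
  have h2 : Fintype.card {j : Fin 5 // j ∈ Set.range I} = 2 := by
    exact (Fintype.card_congr (Equiv.ofInjective I I.injective).symm).trans (Fintype.card_fin 2)
  rw [h2]
  rfl

/-- A numbering of the three columns outside a chart. -/
def complEquiv : Fin 3 ≃ {j : Fin 5 // j ∉ Set.range I} := (exists_notMem_equiv I).some

variable (k) in
/-- The coordinates of a section of `S` at the columns of a chart. -/
def chartDual (a : Fin 2) : Γ(dual (bundleS k), chartOpen k I) :=
  LocalHom.ofFrame (N := structureModule (G25 k)) (isFrameOn_tautRow I le_rfl)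
    fun b => if a = b then (1 : Γ(G25 k, chartOpen k I)) else 0

variable (k) in
/-- The classes of the standard basis vectors outside the columns of a chart. -/
def chartQuot (j : Fin 3) : Γ(bundleQ k, chartOpen k I) := quotClass (chartOpen k I) (complEquiv I j).1

variable (k) in
/-- The coordinate vector fields of a chart. -/
def chartField (j : Fin 3) (i : Fin 2) : Γ(TG k, chartOpen k I) := coordField I (i, complEquiv I j)

lemma evalDual_chartDual (a b : Fin 2) :
    evalDual (chartDual k I a) le_rfl (tautRow I le_rfl b) = if a = b then 1 else 0 :=
  LocalHom.ofFrame_apply (N := structureModule (G25 k)) (isFrameOn_tautRow I le_rfl) _ b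

lemma isFrameOn_chartField :
    IsFrameOn fun p : Fin 3 × Fin 2 => chartField k I p.1 p.2 :=
  (isFrameOn_coordField I).reindex
    ((Equiv.prodComm _ _).trans (Equiv.prodCongr (Equiv.refl _) (complEquiv I)))

/-- On a chart, `∂/∂x_{i j}` corresponds to `ξ_i ⊗ q_j`, where `ξ_i` is the coordinate at the column
`I i` and `q_j` is the class of the basis vector `e_j`. -/
lemma isAdapted_chart : IsAdapted (chartDual k I) (chartQuot k I) (chartField k I) where
  frame_dual := (isFrameOn_tautRow I le_rfl).sheafHom isFrameOn_one (evalDual_chartDual I)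
  frame_quot := (isFrameOn_quotClass I le_rfl).reindex (complEquiv I)
  deriv i j V h s := by
    have h1 : ∀ b, evalDual (chartDual k I i) h (tautRow I h b) = if i = b then 1 else 0 := by
      intro b
      rw [← res_tautRow I le_rfl h b]
      refine (res_evalHom le_rfl h (chartDual k I i) _).symm.trans ?_
      refine (congrArg (resRing h) (evalDual_chartDual I i b)).trans ?_
      split_ifs
      · exact map_one _
      · exact map_zero _
    have h2 : ∀ b, derivTaut (chartField k I j i) h (tautRow I h b) =
        evalDual (chartDual k I i) h (tautRow I h b) • res (bundleQ k) h (chartQuot k I j) := by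
      intro b
      rw [derivTaut_tautRow, h1, chartField, chartQuot, res_quotClass]
      simp only [applyDer_coordField, Prod.mk.injEq]
      rw [Finset.sum_eq_single (complEquiv I j)]
      · simp
      · intro c _ hc
        rw [if_neg fun hh => hc hh.2.symm, zero_smul]
      · simp
    rw [eq_sum_tautRow I h s]
    change derivTautₗ _ h _ = evalDualArgₗ (chartDual k I i) h _ • _
    rw [map_sum, map_sum, Finset.sum_smul]
    refine Finset.sum_congr rfl fun b _ => ?_
    rw [map_smul, map_smul]
    refine (congrArg _ (h2 b)).trans ?_
    rw [smul_smul]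
    rfl

/-- Adapted vector fields form a frame of the tangent bundle. -/
lemma IsAdapted.isFrameOn {ξ : Fin 2 → Γ(dual (bundleS k), U)} {q : Fin 3 → Γ(bundleQ k, U)}
    {D : Fin 3 → Fin 2 → Γ(TG k, U)} (hD : IsAdapted ξ q D) :
    IsFrameOn fun p : Fin 3 × Fin 2 => D p.1 p.2 := by
  refine IsFrameOn.of_forall_mem fun x hx => ?_
  obtain ⟨I, hI⟩ := exists_mem_chartOpen x
  let W := U ⊓ chartOpen k I
  have hWU : W ≤ U := inf_le_left
  have hWI : W ≤ chartOpen k I := inf_le_right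
  refine ⟨W, hWU, ⟨hx, hI⟩, ?_⟩
  have h1 := hD.restrict hWU
  have h2 := (isAdapted_chart (k := k) I).restrict hWI
  obtain ⟨A, hA, hA'⟩ := h2.frame_dual.exists_matrix h1.frame_dual
  obtain ⟨B, hB, hB'⟩ := h2.frame_quot.exists_matrix h1.frame_quot
  have h3 : (fun p : Fin 3 × Fin 2 => res _ hWU (D p.1 p.2)) = fun p => ∑ p',
      Matrix.kroneckerMap (· * ·) B A p p' • res _ hWI (chartField k I p'.1 p'.2) :=
    funext fun p => h2.change h1 hA' hB' p.1 p.2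
  rw [h3]
  refine ((isFrameOn_chartField I).restrict hWI).of_matrix ?_
  rw [Matrix.det_kronecker]
  exact (hB.pow _).mul (hA.pow _)

/-- The six vector fields in the order in which they enter the orientation. -/
lemma vecCons_eq_comp (D : Fin 3 → Fin 2 → Γ(TG k, U)) :
    ![D 0 0, D 0 1, D 1 0, D 1 1, D 2 0, D 2 1] =
      (fun p : Fin 3 × Fin 2 => D p.1 p.2) ∘ (finProdFinEquiv (m := 3) (n := 2)).symm := by
  funext i
  fin_cases i <;> rfl

lemma IsAdapted.isFrameOn_vecCons {ξ : Fin 2 → Γ(dual (bundleS k), U)}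
    {q : Fin 3 → Γ(bundleQ k, U)} {D : Fin 3 → Fin 2 → Γ(TG k, U)} (hD : IsAdapted ξ q D) :
    IsFrameOn ![D 0 0, D 0 1, D 1 0, D 1 1, D 2 0, D 2 1] := by
  rw [vecCons_eq_comp]
  exact hD.isFrameOn.reindex _

/-- The determinant of the change of adapted vector fields. -/
lemma IsAdapted.wedge_change {ξ ξ' : Fin 2 → Γ(dual (bundleS k), U)}
    {q q' : Fin 3 → Γ(bundleQ k, U)} {D D' : Fin 3 → Fin 2 → Γ(TG k, U)} (hD : IsAdapted ξ q D)
    (hD' : IsAdapted ξ' q' D') {A : Matrix (Fin 2) (Fin 2) Γ(G25 k, U)}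
    {B : Matrix (Fin 3) (Fin 3) Γ(G25 k, U)}
    (hA : ξ' = fun i => ∑ a, A i a • ξ a) (hB : q' = fun j => ∑ c, B j c • q c) :
    wedge ![D' 0 0, D' 0 1, D' 1 0, D' 1 1, D' 2 0, D' 2 1] =
      (B.det ^ 2 * A.det ^ 3) • wedge ![D 0 0, D 0 1, D 1 0, D 1 1, D 2 0, D 2 1] := by
  let e := (finProdFinEquiv (m := 3) (n := 2)).symm
  have h : ![D' 0 0, D' 0 1, D' 1 0, D' 1 1, D' 2 0, D' 2 1] = fun i : Fin 6 =>
      ∑ j : Fin 6, (Matrix.kroneckerMap (· * ·) B A).submatrix e e i j •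
        ![D 0 0, D 0 1, D 1 0, D 1 1, D 2 0, D 2 1] j := by
    rw [vecCons_eq_comp, vecCons_eq_comp]
    funext i
    refine (hD.change hD' hA hB (e i).1 (e i).2).trans ?_
    exact (Equiv.sum_comp e fun p => Matrix.kroneckerMap (· * ·) B A (e i) p • D p.1 p.2).symm
  rw [h, wedge_linearCombination, Matrix.det_submatrix_equiv_self, Matrix.det_kronecker]
  simp

end Adapted

/-! ### The canonical isomorphism -/

section Orientation
variable {k : Type u} [Field k] {U V : (G25 k).Opens}

/-- The dual basis of a frame of a sheaf of modules is a frame of the dual. -/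
lemma IsFrameOn.dual {X : Scheme.{u}} {M : X.Modules} {U : X.Opens} {r : ℕ} {q : Fin r → Γ(M, U)}
    (hq : IsFrameOn q) {ψ : Fin r → Γ(Grass.dual M, U)}
    (hψ : ∀ i j, evalDual (ψ i) le_rfl (q j) = if i = j then 1 else 0) : IsFrameOn ψ :=
  hq.sheafHom isFrameOn_one hψ

/-- The matrix of the change of the dual frames is the inverse transpose. -/
lemma exists_dual_change {X : Scheme.{u}} {M : X.Modules} {U : X.Opens} {r : ℕ}
    {q q' : Fin r → Γ(M, U)} {ψ ψ' : Fin r → Γ(dual M, U)} (hq : IsFrameOn q)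
    (hψ : ∀ i j, evalDual (ψ i) le_rfl (q j) = if i = j then 1 else 0)
    (hψ' : ∀ i j, evalDual (ψ' i) le_rfl (q' j) = if i = j then 1 else 0)
    {B : Matrix (Fin r) (Fin r) Γ(X, U)} (hB : q' = fun j => ∑ c, B j c • q c) :
    ∃ C : Matrix (Fin r) (Fin r) Γ(X, U), C.det * B.det = 1 ∧ ψ' = fun i => ∑ c, C i c • ψ c := by
  have hψf := hq.dual hψ
  refine ⟨Matrix.of fun i c => (hψf.basis le_rfl).repr (ψ' i) c, ?_, ?_⟩
  · rw [← Matrix.det_transpose B, ← Matrix.det_mul, ← Matrix.det_one (n := Fin r)]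
    congr 1
    ext i j
    rw [Matrix.one_apply, ← hψ' i j, hB]
    conv_rhs => rw [← hψf.sum_repr (ψ' i)]
    change _ = evalDualₗ le_rfl _ _
    rw [map_sum, Matrix.mul_apply]
    refine Finset.sum_congr rfl fun c _ => ?_
    rw [LinearMap.map_smulₛₗ, resRing_id, smul_eq_mul]
    refine congrArg _ ?_
    change _ = evalDualArgₗ (ψ c) le_rfl _
    rw [map_sum, Finset.sum_eq_single c]
    · rw [map_smul]
      change _ = B j c * evalDual (ψ c) le_rfl (q c)
      rw [hψ, if_pos rfl, mul_one, Matrix.transpose_apply]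
    · intro d _ hd
      rw [map_smul]
      change B j d * evalDual (ψ c) le_rfl (q d) = 0
      rw [hψ, if_neg hd.symm, mul_zero]
    · simp
  · funext i
    exact (hψf.sum_repr (ψ' i)).symm

lemma isFrameOn_frameSection {ξ : Fin 2 → Γ(dual (bundleS k), U)}
    {ψ : Fin 3 → Γ(dual (bundleQ k), U)} (hξ : IsFrameOn ξ) (hψ : IsFrameOn ψ) :
    IsFrameOn fun _ : Fin 1 => frameSection k ξ ψ :=
  hψ.wedge.tensorSection_single (hξ.wedge.tensorPowSection 6)

lemma res_frameSection (h : V ≤ U) (ξ : Fin 2 → Γ(dual (bundleS k), U))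
    (ψ : Fin 3 → Γ(dual (bundleQ k), U)) :
    res _ h (frameSection k ξ ψ) =
      frameSection k (fun i => res _ h (ξ i)) (fun j => res _ h (ψ j)) := by
  refine (res_tensorSection h _ _).trans ?_
  rw [res_wedge, res_tensorPowSection, res_wedge]
  rfl

lemma frameSection_change (A : Matrix (Fin 2) (Fin 2) Γ(G25 k, U))
    (C : Matrix (Fin 3) (Fin 3) Γ(G25 k, U)) (ξ : Fin 2 → Γ(dual (bundleS k), U))
    (ψ : Fin 3 → Γ(dual (bundleQ k), U)) :
    frameSection k (fun i => ∑ a, A i a • ξ a) (fun j => ∑ c, C j c • ψ c) =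
      (C.det * A.det ^ 6) • frameSection k ξ ψ := by
  rw [frameSection, wedge_linearCombination, wedge_linearCombination, tensorPowSection_smul,
    tensorSection_smul_smul]
  rfl

variable (k) in
/-- The pairs of local sections that a canonical isomorphism `Hom(det TG, det E) ≅ L ⊗ L` has to
match. -/
def IsCanonicalPair (U : (G25 k).Opens)
    (ω : Γ(sheafHom (extPow 6 (TG k)) (extPow 6 (bundleE k)), U))
    (y : Γ(tensor (bundleL k) (bundleL k), U)) : Prop :=
  ∃ (ξ : Fin 2 → Γ(dual (bundleS k), U)) (q : Fin 3 → Γ(bundleQ k, U))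
    (ψ : Fin 3 → Γ(dual (bundleQ k), U)) (D : Fin 3 → Fin 2 → Γ(TG k, U)),
    IsAdapted ξ q D ∧ (∀ i j, evalDual (ψ i) le_rfl (q j) = if i = j then 1 else 0) ∧
    evalHom ω le_rfl (wedge ![D 0 0, D 0 1, D 1 0, D 1 1, D 2 0, D 2 1]) =
      wedge (quinticSection ξ) ∧
    y = tensorSection (frameSection k ξ ψ) (frameSection k ξ ψ)

lemma isCanonical_iff
    (φ : sheafHom (extPow 6 (TG k)) (extPow 6 (bundleE k)) ≅ tensor (bundleL k) (bundleL k)) :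
    IsCanonical k φ ↔ ∀ U ω y, IsCanonicalPair k U ω y → φ.hom.app U ω = y := by
  constructor
  · rintro h U ω _ ⟨ξ, q, ψ, D, hD, hψ, hω, rfl⟩
    exact h U ξ q ψ D ω hD.frame_dual hD.frame_quot hψ hD.deriv hω
  · intro h U ξ q ψ D ω hξ hq hψ hD hω
    exact h U ω _ ⟨ξ, q, ψ, D, ⟨hξ, hq, hD⟩, hψ, hω, rfl⟩

lemma IsCanonicalPair.restrict {ω : Γ(sheafHom (extPow 6 (TG k)) (extPow 6 (bundleE k)), U)}
    {y : Γ(tensor (bundleL k) (bundleL k), U)} (h : IsCanonicalPair k U ω y) (hV : V ≤ U) :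
    IsCanonicalPair k V (res _ hV ω) (res _ hV y) := by
  obtain ⟨ξ, q, ψ, D, hD, hψ, hω, rfl⟩ := h
  refine ⟨_, _, fun j => res _ hV (ψ j), _, hD.restrict hV, ?_, ?_, ?_⟩
  · intro i j
    refine (res_evalHom le_rfl hV (ψ i) (q j)).symm.trans ?_
    refine (congrArg (resRing hV) (hψ i j)).trans ?_
    split_ifs
    · exact map_one _
    · exact map_zero _
  · have h1 := congrArg (res _ hV) hω
    rw [res_evalHom, res_wedge] at h1
    refine Eq.trans ?_ (h1.trans ((res_wedge hV (M := symPow 5 (dual (bundleS k)))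
      (quinticSection ξ)).trans (congrArg wedge (funext fun i => res_quinticSection hV ξ i))))
    refine congrArg (fun v : Fin 6 → Γ(TG k, V) => evalHom ω hV (wedge v)) (funext fun i => ?_)
    fin_cases i <;> rfl
  · rw [res_tensorSection, res_frameSection]

lemma IsCanonicalPair.isFrameOn_left
    {ω : Γ(sheafHom (extPow 6 (TG k)) (extPow 6 (bundleE k)), U)}
    {y : Γ(tensor (bundleL k) (bundleL k), U)} (h : IsCanonicalPair k U ω y) :
    IsFrameOn fun _ : Fin 1 => ω := by
  obtain ⟨ξ, q, ψ, D, hD, hψ, hω, rfl⟩ := h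
  exact hD.isFrameOn_vecCons.wedge.sheafHom hD.frame_dual.quinticSection.wedge fun i j => by
    rw [if_pos (Subsingleton.elim i j)]
    exact hω

lemma IsCanonicalPair.isFrameOn_right
    {ω : Γ(sheafHom (extPow 6 (TG k)) (extPow 6 (bundleE k)), U)}
    {y : Γ(tensor (bundleL k) (bundleL k), U)} (h : IsCanonicalPair k U ω y) :
    IsFrameOn fun _ : Fin 1 => y := by
  obtain ⟨ξ, q, ψ, D, hD, hψ, hω, rfl⟩ := h
  have := isFrameOn_frameSection hD.frame_dual (hD.frame_quot.dual hψ)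
  exact this.tensorSection_single this

/-- Both sides of the canonical isomorphism change by the factor `det A ^ 12 * det B ^ (-2)` under a
change of the frames of `S^*` and `Q` by `A` and `B`. -/
lemma IsCanonicalPair.proportional
    {ω ω' : Γ(sheafHom (extPow 6 (TG k)) (extPow 6 (bundleE k)), U)}
    {y y' : Γ(tensor (bundleL k) (bundleL k), U)} (h : IsCanonicalPair k U ω y)
    (h' : IsCanonicalPair k U ω' y') : ∃ c : Γ(G25 k, U), ω' = c • ω ∧ y' = c • y := by
  obtain ⟨ξ, q, ψ, D, hD, hψ, hω, rfl⟩ := h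
  obtain ⟨ξ', q', ψ', D', hD', hψ', hω', rfl⟩ := h'
  obtain ⟨A, hA, hA'⟩ := hD.frame_dual.exists_matrix hD'.frame_dual
  obtain ⟨B, hB, hB'⟩ := hD.frame_quot.exists_matrix hD'.frame_quot
  obtain ⟨C, hC, hC'⟩ := exists_dual_change hD.frame_quot hψ hψ' hB'
  refine ⟨A.det ^ 12 * C.det ^ 2, ?_, ?_⟩
  · refine evalHom_ext hD.isFrameOn_vecCons.wedge fun _ => ?_
    -- the vector fields change by `B ⊗ A`, hence their exterior product by `det B ^ 2 * det A ^ 3`,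
    -- and the quintic monomials change by `Sym⁵ A`, whose determinant is `det A ^ 15`
    have hu : IsUnit (B.det ^ 2 * A.det ^ 3) := (hB.pow 2).mul (hA.pow 3)
    have e1 : (B.det ^ 2 * A.det ^ 3) • evalHom ω' le_rfl
        (wedge ![D 0 0, D 0 1, D 1 0, D 1 1, D 2 0, D 2 1]) = A.det ^ 15 • wedge (quinticSection ξ) := by
      rw [← wedge_quinticSection_linearCombination, ← hA', ← hω', hD.wedge_change hD' hA' hB']
      exact (map_smul (LocalHom.app (M := extPow 6 (TG k)) (N := extPow 6 (bundleE k)) (U := U) ω'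
        U le_rfl) _ _).symm
    have e2 : A.det ^ 15 = B.det ^ 2 * A.det ^ 3 * (A.det ^ 12 * C.det ^ 2) := by
      calc A.det ^ 15 = (C.det * B.det) ^ 2 * A.det ^ 15 := by rw [hC, one_pow, one_mul]
        _ = _ := by ring
    refine hu.smul_left_cancel.1 (e1.trans ?_)
    rw [evalHom_smul, resRing_id, hω]
    exact (congrArg (· • wedge (quinticSection ξ)) e2).trans (mul_smul _ _ _)
  · rw [hA', hC', frameSection_change, tensorSection_smul_smul]
    congr 1
    ring

variable (I : Fin 2 ↪o Fin 5)

variable (k) in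
/-- The dual basis of the basis `chartQuot` of `Q`. -/
def chartQuotDual (i : Fin 3) : Γ(dual (bundleQ k), chartOpen k I) :=
  LocalHom.ofFrame (N := structureModule (G25 k)) (isAdapted_chart (k := k) I).frame_quot
    fun j => if i = j then (1 : Γ(G25 k, chartOpen k I)) else 0

lemma evalDual_chartQuotDual (i j : Fin 3) :
    evalDual (chartQuotDual k I i) le_rfl (chartQuot k I j) = if i = j then 1 else 0 :=
  LocalHom.ofFrame_apply (N := structureModule (G25 k)) (isAdapted_chart (k := k) I).frame_quot _ j

/-- The charts carry pairs of the kind that the canonical isomorphism has to match. -/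
lemma exists_isCanonicalPair :
    ∃ ω y, IsCanonicalPair k (chartOpen k I) ω y := by
  refine ⟨LocalHom.ofFrame (M := extPow 6 (TG k)) (N := extPow 6 (bundleE k))
    (isAdapted_chart (k := k) I).isFrameOn_vecCons.wedge
      fun _ => wedge (quinticSection (chartDual k I)), _, chartDual k I, chartQuot k I,
    chartQuotDual k I, chartField k I, isAdapted_chart I, evalDual_chartQuotDual I, ?_, rfl⟩
  exact LocalHom.ofFrame_apply (M := extPow 6 (TG k)) (N := extPow 6 (bundleE k)) _ _ 0

variable (k)

lemma isVectorBundle_TG : IsVectorBundle (TG k) 6 := fun x => by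
  obtain ⟨I, hI⟩ := exists_mem_chartOpen x
  exact ⟨_, _, hI, (isAdapted_chart I).isFrameOn_vecCons⟩

lemma isVectorBundle_bundleE : IsVectorBundle (bundleE k) 6 := fun x => by
  obtain ⟨I, hI⟩ := exists_mem_chartOpen x
  exact ⟨_, _, hI, (isAdapted_chart I).frame_dual.quinticSection⟩

lemma isVectorBundle_bundleL : IsVectorBundle (bundleL k) 1 := fun x => by
  obtain ⟨I, hI⟩ := exists_mem_chartOpen x
  exact ⟨_, _, hI, isFrameOn_frameSection (isAdapted_chart I).frame_dual
    ((isAdapted_chart I).frame_quot.dual (evalDual_chartQuotDual I))⟩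

lemma existsUnique_isCanonical :
    ∃! φ : sheafHom (extPow 6 (TG k)) (extPow 6 (bundleE k)) ≅ tensor (bundleL k) (bundleL k),
      IsCanonical k φ := by
  simp only [isCanonical_iff]
  refine existsUnique_iso_of_generators (IsCanonicalPair k) (fun U m n h => h.isFrameOn_left)
    (fun U m n h => h.isFrameOn_right) (fun U U' m m' n n' h h' => ?_) fun x => ?_
  · exact (h.restrict inf_le_left).proportional (h'.restrict inf_le_right)
  · obtain ⟨I, hI⟩ := exists_mem_chartOpen x
    obtain ⟨ω, y, h⟩ := exists_isCanonicalPair (k := k) I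
    exact ⟨_, ω, y, hI, h⟩

end Orientation
end Grass

end

theorem mainTheorem7 (k : Type u) [Field k] :
    Grass.IsRelativelyOrientable (Grass.Gr.toBase k 2 5) 6 (Grass.bundleE k) 6 ∧
    Grass.IsVectorBundle (Grass.bundleL k) 1 ∧
    ∃! φ : Grass.sheafHom (Grass.extPow 6 (Grass.TG k)) (Grass.extPow 6 (Grass.bundleE k)) ≅
        Grass.tensor (Grass.bundleL k) (Grass.bundleL k),
      Grass.IsCanonical k φ := by
  have h := Grass.existsUnique_isCanonical k
  exact ⟨⟨Grass.isVectorBundle_TG k, Grass.isVectorBundle_bundleE k, Grass.bundleL k,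
    Grass.isVectorBundle_bundleL k, ⟨h.exists.choose⟩⟩, Grass.isVectorBundle_bundleL k, h⟩
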